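/- Let $\mathbb{K}=\mathbb{R}$ or $\mathbb{C}$. Consider a system $(\mathcal{E}_5)$ of partial differential equations for one unknown function $y(x^1,x^2)$, $$y_{x^2}=F(x^1,x^2,y,y_{x^1},y_{x^1x^1}),\qquad y_{x^1x^1x^1}=G(x^1,x^2,y,y_{x^1},y_{x^1x^1}),$$ with $F,G$ $\mathbb{K}$-analytic near the origin of $\mathbb{K}^5$, where the coordinates are $(x^1,x^2,y,y_1,y_{1,1})$. Put $$D_1=\partial_{x^1}+y_1\partial_y+y_{1,1}\partial_{y_1}+G\,\partial_{y_{1,1}},\quad H=D_1F,\quad K=D_1H,\quad D_2=\partial_{x^2}+F\,\partial_y+H\,\partial_{y_1}+K\,\partial_{y_{1,1}},$$ so that $y_{x^1x^2}=H$ and $y_{x^1x^1x^2}=K$ on solutions. Assume that the system is completely integrable, i.e. that near the origin $[D_1,D_2]$ is a linear combination of $D_1,D_2$, and that it is normalized at the origin, i.e. that near the origin $$\begin{aligned}F={}&\tfrac14 (y_1)^2+(y_1)^3\mathsf r+(y_1)^4\mathsf r+(y_1)^5\mathsf r+(y_1)^6\mathsf R+y_{1,1}\big[(y_1)^2\mathsf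 s^*+(y_1)^3\mathsf r+(y_1)^4\mathsf r+(y_1)^5\mathsf r\big]+(y_{1,1})^2\mathsf R,\\ G={}&(y_1)^3\mathsf r+(y_1)^4\mathsf R+y_{1,1}\big[\mathsf r+y_1\mathsf r+(y_1)^2\mathsf r+(y_1)^3\mathsf r\big]+(y_{1,1})^2\big[\mathsf r+y_1\mathsf r+(y_1)^2\mathsf r+(y_1)^3\mathsf r\big]+(y_{1,1})^3\mathsf R,\end{aligned}$$ where each letter $\mathsf r$ stands for some (each time possibly different) analytic function of $(x^1,x^2)$, each letter $\mathsf R$ for some analytic function of $(x^1,x^2,y,y_1,y_{1,1})$, and where $\mathsf s^*=\mathsf s^*(x^1,x^2)$ is analytic with $\mathsf s^*(0)=0$ and $\mathsf s^*_{x^2}(0)=0$. An infinitesimal Lie symmetry of $(\mathcal{E}_5)$ is a vector field $\mathcal L=\mathcal X^1\partial_{x^1}+\mathcal X^2\partial_{x^2}+\mathcal Y\partial_y$, with coefficients analytic functions of $(x^1,x^2,y)$ near the origin, whose time-$t$ flow map, for every small $t$, transforms the graphs of solutions of $(\mathcal{E}_5)$ into graphs of solutions (locally, for solutions with $(x^1,x^2,y,y_{x^1},y_{x^1x^1})$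 near the origin). Let $\mathfrak{SYM}(\mathcal{E}_5)$ be the $\mathbb{K}$-vector space of germs at the origin of such fields. Then every infinitesimal Lie symmetry is uniquely determined, as a germ at the origin, by the ten initial Taylor coefficients $$\mathcal X^1(0),\ \mathcal X^2(0),\ \mathcal Y(0),\ \mathcal X^1_y(0),\ \mathcal X^2_{x^2}(0),\ \mathcal Y_{x^1}(0),\ \mathcal Y_y(0),\ \mathcal X^2_{x^1x^2}(0),\ \mathcal Y_{x^1x^1}(0),\ \mathcal Y_{yy}(0):$$ two infinitesimal Lie symmetries with the same ten coefficients coincide near the origin. Hence $\dim_{\mathbb{K}}\mathfrak{SYM}(\mathcal{E}_5)\leqslant 10$. -/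

import Mathlib

open Filter Topology

noncomputable section

namespace EFive

variable {𝕜 : Type*} [RCLike 𝕜]

/-- Partial derivative in the `i`-th coordinate direction. -/
def pd {n : ℕ} (i : Fin n) (f : (Fin n → 𝕜) → 𝕜) (p : Fin n → 𝕜) : 𝕜 :=
  fderiv 𝕜 f p (Pi.single i 1)

/-!
Coordinates. Independent variables `(x¹, x²)`: `Fin 2 → 𝕜`. The space of `(x¹, x², y)`:
`Fin 3 → 𝕜`. The skeleton, with its natural coordinates `(x¹, x², y, y₁, y₁₁)`: `Fin 5 → 𝕜`.
A system `y_{x²} = F(x¹, x², y, y_{x¹}, y_{x¹x¹})`, `y_{x¹x¹x¹} = G(same arguments)` is given by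
the pair of functions `F G : (Fin 5 → 𝕜) → 𝕜`, which matter only near the origin.
-/

/-- The point `(x, u(x))` of the graph of `u`. -/
def graphPt (u : (Fin 2 → 𝕜) → 𝕜) (x : Fin 2 → 𝕜) : Fin 3 → 𝕜 :=
  ![x 0, x 1, u x]

/-- The projection `(x¹, x², y) ↦ (x¹, x²)`. -/
def basePt (p : Fin 3 → 𝕜) : Fin 2 → 𝕜 :=
  ![p 0, p 1]

/-- `(x¹, x², u, u_{x¹}, u_{x¹x¹})` at `x`. -/
def jet (u : (Fin 2 → 𝕜) → 𝕜) (x : Fin 2 → 𝕜) : Fin 5 → 𝕜 :=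
  ![x 0, x 1, u x, pd 0 u x, pd 0 (pd 0 u) x]

/-- `u` is a (local) solution of the system `(F, G)` in a neighbourhood of `x`. -/
def IsSolutionAt (F G : (Fin 5 → 𝕜) → 𝕜) (u : (Fin 2 → 𝕜) → 𝕜) (x : Fin 2 → 𝕜) : Prop :=
  ContDiffAt 𝕜 3 u x ∧
    ∀ᶠ ξ in 𝓝 x, pd 1 u ξ = F (jet u ξ) ∧ pd 0 (pd 0 (pd 0 u)) ξ = G (jet u ξ)

/-- The total derivative `D₁ = ∂_{x¹} + y₁ ∂_y + y₁₁ ∂_{y₁} + G ∂_{y₁₁}` on the skeleton. -/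
def D₁ (G : (Fin 5 → 𝕜) → 𝕜) (z : Fin 5 → 𝕜) : Fin 5 → 𝕜 :=
  ![1, 0, z 3, z 4, G z]

/-- The right-hand side of the equation `y_{x¹x²} = H`, namely `H = D₁ F`. -/
def H (F G : (Fin 5 → 𝕜) → 𝕜) (z : Fin 5 → 𝕜) : 𝕜 :=
  fderiv 𝕜 F z (D₁ G z)

/-- The right-hand side of the equation `y_{x¹x¹x²} = K`, namely `K = D₁ H`. -/
def K (F G : (Fin 5 → 𝕜) → 𝕜) (z : Fin 5 → 𝕜) : 𝕜 :=
  fderiv 𝕜 (H F G) z (D₁ G z)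

/-- The total derivative `D₂ = ∂_{x²} + F ∂_y + H ∂_{y₁} + K ∂_{y₁₁}` on the skeleton. -/
def D₂ (F G : (Fin 5 → 𝕜) → 𝕜) (z : Fin 5 → 𝕜) : Fin 5 → 𝕜 :=
  ![0, 1, F z, H F G z, K F G z]

/-- Complete integrability: near the origin of the skeleton, the Lie bracket `[D₁, D₂]` is a
linear combination of `D₁` and `D₂`. -/
def IsCompletelyIntegrable (F G : (Fin 5 → 𝕜) → 𝕜) : Prop :=
  ∀ᶠ z in 𝓝 (0 : Fin 5 → 𝕜),
    VectorField.lieBracket 𝕜 (D₁ G) (D₂ F G) z ∈ Submodule.span 𝕜 {D₁ G z, D₂ F G z}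

/-- The normal form of the skeleton at the origin. The coefficients `a`, `b`, `c`, `d`, `e` and
`s` are analytic functions of `(x¹, x²)` only, the remainders `R i` are arbitrary analytic
functions of all the variables, and `s` vanishes at `0` together with its first `x²`-derivative.
The equation for `y_{x¹x²}` is not listed, since its right-hand side `H = D₁ F` is determined by
`F` and `G`. -/
def IsNormalized (F G : (Fin 5 → 𝕜) → 𝕜) : Prop :=
  ∃ (a b : Fin 3 → (Fin 2 → 𝕜) → 𝕜) (s c : (Fin 2 → 𝕜) → 𝕜) (d e : Fin 4 → (Fin 2 → 𝕜) → 𝕜)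
    (R : Fin 4 → (Fin 5 → 𝕜) → 𝕜),
    (∀ i, AnalyticAt 𝕜 (a i) 0) ∧ (∀ i, AnalyticAt 𝕜 (b i) 0) ∧
    AnalyticAt 𝕜 s 0 ∧ AnalyticAt 𝕜 c 0 ∧
    (∀ i, AnalyticAt 𝕜 (d i) 0) ∧ (∀ i, AnalyticAt 𝕜 (e i) 0) ∧
    (∀ i, AnalyticAt 𝕜 (R i) 0) ∧
    s 0 = 0 ∧ pd 1 s 0 = 0 ∧
    ∀ᶠ z in 𝓝 (0 : Fin 5 → 𝕜),
      (F z = (1 / 4) * z 3 ^ 2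
          + z 3 ^ 3 * a 0 ![z 0, z 1] + z 3 ^ 4 * a 1 ![z 0, z 1] + z 3 ^ 5 * a 2 ![z 0, z 1]
          + z 3 ^ 6 * R 0 z
          + z 4 * (z 3 ^ 2 * s ![z 0, z 1] + z 3 ^ 3 * b 0 ![z 0, z 1]
              + z 3 ^ 4 * b 1 ![z 0, z 1] + z 3 ^ 5 * b 2 ![z 0, z 1])
          + z 4 ^ 2 * R 1 z) ∧
      (G z = z 3 ^ 3 * c ![z 0, z 1] + z 3 ^ 4 * R 2 z
          + z 4 * (d 0 ![z 0, z 1] + z 3 * d 1 ![z 0, z 1]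
              + z 3 ^ 2 * d 2 ![z 0, z 1] + z 3 ^ 3 * d 3 ![z 0, z 1])
          + z 4 ^ 2 * (e 0 ![z 0, z 1] + z 3 * e 1 ![z 0, z 1]
              + z 3 ^ 2 * e 2 ![z 0, z 1] + z 3 ^ 3 * e 3 ![z 0, z 1])
          + z 4 ^ 3 * R 3 z)

/-- The map `ψ` of `(x¹, x², y)`-space transforms (germs of) graphs of solutions, whose jet at
the point under consideration lies in `U`, into (germs of) graphs of solutions. -/
def IsLieSymmetryOn (F G : (Fin 5 → 𝕜) → 𝕜) (U : Set (Fin 5 → 𝕜))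
    (ψ : (Fin 3 → 𝕜) → (Fin 3 → 𝕜)) : Prop :=
  ∀ (u : (Fin 2 → 𝕜) → 𝕜) (x : Fin 2 → 𝕜), IsSolutionAt F G u x → jet u x ∈ U →
    ∃ v : (Fin 2 → 𝕜) → 𝕜, IsSolutionAt F G v (basePt (ψ (graphPt u x))) ∧
      ∀ᶠ ξ in 𝓝 x, ψ (graphPt u ξ) = graphPt v (basePt (ψ (graphPt u ξ)))

/-- `φ` is an analytic local flow, near the origin, of the vector field `L`. -/
def IsLocalFlow (L : (Fin 3 → 𝕜) → (Fin 3 → 𝕜)) (φ : 𝕜 → (Fin 3 → 𝕜) → (Fin 3 → 𝕜)) : Prop :=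
  AnalyticAt 𝕜 (fun q : 𝕜 × (Fin 3 → 𝕜) => φ q.1 q.2) (0, 0) ∧
    (∀ᶠ p in 𝓝 (0 : Fin 3 → 𝕜), φ 0 p = p) ∧
    ∀ᶠ q in 𝓝 ((0, 0) : 𝕜 × (Fin 3 → 𝕜)),
      HasDerivAt (fun t => φ t q.2) (L (φ q.1 q.2)) q.1

/-- The vector field `L = X¹ ∂_{x¹} + X² ∂_{x²} + Y ∂_y`, analytic at the origin, with
components `(L 0, L 1, L 2) = (X¹, X², Y)`, is an infinitesimal Lie symmetry of the system:
for every small `t`, its time-`t` flow map is a Lie symmetry, all of this being local near the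
origin. -/
def IsInfinitesimalSymmetry (F G : (Fin 5 → 𝕜) → 𝕜) (L : (Fin 3 → 𝕜) → (Fin 3 → 𝕜)) : Prop :=
  AnalyticAt 𝕜 L 0 ∧
    ∃ φ : 𝕜 → (Fin 3 → 𝕜) → (Fin 3 → 𝕜), IsLocalFlow L φ ∧
      ∃ U ∈ 𝓝 (0 : Fin 5 → 𝕜), ∀ᶠ t in 𝓝 (0 : 𝕜), IsLieSymmetryOn F G U (φ t)

/-- The space of germs at the origin of infinitesimal Lie symmetries. The linear span only
serves to have the vector space structure at hand. -/
def SYM (F G : (Fin 5 → 𝕜) → 𝕜) :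
    Submodule 𝕜 (Germ (𝓝 (0 : Fin 3 → 𝕜)) (Fin 3 → 𝕜)) :=
  Submodule.span 𝕜 {g | ∃ L : (Fin 3 → 𝕜) → (Fin 3 → 𝕜),
    IsInfinitesimalSymmetry F G L ∧ g = (L : Germ (𝓝 (0 : Fin 3 → 𝕜)) (Fin 3 → 𝕜))}

/-- The ten coefficients
`X¹, X², Y, X¹_y, X²_{x²}, Y_{x¹}, Y_y, X²_{x¹x²}, Y_{x¹x¹}, Y_{yy}` at the origin. -/
def initialCoeffs (L : (Fin 3 → 𝕜) → (Fin 3 → 𝕜)) : Fin 10 → 𝕜 :=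
  let X₁ : (Fin 3 → 𝕜) → 𝕜 := fun p => L p 0
  let X₂ : (Fin 3 → 𝕜) → 𝕜 := fun p => L p 1
  let Y : (Fin 3 → 𝕜) → 𝕜 := fun p => L p 2
  ![X₁ 0, X₂ 0, Y 0, pd 2 X₁ 0, pd 1 X₂ 0, pd 0 Y 0, pd 2 Y 0,
    pd 1 (pd 0 X₂) 0, pd 0 (pd 0 Y) 0, pd 2 (pd 2 Y) 0]

end EFive

end

/-! Two facts carry the proof: symmetries obey linear determining equations, and these equations are
a perturbation of weight-homogeneous ones that ten initial values control.

Linearization. The flow of a symmetry moves a solution `u` through a family of solutions, and the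
velocity of this family is the characteristic q = Y - y₁ X¹ - F X² evaluated on the jet of `u`.
Hence q solves the linearized system D₂q = F_y q + F_{y₁} D₁q + F_{y₁₁} D₁²q, D₁³q = G_y q + G_{y₁}
D₁q + G_{y₁₁} D₁²q along `u`. By complete integrability and the Frobenius theorem
(`exists_solution_with_jet`), every point of the skeleton near the origin is the jet of a solution,
so these equations hold identically there (`IsInfinitesimalSymmetry.satisfiesDetermining`).

Weights. The weights 3, 1, 5, 2 of x¹, x², y, y₁ make the model equation y_{x²} = (y_{x¹})²/4
homogeneous: 5 - 1 = 2(5 - 3). The coordinate y₁₁ would get weight 2 - 3 < 0, so it is left out: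
weights are measured on y₁₁ = 0, and the dependence on y₁₁ is probed by applying ∂_{y₁₁} before
restricting. The normalization enters only through the statement that F - y₁²/4, F_{y₁₁} and G have
weight at least 6 (`weight_of_isNormalized`).

Induction. Let Y, X¹, X² have weights at least n, n - 2, n - 4, so that the field has degree at
least n - 5. Comparing powers of y₁ in the first equation, in the second one and in its
y₁₁-derivative yields the determining equations of the model y_{x²} = (y_{x¹})²/4, y_{x¹x¹x¹} = 0
with errors of higher weight (`IsJetAlgebra.mem_succ`). The model equations are of finite type:
after differentiation they control all derivatives by the ten initial coefficients, and if these
vanish then all three weights increase by one (`mem_of_model_equations`). Thus a triple with zero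
initial coefficients vanishes to infinite order, and by analyticity it is zero. Applied to
differences this is uniqueness; as the determining equations are linear, their solution space embeds
into the ten-dimensional space of coefficients, which bounds the dimension. -/

open Filter Topology

noncomputable section

namespace EFive

/-! ### The weight filtration, for abstract algebras with derivations. -/

section WeightFiltration

variable {𝕜 A : Type*} [Field 𝕜] [CommRing A] [Algebra 𝕜 A]

/-- The weights of the coordinates `x¹, x², y, y₁`. -/
def coordWeight : Fin 4 → ℕ := ![3, 1, 5, 2]

/-- Iterated application of the derivations `d i` along a list of indices. -/
def iterDer (d : Fin 4 → Derivation 𝕜 A A) : List (Fin 4) → A → A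
  | [], f => f
  | i :: l, f => iterDer d l (d i f)

lemma iterDer_add (d : Fin 4 → Derivation 𝕜 A A) (l : List (Fin 4)) (f g : A) :
    iterDer d l (f + g) = iterDer d l f + iterDer d l g := by
  induction l generalizing f g with
  | nil => rfl
  | cons i l ih => simp [iterDer, ih]

lemma iterDer_smul (d : Fin 4 → Derivation 𝕜 A A) (l : List (Fin 4)) (c : 𝕜) (f : A) :
    iterDer d l (c • f) = c • iterDer d l f := by
  induction l generalizing f with
  | nil => rfl
  | cons i l ih => simp [iterDer, ih]

/-- The elements all of whose derivatives of weight less than `k` along the `d i` vanish under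
the evaluation `ev`. -/
def weightGE (d : Fin 4 → Derivation 𝕜 A A) (ev : A →ₐ[𝕜] 𝕜) (k : ℕ) : Submodule 𝕜 A where
  carrier := {f | ∀ l : List (Fin 4), (l.map coordWeight).sum < k → ev (iterDer d l f) = 0}
  add_mem' hf hg l hl := by rw [iterDer_add, map_add, hf l hl, hg l hl, add_zero]
  zero_mem' l _ := by
    have := iterDer_smul d l (0 : 𝕜) (0 : A)
    simp only [zero_smul] at this
    rw [this, map_zero]
  smul_mem' c f hf l hl := by rw [iterDer_smul, map_smul, hf l hl, smul_zero]

variable {d : Fin 4 → Derivation 𝕜 A A} {ev : A →ₐ[𝕜] 𝕜}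

/-- The recursive form of the filtration, used for nearly all weight estimates. Truncated
subtraction is harmless, because weight at least 0 is no condition. -/
lemma mem_weightGE_iff {k : ℕ} {f : A} :
    f ∈ weightGE d ev k ↔
      (0 < k → ev f = 0) ∧ ∀ i, d i f ∈ weightGE d ev (k - coordWeight i) := by
  constructor
  · intro h
    refine ⟨fun hk => h [] (by simpa using hk), fun i l hl => h (i :: l) ?_⟩
    simp only [List.map_cons, List.sum_cons]
    omega
  · rintro ⟨h0, h1⟩ l hl
    cases l with
    | nil => exact h0 (by simpa using hl)
    | cons i l =>
      refine h1 i l ?_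
      simp only [List.map_cons, List.sum_cons] at hl
      omega

lemma weightGE_anti {k m : ℕ} {f : A} (hf : f ∈ weightGE d ev k) (h : m ≤ k) :
    f ∈ weightGE d ev m :=
  fun l hl => hf l (hl.trans_le h)

lemma mem_weightGE_zero (f : A) : f ∈ weightGE d ev 0 := fun _ hl => absurd hl (by simp)

lemma mem_weightGE_mk {k : ℕ} {f : A} (h : 0 < k → ev f = 0)
    (h0 : d 0 f ∈ weightGE d ev (k - 3)) (h1 : d 1 f ∈ weightGE d ev (k - 1))
    (h2 : d 2 f ∈ weightGE d ev (k - 5)) (h3 : d 3 f ∈ weightGE d ev (k - 2)) :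
    f ∈ weightGE d ev k :=
  mem_weightGE_iff.2 ⟨h, fun i => by fin_cases i <;> assumption⟩

lemma der_mem_weightGE (i : Fin 4) {k m : ℕ} {f : A} (hf : f ∈ weightGE d ev k)
    (h : m + coordWeight i ≤ k ∨ m = 0) : d i f ∈ weightGE d ev m := by
  rcases h with h | rfl
  · exact weightGE_anti ((mem_weightGE_iff.1 hf).2 i) (by omega)
  · exact mem_weightGE_zero _

lemma d0_mem {k m : ℕ} {f : A} (hf : f ∈ weightGE d ev k) (h : m ≤ k - 3) :
    d 0 f ∈ weightGE d ev m :=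
  der_mem_weightGE 0 hf (by change m + 3 ≤ k ∨ m = 0; omega)

lemma d1_mem {k m : ℕ} {f : A} (hf : f ∈ weightGE d ev k) (h : m ≤ k - 1) :
    d 1 f ∈ weightGE d ev m :=
  der_mem_weightGE 1 hf (by change m + 1 ≤ k ∨ m = 0; omega)

lemma d2_mem {k m : ℕ} {f : A} (hf : f ∈ weightGE d ev k) (h : m ≤ k - 5) :
    d 2 f ∈ weightGE d ev m :=
  der_mem_weightGE 2 hf (by change m + 5 ≤ k ∨ m = 0; omega)

lemma d3_mem {k m : ℕ} {f : A} (hf : f ∈ weightGE d ev k) (h : m ≤ k - 2) :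
    d 3 f ∈ weightGE d ev m :=
  der_mem_weightGE 3 hf (by change m + 2 ≤ k ∨ m = 0; omega)

/-- Leibniz rule and strong induction on `a + b`: in each term one factor loses the weight of the
derivation. -/
lemma mul_mem_weightGE_add {a b : ℕ} {f g : A} (hf : f ∈ weightGE d ev a)
    (hg : g ∈ weightGE d ev b) : f * g ∈ weightGE d ev (a + b) := by
  induction hn : a + b using Nat.strong_induction_on generalizing a b f g with
  | _ n ih =>
    subst hn
    refine mem_weightGE_iff.2 ⟨fun hk => ?_, fun i => ?_⟩
    · rw [map_mul]
      rcases Nat.eq_zero_or_pos a with rfl | ha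
      · rw [(mem_weightGE_iff.1 hg).1 (by omega), mul_zero]
      · rw [(mem_weightGE_iff.1 hf).1 ha, zero_mul]
    · have hw : 0 < coordWeight i := by fin_cases i <;> decide
      rcases Nat.eq_zero_or_pos (a + b) with h0 | hpos
      · rw [h0, Nat.zero_sub]; exact mem_weightGE_zero _
      rw [Derivation.leibniz, smul_eq_mul, smul_eq_mul]
      have hf' := (mem_weightGE_iff.1 hf).2 i
      have hg' := (mem_weightGE_iff.1 hg).2 i
      refine Submodule.add_mem _ ?_ ?_
      · by_cases hlt : a + (b - coordWeight i) < a + b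
        · exact weightGE_anti (ih _ hlt hf hg' rfl) (by omega)
        -- When `b = 0`, differentiating `g` does not lower `a + b`. The weight is given up by `f`
        -- instead, which restores the descent.
        · have hb : b = 0 := by omega
          subst hb
          exact weightGE_anti (ih (a - coordWeight i + 0) (by omega)
            (weightGE_anti hf (Nat.sub_le _ _)) (mem_weightGE_zero (d i g)) rfl) (by omega)
      · by_cases hlt : b + (a - coordWeight i) < a + b
        · exact weightGE_anti (ih _ hlt hg hf' rfl) (by omega)
        · have ha : a = 0 := by omega
          subst ha
          exact weightGE_anti (ih (b - coordWeight i + 0) (by omega)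
            (weightGE_anti hg (Nat.sub_le _ _)) (mem_weightGE_zero (d i f)) rfl) (by omega)

lemma mul_mem_weightGE {a b c : ℕ} {f g : A} (hf : f ∈ weightGE d ev a)
    (hg : g ∈ weightGE d ev b) (h : c ≤ a + b) : f * g ∈ weightGE d ev c :=
  weightGE_anti (mul_mem_weightGE_add hf hg) h

lemma mul_mem_weightGE_left {c : ℕ} {f : A} (hf : f ∈ weightGE d ev c) (g : A) :
    f * g ∈ weightGE d ev c :=
  mul_mem_weightGE hf (mem_weightGE_zero g) le_rfl

lemma mul_mem_weightGE_right {c : ℕ} (f : A) {g : A} (hg : g ∈ weightGE d ev c) :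
    f * g ∈ weightGE d ev c :=
  mul_mem_weightGE (mem_weightGE_zero f) hg (by omega)

lemma mem_weightGE_of_natCast_mul [CharZero 𝕜] {c n : ℕ} (hn : n ≠ 0) {f : A}
    (hf : (n : A) * f ∈ weightGE d ev c) : f ∈ weightGE d ev c := by
  have h : (n : 𝕜)⁻¹ • ((n : A) * f) = f := by
    have : (n : A) * f = (n : 𝕜) • f := by
      rw [Algebra.smul_def, map_natCast]
    rw [this, smul_smul, inv_mul_cancel₀ (by exact_mod_cast hn), one_smul]
  rw [← h]
  exact Submodule.smul_mem _ _ hf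

/-- `p` and `r` behave as the last two of five coordinates, for the commuting derivations
`d 0, …, d 3, e`. -/
structure IsJetAlgebra (d : Fin 4 → Derivation 𝕜 A A) (e : Derivation 𝕜 A A) (ev : A →ₐ[𝕜] 𝕜)
    (p r : A) : Prop where
  comm : ∀ i j f, d i (d j f) = d j (d i f)
  comm_e : ∀ i f, e (d i f) = d i (e f)
  ev_p : ev p = 0
  d0_p : d 0 p = 0
  d1_p : d 1 p = 0
  d2_p : d 2 p = 0
  d3_p : d 3 p = 1
  e_p : e p = 0
  ev_r : ev r = 0
  d_r : ∀ i, d i r = 0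
  e_r : e r = 1

variable {e : Derivation 𝕜 A A} {p r : A}

/-- Only `d 0, …, d 3` enter the filtration and they all kill `r`, so multiples of `r` are
negligible to every order: the filtration sees only `r = 0`. -/
lemma IsJetAlgebra.r_mem (h : IsJetAlgebra d e ev p r) (k : ℕ) : r ∈ weightGE d ev k :=
  mem_weightGE_iff.2 ⟨fun _ => h.ev_r, fun i => by rw [h.d_r]; exact Submodule.zero_mem _⟩

lemma IsJetAlgebra.p_mem (h : IsJetAlgebra d e ev p r) : p ∈ weightGE d ev 2 := by
  refine mem_weightGE_mk (fun _ => h.ev_p) ?_ ?_ ?_ (mem_weightGE_zero _)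
  · rw [h.d0_p]; exact Submodule.zero_mem _
  · rw [h.d1_p]; exact Submodule.zero_mem _
  · rw [h.d2_p]; exact Submodule.zero_mem _

lemma IsJetAlgebra.p_pow_mem (h : IsJetAlgebra d e ev p r) (n : ℕ) :
    p ^ n ∈ weightGE d ev (2 * n) := by
  induction n with
  | zero => exact mem_weightGE_zero _
  | succ n ih => rw [pow_succ]; exact mul_mem_weightGE ih h.p_mem (by omega)

/-- The coefficients of a polynomial in `p`, with coefficients independent of `p`, inherit a
lower bound on the weight. -/
lemma IsJetAlgebra.coeff_mem [CharZero 𝕜] (h : IsJetAlgebra d e ev p r) (N : ℕ) (M : ℕ → A)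
    (m : ℕ) (hM : ∀ k, d 3 (M k) = 0)
    (hs : ∑ k ∈ Finset.range N, p ^ k * M k ∈ weightGE d ev m) :
    ∀ k < N, M k ∈ weightGE d ev (m - 2 * k) := by
  induction N generalizing M m with
  | zero => intro k hk; omega
  | succ N ih =>
    -- Differentiation in `p` costs weight 2 and leaves a polynomial with one term fewer and
    -- coefficients `(k + 1) * M (k + 1)`. The constant term is then recovered by subtraction.
    have key : ∀ k < N, M (k + 1) ∈ weightGE d ev (m - 2 * (k + 1)) := by
      have h3 := d3_mem hs le_rfl
      have h4 : d 3 (∑ k ∈ Finset.range (N + 1), p ^ k * M k)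
          = ∑ k ∈ Finset.range N, p ^ k * (((k + 1 : ℕ) : A) * M (k + 1)) := by
        rw [map_sum, Finset.sum_range_succ']
        simp only [Derivation.leibniz, hM, Derivation.leibniz_pow, h.d3_p, smul_eq_mul, mul_zero,
          zero_add, pow_zero, Derivation.map_one_eq_zero, mul_one, add_zero,
          Nat.add_sub_cancel, nsmul_eq_mul]
        refine Finset.sum_congr rfl fun k _ => ?_
        simp only [Nat.cast_succ]
        ring

      rw [h4] at h3
      intro k hk
      refine mem_weightGE_of_natCast_mul (Nat.succ_ne_zero k) ?_
      refine weightGE_anti (ih (fun k => ((k + 1 : ℕ) : A) * M (k + 1)) (m - 2) ?_ h3 k hk)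
        (by omega)
      intro k
      simp [Derivation.leibniz, hM]
    intro k hk
    cases k with
    | succ k => exact key k (by omega)
    | zero =>
      rw [Finset.sum_range_succ', pow_zero, one_mul] at hs
      have : ∑ k ∈ Finset.range N, p ^ (k + 1) * M (k + 1) ∈ weightGE d ev m :=
        Submodule.sum_mem _ fun k hk => mul_mem_weightGE (h.p_pow_mem (k + 1))
          (key k (Finset.mem_range.1 hk)) (by omega)
      simpa using Submodule.sub_mem _ hs this

end WeightFiltration

/-! ### Finite type of the determining equations of the model. -/

section ModelEquations

variable {𝕜 A : Type*} [Field 𝕜] [CharZero 𝕜] [CommRing A] [Algebra 𝕜 A]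
  {d : Fin 4 → Derivation 𝕜 A A} {ev : A →ₐ[𝕜] 𝕜}

/-- The ten initial coefficients of a triple `(X, Z, Y)` vanish. -/
structure InitialZero (d : Fin 4 → Derivation 𝕜 A A) (ev : A →ₐ[𝕜] 𝕜) (X Z Y : A) : Prop where
  ev_X : ev X = 0
  ev_Z : ev Z = 0
  ev_Y : ev Y = 0
  ev_Xy : ev (d 2 X) = 0
  ev_Z2 : ev (d 1 Z) = 0
  ev_Y1 : ev (d 0 Y) = 0
  ev_Yy : ev (d 2 Y) = 0
  ev_Z12 : ev (d 0 (d 1 Z)) = 0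
  ev_Y11 : ev (d 0 (d 0 Y)) = 0
  ev_Yyy : ev (d 2 (d 2 Y)) = 0

/-- If the determining equations of the model `y_{x²} = (y_{x¹})² / 4`, `y_{x¹x¹x¹} = 0` hold up
to terms of higher weight, then a triple with vanishing initial coefficients is itself of higher
weight. -/
lemma mem_of_model_equations
    (comm : ∀ i j f, d i (d j f) = d j (d i f)) {X Z Y : A}
    (hX3 : d 3 X = 0) (hZ3 : d 3 Z = 0) (hY3 : d 3 Y = 0) (h0 : InitialZero d ev X Z Y) {n : ℕ}
    (g1 : d 1 Y ∈ weightGE d ev n)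
    (g2 : (2 : 𝕜) • d 1 X + d 0 Y ∈ weightGE d ev (n - 2))
    (g3 : d 1 Z - (2 : 𝕜) • d 0 X + d 2 Y ∈ weightGE d ev (n - 4))
    (g4 : d 0 Z + (2 : 𝕜) • d 2 X ∈ weightGE d ev (n - 6))
    (g5 : d 2 Z ∈ weightGE d ev (n - 8))
    (g6 : d 0 (d 0 X) - d 0 (d 2 Y) ∈ weightGE d ev (n - 7))
    (g7 : d 0 (d 0 (d 0 Y)) ∈ weightGE d ev (n - 8))
    (g8 : (3 : 𝕜) • d 0 (d 0 (d 2 Y)) - d 0 (d 0 (d 0 X)) ∈ weightGE d ev (n - 10)) :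
    Y ∈ weightGE d ev (n + 1) ∧ X ∈ weightGE d ev (n - 1) ∧ Z ∈ weightGE d ev (n - 3) := by
  -- Mixed derivatives are brought to the order with the smaller index outermost, so that relations
  -- can be combined linearly.
  have c10 : ∀ f, d 1 (d 0 f) = d 0 (d 1 f) := fun f => comm 1 0 f
  have c20 : ∀ f, d 2 (d 0 f) = d 0 (d 2 f) := fun f => comm 2 0 f
  have c21 : ∀ f, d 2 (d 1 f) = d 1 (d 2 f) := fun f => comm 2 1 f
  have c3 : ∀ i f, d 3 (d i f) = d i (d 3 f) := fun i f => comm 3 i f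
  have z3 : ∀ (f : A) (k : ℕ), d 3 f = 0 → d 3 f ∈ weightGE d ev k := fun f k h => by
    rw [h]; exact Submodule.zero_mem _
  have X3 : ∀ k, d 3 X ∈ weightGE d ev k := fun k => z3 _ _ hX3
  have Y3 : ∀ k, d 3 Y ∈ weightGE d ev k := fun k => z3 _ _ hY3
  have Z3 : ∀ k, d 3 Z ∈ weightGE d ev k := fun k => z3 _ _ hZ3
  have X3' : ∀ i k, d 3 (d i X) ∈ weightGE d ev k := fun i k => z3 _ _ (by
    rw [c3, hX3, map_zero])
  have Y3' : ∀ i k, d 3 (d i Y) ∈ weightGE d ev k := fun i k => z3 _ _ (by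
    rw [c3, hY3, map_zero])
  have Z3' : ∀ i k, d 3 (d i Z) ∈ weightGE d ev k := fun i k => z3 _ _ (by
    rw [c3, hZ3, map_zero])
  have X3'' : ∀ i j k, d 3 (d i (d j X)) ∈ weightGE d ev k := fun i j k => z3 _ _ (by
    rw [c3, c3, hX3, map_zero, map_zero])
  have Y3'' : ∀ i j k, d 3 (d i (d j Y)) ∈ weightGE d ev k := fun i j k => z3 _ _ (by
    rw [c3, c3, hY3, map_zero, map_zero])
  have Z3'' : ∀ i j k, d 3 (d i (d j Z)) ∈ weightGE d ev k := fun i j k => z3 _ _ (by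
    rw [c3, c3, hZ3, map_zero, map_zero])
  -- differentiated relations
  have g6_0 := d0_mem g6 le_rfl
  have g6_2 := d2_mem g6 le_rfl
  have g5_0 := d0_mem g5 le_rfl
  have g5_1 := d1_mem g5 le_rfl
  have g4_0 := d0_mem g4 le_rfl
  have g4_1 := d1_mem g4 le_rfl
  have g4_2 := d2_mem g4 le_rfl
  have g3_0 := d0_mem g3 le_rfl
  have g3_2 := d2_mem g3 le_rfl
  have g3_1 := d1_mem g3 le_rfl
  have g2_0 := d0_mem g2 le_rfl
  have g2_2 := d2_mem g2 le_rfl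
  have g1_0 := d0_mem g1 le_rfl
  have g1_2 := d2_mem g1 le_rfl
  simp only [map_add, map_sub, Derivation.map_smul, c10, c20, c21, Nat.sub_sub, Nat.reduceAdd]
    at g6_0 g6_2 g5_0 g5_1 g4_0 g4_1 g4_2 g3_0 g3_1 g3_2 g2_0 g2_2 g1_0 g1_2
  -- third order
  have Y11y : d 0 (d 0 (d 2 Y)) ∈ weightGE d ev (n - 10) := by
    have := Submodule.smul_mem _ (1 / 2 : 𝕜) (Submodule.add_mem _ g8 g6_0)
    convert this using 1; module
  have Xyy : d 2 (d 2 X) ∈ weightGE d ev (n - 11) := by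
    have := Submodule.smul_mem _ (1 / 2 : 𝕜) (Submodule.sub_mem _ g4_2 g5_0)
    convert this using 1; module
  have X1yy := d0_mem Xyy le_rfl
  -- Cross-differentiation: Z_{x²y} is found from `g5` and from `g3`.
  have rYyy : (2 : 𝕜) • d 0 (d 2 X) - d 2 (d 2 Y) ∈ weightGE d ev (n - 9) := by
    have := Submodule.sub_mem _ g5_1 g3_2
    convert this using 1; module
  have rYyy_0 := d0_mem rYyy le_rfl
  have rYyy_2 := d2_mem rYyy le_rfl
  simp only [map_sub, Derivation.map_smul, c20, Nat.sub_sub, Nat.reduceAdd]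
    at rYyy_0 rYyy_2 X1yy
  have Y1yy : d 0 (d 2 (d 2 Y)) ∈ weightGE d ev (n - 12) := by
    have := Submodule.sub_mem _ rYyy_0 (Submodule.smul_mem _ (2 : 𝕜) g6_2)
    convert this using 1; module
  have Yyyy : d 2 (d 2 (d 2 Y)) ∈ weightGE d ev (n - 14) := by
    have := Submodule.sub_mem _ (Submodule.smul_mem _ (2 : 𝕜) X1yy) rYyy_2
    convert this using 1; module
  -- second order
  have Y11 : d 0 (d 0 Y) ∈ weightGE d ev (n - 5) := by
    -- Here the initial values begin to enter: a derivative whose own derivatives have high weight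
    -- has itself high weight as soon as it vanishes at the origin.
    refine mem_weightGE_mk (fun _ => h0.ev_Y11) ?_ ?_ ?_ (Y3'' _ _ _)
    · exact weightGE_anti g7 (by omega)
    · rw [c10, c10]; exact d0_mem g1_0 (by omega)
    · rw [c20, c20]; exact weightGE_anti Y11y (by omega)
  have X12 : d 0 (d 1 X) ∈ weightGE d ev (n - 5) := by
    have := Submodule.smul_mem _ (1 / 2 : 𝕜) (Submodule.sub_mem _ g2_0 Y11)
    convert this using 1; module
  -- Z_{x¹x²} and Y_{x¹y} agree up to higher weight, so the single initial value of the former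
  -- controls both.
  have rZ12 : d 0 (d 1 Z) - d 0 (d 2 Y) ∈ weightGE d ev (n - 7) := by
    have := Submodule.add_mem _ g3_0 (Submodule.smul_mem _ (2 : 𝕜) g6)
    convert this using 1; module
  have Z12 : d 0 (d 1 Z) ∈ weightGE d ev (n - 7) := by
    refine mem_weightGE_mk (fun _ => h0.ev_Z12) ?_ ?_ ?_ (Z3'' _ _ _)
    · have h := d0_mem rZ12 le_rfl
      simp only [map_sub] at h
      have := Submodule.add_mem _ h Y11y
      convert this using 1; module
    · have h := d1_mem rZ12 le_rfl
      simp only [map_sub, c10] at h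
      have := Submodule.add_mem _ h (d0_mem g1_2 (m := n - 7 - 1) (by omega))
      rw [c10]
      convert this using 1; module
    · have h := d2_mem rZ12 le_rfl
      simp only [map_sub, c20] at h
      have := Submodule.add_mem _ h (weightGE_anti Y1yy (by omega))
      rw [c20]
      convert this using 1; module
  have Y1y : d 0 (d 2 Y) ∈ weightGE d ev (n - 7) := by
    have := Submodule.sub_mem _ Z12 rZ12
    convert this using 1; module
  have Yyy : d 2 (d 2 Y) ∈ weightGE d ev (n - 9) := by
    refine mem_weightGE_mk (fun _ => h0.ev_Yyy) ?_ ?_ ?_ (Y3'' _ _ _)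
    · exact weightGE_anti Y1yy (by omega)
    · rw [comm 1 2, comm 1 2]; exact d2_mem (d2_mem g1 le_rfl) (by omega)
    · exact weightGE_anti Yyyy (by omega)
  have X1y : d 0 (d 2 X) ∈ weightGE d ev (n - 9) := by
    have := Submodule.smul_mem _ (1 / 2 : 𝕜) (Submodule.add_mem _ rYyy Yyy)
    convert this using 1; module
  have X2y : d 1 (d 2 X) ∈ weightGE d ev (n - 7) := by
    have := Submodule.smul_mem _ (1 / 2 : 𝕜) (Submodule.sub_mem _ g2_2 Y1y)
    convert this using 1; module
  have Z22 : d 1 (d 1 Z) ∈ weightGE d ev (n - 5) := by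
    have := Submodule.sub_mem _ (Submodule.add_mem _ g3_1 (Submodule.smul_mem _ (2 : 𝕜) X12))
      (weightGE_anti g1_2 (m := n - 5) (by omega))
    convert this using 1; module
  -- first order
  have Xy : d 2 X ∈ weightGE d ev (n - 6) := by
    refine mem_weightGE_mk (fun _ => h0.ev_Xy) ?_ ?_ ?_ (X3' _ _)
    · exact weightGE_anti X1y (by omega)
    · exact weightGE_anti X2y (by omega)
    · exact weightGE_anti Xyy (by omega)
  have Z2 : d 1 Z ∈ weightGE d ev (n - 4) := by
    refine mem_weightGE_mk (fun _ => h0.ev_Z2) ?_ ?_ ?_ (Z3' _ _)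
    · exact weightGE_anti Z12 (by omega)
    · exact weightGE_anti Z22 (by omega)
    · rw [c21]; exact weightGE_anti g5_1 (by omega)
  have Y1 : d 0 Y ∈ weightGE d ev (n - 2) := by
    refine mem_weightGE_mk (fun _ => h0.ev_Y1) ?_ ?_ ?_ (Y3' _ _)
    · exact weightGE_anti Y11 (by omega)
    · rw [c10]; exact weightGE_anti g1_0 (by omega)
    · rw [c20]; exact weightGE_anti Y1y (by omega)
  have Yy : d 2 Y ∈ weightGE d ev (n - 4) := by
    refine mem_weightGE_mk (fun _ => h0.ev_Yy) ?_ ?_ ?_ (Y3' _ _)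
    · exact weightGE_anti Y1y (by omega)
    · rw [← c21]; exact d2_mem g1 (by omega)
    · exact weightGE_anti Yyy (by omega)
  -- The first derivatives without an initial value follow algebraically from `g3`, `g2` and `g4`.
  have X1 : d 0 X ∈ weightGE d ev (n - 4) := by
    have := Submodule.smul_mem _ (1 / 2 : 𝕜) (Submodule.sub_mem _ (Submodule.add_mem _ Z2 Yy) g3)
    convert this using 1; module
  have X2 : d 1 X ∈ weightGE d ev (n - 2) := by
    have := Submodule.smul_mem _ (1 / 2 : 𝕜) (Submodule.sub_mem _ g2 Y1)
    convert this using 1; module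
  have Z1 : d 0 Z ∈ weightGE d ev (n - 6) := by
    have := Submodule.sub_mem _ g4 (Submodule.smul_mem _ (2 : 𝕜) Xy)
    convert this using 1; module
  exact ⟨mem_weightGE_mk (fun _ => h0.ev_Y) (weightGE_anti Y1 (by omega)) (weightGE_anti g1 (by omega))
      (weightGE_anti Yy (by omega)) (Y3 _),
    mem_weightGE_mk (fun _ => h0.ev_X) (weightGE_anti X1 (by omega)) (weightGE_anti X2 (by omega))
      (weightGE_anti Xy (by omega)) (X3 _),
    mem_weightGE_mk (fun _ => h0.ev_Z) (weightGE_anti Z1 (by omega)) (weightGE_anti Z2 (by omega))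
      (weightGE_anti g5 (by omega)) (Z3 _)⟩

end ModelEquations

/-! ### From the determining equations to those of the model, and the induction on the weight. -/

section DeterminingEquations

variable {𝕜 A : Type*} [Field 𝕜] [CommRing A] [Algebra 𝕜 A]
  {d : Fin 4 → Derivation 𝕜 A A} {e : Derivation 𝕜 A A} {ev : A →ₐ[𝕜] 𝕜} {p r G : A}

/-- The operator `∂_{x¹} + y₁ ∂_y`. -/
def horizD (d : Fin 4 → Derivation 𝕜 A A) (p f : A) : A := d 0 f + p * d 2 f

/-- The total derivative `∂_{x¹} + y₁ ∂_y + y₁₁ ∂_{y₁} + G ∂_{y₁₁}`. -/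
def totalD (d : Fin 4 → Derivation 𝕜 A A) (e : Derivation 𝕜 A A) (p r G f : A) : A :=
  horizD d p f + r * d 3 f + G * e f

lemma horizD_sub (f g : A) : horizD d p (f - g) = horizD d p f - horizD d p g := by
  simp only [horizD, map_sub]; ring

lemma totalD_add (f g : A) :
    totalD d e p r G (f + g) = totalD d e p r G f + totalD d e p r G g := by
  simp only [totalD, horizD, map_add]; ring

lemma totalD_smul (c : 𝕜) (f : A) :
    totalD d e p r G (c • f) = c • totalD d e p r G f := by
  simp only [totalD, horizD, Derivation.map_smul, mul_smul_comm, smul_add]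

section Bounds

variable (h : IsJetAlgebra d e ev p r)
include h

lemma IsJetAlgebra.horizD_mem {k m : ℕ} {f : A} (hf : f ∈ weightGE d ev k) (hm : m ≤ k - 3) :
    horizD d p f ∈ weightGE d ev m :=
  Submodule.add_mem _ (d0_mem hf hm)
    (mul_mem_weightGE h.p_mem (d2_mem hf (le_refl (k - 5))) (by omega))

lemma IsJetAlgebra.r_mul_mem (m : ℕ) (f : A) : r * f ∈ weightGE d ev m :=
  mul_mem_weightGE_left (h.r_mem m) f

/-- The commutator of ∂_{y₁₁} with D₁ is ∂_{y₁} + G_{y₁₁} ∂_{y₁₁}. -/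
lemma IsJetAlgebra.e_totalD (f : A) :
    e (totalD d e p r G f)
      = horizD d p (e f) + d 3 f + r * d 3 (e f) + e G * e f + G * e (e f) := by
  simp only [totalD, horizD, map_add, Derivation.leibniz, smul_eq_mul, h.comm_e, h.e_p, h.e_r]
  ring

lemma IsJetAlgebra.e_e_totalD (f : A) :
    e (e (totalD d e p r G f))
      = horizD d p (e (e f)) + 2 * d 3 (e f) + r * d 3 (e (e f)) + e (e G) * e f
        + 2 * (e G * e (e f)) + G * e (e (e f)) := by
  rw [h.e_totalD]
  simp only [horizD, map_add, Derivation.leibniz, smul_eq_mul, h.comm_e, h.e_p, h.e_r]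
  ring

lemma IsJetAlgebra.e_e_e_totalD (f : A) :
    e (e (e (totalD d e p r G f)))
      = horizD d p (e (e (e f))) + 3 * d 3 (e (e f)) + r * d 3 (e (e (e f)))
        + e (e (e G)) * e f + 3 * (e (e G) * e (e f)) + 3 * (e G * e (e (e f)))
        + G * e (e (e (e f))) := by
  rw [h.e_e_totalD]
  have e2 : e (2 : A) = 0 := by exact_mod_cast e.map_natCast 2
  simp only [horizD, map_add, Derivation.leibniz, smul_eq_mul, h.comm_e, h.e_p, h.e_r, e2]
  ring

variable (hG : G ∈ weightGE d ev 6)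
include hG

/-- Up to higher weight D₁ acts as `horizD`: the term with the factor `r` is invisible, and the
factor `G` gains 6. Here `g` plays the role of the model part of `f`. -/
lemma IsJetAlgebra.totalD_sub_mem {f g : A} {k l m : ℕ} (hf : f - g ∈ weightGE d ev k)
    (hef : e f ∈ weightGE d ev l) (hk : m ≤ k - 3) (hl : m ≤ l + 6) :
    totalD d e p r G f - horizD d p g ∈ weightGE d ev m := by
  have : totalD d e p r G f - horizD d p g
      = horizD d p (f - g) + r * d 3 f + G * e f := by
    rw [horizD_sub, totalD]; ring
  rw [this]
  exact Submodule.add_mem _ (Submodule.add_mem _ (h.horizD_mem hf hk) (h.r_mul_mem _ _))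
    (mul_mem_weightGE hG hef (by omega))

/-- Here `g` and `g'` are the model parts of `f` and `e f`. No weight is available for `e G`, so `e
f` has to supply the weight `m` by itself. -/
lemma IsJetAlgebra.e_totalD_sub_mem {f g g' : A} {k₁ k₂ k₃ k₄ m : ℕ}
    (h₁ : e f - g' ∈ weightGE d ev k₁) (h₂ : f - g ∈ weightGE d ev k₂)
    (h₃ : e f ∈ weightGE d ev k₃) (h₄ : e (e f) ∈ weightGE d ev k₄)
    (hm₁ : m ≤ k₁ - 3) (hm₂ : m ≤ k₂ - 2) (hm₃ : m ≤ k₃) (hm₄ : m ≤ k₄ + 6) :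
    e (totalD d e p r G f) - (horizD d p g' + d 3 g) ∈ weightGE d ev m := by
  have : e (totalD d e p r G f) - (horizD d p g' + d 3 g)
      = horizD d p (e f - g') + d 3 (f - g) + r * d 3 (e f) + e G * e f + G * e (e f) := by
    rw [horizD_sub, h.e_totalD, map_sub]; ring
  rw [this]
  exact Submodule.add_mem _ (Submodule.add_mem _ (Submodule.add_mem _ (Submodule.add_mem _
    (h.horizD_mem h₁ hm₁) (d3_mem h₂ hm₂)) (h.r_mul_mem _ _))
    (weightGE_anti (mul_mem_weightGE_right _ h₃) hm₃)) (mul_mem_weightGE hG h₄ (by omega))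

/-- For the higher derivatives in `r` no model part is tracked; crude bounds are enough, because
these derivatives enter the main estimates only with the factor `G`. -/
lemma IsJetAlgebra.e_e_totalD_mem {f : A} {k₁ k₂ k₃ m : ℕ}
    (h₁ : e f ∈ weightGE d ev k₁) (h₂ : e (e f) ∈ weightGE d ev k₂)
    (h₃ : e (e (e f)) ∈ weightGE d ev k₃)
    (hm₁ : m ≤ k₁ - 2) (hm₂ : m ≤ k₂ - 3) (hm₃ : m ≤ k₃ + 6) :
    e (e (totalD d e p r G f)) ∈ weightGE d ev m := by
  rw [h.e_e_totalD]
  refine Submodule.add_mem _ (Submodule.add_mem _ (Submodule.add_mem _ (Submodule.add_mem _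
    (Submodule.add_mem _ (h.horizD_mem h₂ hm₂) (mul_mem_weightGE_right _ (d3_mem h₁ hm₁)))
    (h.r_mul_mem _ _)) (mul_mem_weightGE_right _ (weightGE_anti h₁ (by omega))))
    (mul_mem_weightGE_right _ (mul_mem_weightGE_right _ (weightGE_anti h₂ (by omega)))))
    (mul_mem_weightGE hG h₃ (by omega))

lemma IsJetAlgebra.e_e_e_totalD_mem {f : A} {k₁ k₂ k₃ k₄ m : ℕ}
    (h₁ : e f ∈ weightGE d ev k₁) (h₂ : e (e f) ∈ weightGE d ev k₂)
    (h₃ : e (e (e f)) ∈ weightGE d ev k₃) (h₄ : e (e (e (e f))) ∈ weightGE d ev k₄)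
    (hm₁ : m ≤ k₁) (hm₂ : m ≤ k₂ - 2) (hm₃ : m ≤ k₃ - 3) (hm₄ : m ≤ k₄ + 6) :
    e (e (e (totalD d e p r G f))) ∈ weightGE d ev m := by
  rw [h.e_e_e_totalD]
  refine Submodule.add_mem _ (Submodule.add_mem _ (Submodule.add_mem _ (Submodule.add_mem _
    (Submodule.add_mem _ (Submodule.add_mem _ (h.horizD_mem h₃ hm₃)
      (mul_mem_weightGE_right _ (d3_mem h₂ hm₂))) (h.r_mul_mem _ _))
    (mul_mem_weightGE_right _ (weightGE_anti h₁ (by omega))))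
    (mul_mem_weightGE_right _ (mul_mem_weightGE_right _ (weightGE_anti h₂ (by omega)))))
    (mul_mem_weightGE_right _ (mul_mem_weightGE_right _ (weightGE_anti h₃ (by omega)))))
    (mul_mem_weightGE hG h₄ (by omega))

end Bounds

lemma IsJetAlgebra.coeff_mem_five [CharZero 𝕜] (h : IsJetAlgebra d e ev p r)
    {a₀ a₁ a₂ a₃ a₄ a₅ : A} {m : ℕ}
    (h₀ : d 3 a₀ = 0) (h₁ : d 3 a₁ = 0) (h₂ : d 3 a₂ = 0) (h₃ : d 3 a₃ = 0) (h₄ : d 3 a₄ = 0)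
    (h₅ : d 3 a₅ = 0)
    (hs : a₀ + p * a₁ + p ^ 2 * a₂ + p ^ 3 * a₃ + p ^ 4 * a₄ + p ^ 5 * a₅ ∈ weightGE d ev m) :
    a₀ ∈ weightGE d ev m ∧ a₁ ∈ weightGE d ev (m - 2) ∧ a₂ ∈ weightGE d ev (m - 4) ∧
      a₃ ∈ weightGE d ev (m - 6) ∧ a₄ ∈ weightGE d ev (m - 8) := by
  let M : ℕ → A := fun k => match k with
    | 0 => a₀ | 1 => a₁ | 2 => a₂ | 3 => a₃ | 4 => a₄ | 5 => a₅ | _ => 0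
  have hM : ∀ k, d 3 (M k) = 0 := by
    intro k
    match k with
    | 0 => exact h₀
    | 1 => exact h₁
    | 2 => exact h₂
    | 3 => exact h₃
    | 4 => exact h₄
    | 5 => exact h₅
    | k + 6 => exact map_zero _
  have hs' : ∑ k ∈ Finset.range 6, p ^ k * M k ∈ weightGE d ev m := by
    simpa [Finset.sum_range_succ, M] using hs
  have key := h.coeff_mem 6 M m hM hs'
  exact ⟨key 0 (by norm_num), key 1 (by norm_num), key 2 (by norm_num), key 3 (by norm_num),
    key 4 (by norm_num)⟩

/-- The determining equations for `(X, Z, Y)`, in terms of the characteristic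
`q = Y - y₁ X - F Z`: it solves the linearization of the system `(F, G)`. -/
structure Determining (d : Fin 4 → Derivation 𝕜 A A) (e : Derivation 𝕜 A A) (p r F G q : A) :
    Prop where
  first : d 1 q + F * d 2 q + totalD d e p r G F * d 3 q
      + totalD d e p r G (totalD d e p r G F) * e q
    = d 2 F * q + d 3 F * totalD d e p r G q + e F * totalD d e p r G (totalD d e p r G q)
  second : totalD d e p r G (totalD d e p r G (totalD d e p r G q))
    = d 2 G * q + d 3 G * totalD d e p r G q + e G * totalD d e p r G (totalD d e p r G q)

-- One step of the induction. Replacing `F` by p²/4, `q` by `q₀` and D₁ by `horizD` leaves main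
-- terms of weights n - 1 in the first equation, n - 9 in the second and n - 8 in its
-- `e`-derivative; the errors have weight at least n, n - 8 and n - 7.
set_option linter.unusedSimpArgs false in
lemma IsJetAlgebra.mem_succ [CharZero 𝕜] (h : IsJetAlgebra d e ev p r) {F G X Z Y : A}
    (hF : F - algebraMap 𝕜 A (1 / 4) * p ^ 2 ∈ weightGE d ev 6) (heF : e F ∈ weightGE d ev 6)
    (hG : G ∈ weightGE d ev 6)
    (hX3 : d 3 X = 0) (hZ3 : d 3 Z = 0) (hY3 : d 3 Y = 0)
    (hX4 : e X = 0) (hZ4 : e Z = 0) (hY4 : e Y = 0) (h0 : InitialZero d ev X Z Y)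
    (hE : Determining d e p r F G (Y - p * X - F * Z)) {n : ℕ}
    (hY : Y ∈ weightGE d ev n) (hX : X ∈ weightGE d ev (n - 2)) (hZ : Z ∈ weightGE d ev (n - 4)) :
    Y ∈ weightGE d ev (n + 1) ∧ X ∈ weightGE d ev (n - 1) ∧ Z ∈ weightGE d ev (n - 3) := by
  obtain ⟨E1, E2⟩ := hE
  set c : A := algebraMap 𝕜 A (1 / 4) with hc
  have dc : ∀ i, d i c = 0 := fun i => (d i).map_algebraMap _
  have c4 : 4 * c = 1 := by
    have : (4 : A) = algebraMap 𝕜 A 4 := (map_ofNat _ 4).symm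
    rw [hc, this, ← map_mul]; norm_num
  set q := Y - p * X - F * Z with hq
  set q₀ := Y - p * X - c * p ^ 2 * Z with hq₀
  have hpX : p * X ∈ weightGE d ev n := mul_mem_weightGE h.p_mem hX (by omega)
  have hcp : c * p ^ 2 ∈ weightGE d ev 4 := mul_mem_weightGE_right _ (h.p_pow_mem 2)
  have q0n : q₀ ∈ weightGE d ev n :=
    Submodule.sub_mem _ (Submodule.sub_mem _ hY hpX) (mul_mem_weightGE hcp hZ (by omega))
  have qq0 : q - q₀ ∈ weightGE d ev (n + 2) := by
    have : q - q₀ = -((F - c * p ^ 2) * Z) := by rw [hq, hq₀]; ring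
    rw [this]
    exact Submodule.neg_mem _ (mul_mem_weightGE hF hZ (by omega))
  have qn : q ∈ weightGE d ev n := by
    have := Submodule.add_mem _ (weightGE_anti qq0 (by omega : n ≤ n + 2)) q0n
    rwa [sub_add_cancel] at this
  have eq : e q = -(e F * Z) := by
    simp only [hq, map_sub, Derivation.leibniz, h.e_p, hX4, hY4, hZ4, smul_eq_mul]; ring
  have eeq : e (e q) = -(e (e F) * Z) := by
    simp only [eq, map_neg, Derivation.leibniz, hZ4, smul_eq_mul]; ring
  have eeeq : e (e (e q)) = -(e (e (e F)) * Z) := by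
    simp only [eeq, map_neg, Derivation.leibniz, hZ4, smul_eq_mul]; ring
  have eeeeq : e (e (e (e q))) = -(e (e (e (e F))) * Z) := by
    simp only [eeeq, map_neg, Derivation.leibniz, hZ4, smul_eq_mul]; ring
  -- The weight 6 of `e F` is used here. Nothing is known about further `e`-derivatives of `F`, so
  -- the next three bounds only keep the weight of `Z`.
  have q1 : e q ∈ weightGE d ev (n + 2) := by
    rw [eq]; exact Submodule.neg_mem _ (mul_mem_weightGE heF hZ (by omega))
  have q2 : e (e q) ∈ weightGE d ev (n - 4) := by
    rw [eeq]; exact Submodule.neg_mem _ (mul_mem_weightGE_right _ hZ)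
  have q3 : e (e (e q)) ∈ weightGE d ev (n - 4) := by
    rw [eeeq]; exact Submodule.neg_mem _ (mul_mem_weightGE_right _ hZ)
  have q4 : e (e (e (e q))) ∈ weightGE d ev (n - 4) := by
    rw [eeeeq]; exact Submodule.neg_mem _ (mul_mem_weightGE_right _ hZ)
  -- first total derivative
  set Dq := totalD d e p r G q with hDq
  have A0 : Dq - horizD d p q₀ ∈ weightGE d ev (n - 1) :=
    h.totalD_sub_mem hG qq0 q1 (by omega) (by omega)
  have A1 : e Dq - (horizD d p 0 + d 3 q₀) ∈ weightGE d ev (n - 1) :=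
    h.e_totalD_sub_mem hG (by rw [sub_zero]; exact q1) qq0 q1 q2 (by omega) (by omega) (by omega)
      (by omega)
  have A2 : e (e Dq) ∈ weightGE d ev (n - 7) :=
    h.e_e_totalD_mem hG q1 q2 q3 (by omega) (by omega) (by omega)
  have A3 : e (e (e Dq)) ∈ weightGE d ev (n - 7) :=
    h.e_e_e_totalD_mem hG q1 q2 q3 q4 (by omega) (by omega) (by omega) (by omega)
  have hz : horizD d p 0 = 0 := by simp [horizD]
  rw [hz, zero_add] at A1
  have A0n : Dq ∈ weightGE d ev (n - 3) := by
    have := Submodule.add_mem _ (weightGE_anti A0 (by omega : n - 3 ≤ n - 1))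
      (h.horizD_mem q0n le_rfl)
    rwa [sub_add_cancel] at this
  have A1n : e Dq ∈ weightGE d ev (n - 2) := by
    have := Submodule.add_mem _ (weightGE_anti A1 (by omega : n - 2 ≤ n - 1))
      (d3_mem q0n le_rfl)
    rwa [sub_add_cancel] at this
  -- second total derivative
  set DDq := totalD d e p r G Dq with hDDq
  have B0 : DDq - horizD d p (horizD d p q₀) ∈ weightGE d ev (n - 4) :=
    h.totalD_sub_mem hG A0 A1n (by omega) (by omega)
  have B1 : e DDq - (horizD d p (d 3 q₀) + d 3 (horizD d p q₀)) ∈ weightGE d ev (n - 4) :=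
    h.e_totalD_sub_mem hG A1 A0 A1n A2 (by omega) (by omega) (by omega) (by omega)
  have B2 : e (e DDq) ∈ weightGE d ev (n - 10) :=
    h.e_e_totalD_mem hG A1n A2 A3 (by omega) (by omega) (by omega)
  have B0n : DDq ∈ weightGE d ev (n - 6) := by
    have := Submodule.add_mem _ (weightGE_anti B0 (by omega : n - 6 ≤ n - 4))
      (h.horizD_mem (h.horizD_mem q0n (le_refl (n - 3))) (by omega : n - 6 ≤ n - 3 - 3))
    rwa [sub_add_cancel] at this
  have B1n : e DDq ∈ weightGE d ev (n - 5) := by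
    have := Submodule.add_mem _ (weightGE_anti B1 (by omega : n - 5 ≤ n - 4))
      (Submodule.add_mem _ (h.horizD_mem (d3_mem q0n (le_refl (n - 2)))
        (by omega : n - 5 ≤ n - 2 - 3)) (d3_mem (h.horizD_mem q0n (le_refl (n - 3)))
        (by omega : n - 5 ≤ n - 3 - 2)))
    rwa [sub_add_cancel] at this
  -- third total derivative
  have C0 : totalD d e p r G DDq - horizD d p (horizD d p (horizD d p q₀))
      ∈ weightGE d ev (n - 7) :=
    h.totalD_sub_mem hG B0 B1n (by omega) (by omega)
  have C1 : e (totalD d e p r G DDq)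
      - (horizD d p (horizD d p (d 3 q₀) + d 3 (horizD d p q₀))
        + d 3 (horizD d p (horizD d p q₀))) ∈ weightGE d ev (n - 7) :=
    h.e_totalD_sub_mem hG B1 B0 B1n B2 (by omega) (by omega) (by omega) (by omega)
  -- The filtration sees only `r = 0`; the part of the second equation that is linear in `r` has to
  -- be extracted by applying `e`.
  have eE2 := congrArg e E2
  simp only [map_add, Derivation.leibniz, smul_eq_mul] at eE2
  have P0 : horizD d p (horizD d p (horizD d p q₀)) ∈ weightGE d ev (n - 8) := by
    have R : totalD d e p r G DDq ∈ weightGE d ev (n - 8) := by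
      rw [E2]
      exact Submodule.add_mem _ (Submodule.add_mem _
        (mul_mem_weightGE_right _ (weightGE_anti qn (by omega)))
        (mul_mem_weightGE_right _ (weightGE_anti A0n (by omega))))
        (mul_mem_weightGE_right _ (weightGE_anti B0n (by omega)))
    have := Submodule.sub_mem _ R (weightGE_anti C0 (by omega : n - 8 ≤ n - 7))
    rwa [sub_sub_cancel] at this
  have P1 : horizD d p (horizD d p (d 3 q₀) + d 3 (horizD d p q₀))
        + d 3 (horizD d p (horizD d p q₀)) ∈ weightGE d ev (n - 7) := by
    have R : e (totalD d e p r G DDq) ∈ weightGE d ev (n - 7) := by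
      rw [eE2]
      refine Submodule.add_mem _ (Submodule.add_mem _ (Submodule.add_mem _ ?_ ?_)
        (Submodule.add_mem _ ?_ ?_)) (Submodule.add_mem _ ?_ ?_)
      · exact mul_mem_weightGE_right _ (weightGE_anti q1 (by omega))
      · exact mul_mem_weightGE_left (weightGE_anti qn (by omega)) _
      · exact mul_mem_weightGE_right _ (weightGE_anti A1n (by omega))
      · exact mul_mem_weightGE_left (weightGE_anti A0n (by omega)) _
      · exact mul_mem_weightGE_right _ (weightGE_anti B1n (by omega))
      · exact mul_mem_weightGE_left (weightGE_anti B0n (by omega)) _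
    have := Submodule.sub_mem _ R C1
    rwa [sub_sub_cancel] at this
  -- the first equation
  set f := F - c * p ^ 2 with hf
  have d3F : d 3 F = 2 * c * p + d 3 f := by
    simp only [hf, map_sub, Derivation.leibniz, Derivation.leibniz_pow, dc, h.d3_p, smul_eq_mul,
      nsmul_eq_mul]
    push_cast; ring
  have d2F : d 2 F = d 2 f := by
    simp only [hf, map_sub, Derivation.leibniz, Derivation.leibniz_pow, dc, h.d2_p, smul_eq_mul,
      nsmul_eq_mul]
    ring
  have DF : totalD d e p r G F ∈ weightGE d ev 3 := by
    have hh : horizD d p F = horizD d p f := by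
      simp only [hf, horizD, map_sub, Derivation.leibniz, Derivation.leibniz_pow, dc, h.d2_p,
        h.d0_p, smul_eq_mul, nsmul_eq_mul]
      ring
    rw [totalD, hh]
    exact Submodule.add_mem _ (Submodule.add_mem _ (h.horizD_mem hF (by omega)) (h.r_mul_mem _ _))
      (mul_mem_weightGE_right _ (weightGE_anti heF (by omega)))
  -- This is the linearization of y_{x²} = c (y_{x¹})². The ∂_{y₁}-term of D₂ goes into the error,
  -- since D₁F has weight 3 and `d 3 q` has weight n - 2.
  have P2 : d 1 q₀ + c * p ^ 2 * d 2 q₀ - 2 * c * p * horizD d p q₀ ∈ weightGE d ev n := by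
    have key : d 1 q₀ + c * p ^ 2 * d 2 q₀ - 2 * c * p * horizD d p q₀
        = d 2 f * q + d 3 f * Dq + e F * DDq - totalD d e p r G F * d 3 q
          - totalD d e p r G (totalD d e p r G F) * e q - d 1 (q - q₀)
          - c * p ^ 2 * d 2 (q - q₀) - f * d 2 q + 2 * c * p * (Dq - horizD d p q₀) := by
      rw [map_sub (d 1) q q₀, map_sub (d 2) q q₀]
      rw [d3F, d2F] at E1
      have : F = f + c * p ^ 2 := by rw [hf]; ring
      linear_combination E1 - d 2 q * this
    rw [key]
    refine Submodule.add_mem _ (Submodule.sub_mem _ (Submodule.sub_mem _ (Submodule.sub_mem _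
      (Submodule.sub_mem _ (Submodule.sub_mem _ (Submodule.add_mem _ (Submodule.add_mem _
        ?_ ?_) ?_) ?_) ?_) ?_) ?_) ?_) ?_
    · exact mul_mem_weightGE_right _ qn
    · exact mul_mem_weightGE (d3_mem hF (le_refl 4)) A0n (by omega)
    -- `DDq` has weight only n - 6, so weight 6 of `e F` is exactly what this estimate consumes.
    · exact mul_mem_weightGE heF B0n (by omega)
    · exact mul_mem_weightGE DF (d3_mem qn (le_refl (n - 2))) (by omega)
    · exact mul_mem_weightGE_right _ (weightGE_anti q1 (by omega))
    · exact d1_mem qq0 (by omega)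
    · exact mul_mem_weightGE hcp (d2_mem qq0 (le_refl (n + 2 - 5))) (by omega)
    · exact mul_mem_weightGE hF (d2_mem qn (le_refl (n - 5))) (by omega)
    · exact mul_mem_weightGE (mul_mem_weightGE_right _ h.p_mem : 2 * c * p ∈ weightGE d ev 2) A0
        (by omega)
  -- extraction of the coefficients of the powers of `p`
  have c10 : ∀ g, d 1 (d 0 g) = d 0 (d 1 g) := fun g => h.comm 1 0 g
  have c20 : ∀ g, d 2 (d 0 g) = d 0 (d 2 g) := fun g => h.comm 2 0 g
  have c21 : ∀ g, d 2 (d 1 g) = d 1 (d 2 g) := fun g => h.comm 2 1 g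
  have c30 : ∀ g, d 3 (d 0 g) = d 0 (d 3 g) := fun g => h.comm 3 0 g
  have c31 : ∀ g, d 3 (d 1 g) = d 1 (d 3 g) := fun g => h.comm 3 1 g
  have c32 : ∀ g, d 3 (d 2 g) = d 2 (d 3 g) := fun g => h.comm 3 2 g
  have dn : ∀ i (k : ℕ) [k.AtLeastTwo], d i (OfNat.ofNat k : A) = 0 := fun i k _ =>
    (d i).map_natCast k
  have T2 := h.coeff_mem_five (m := n) (a₀ := d 1 Y) (a₁ := -d 1 X - 2 * c * d 0 Y)
    (a₂ := -(c * d 1 Z) + 2 * c * d 0 X - c * d 2 Y)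
    (a₃ := c * d 2 X + 2 * c ^ 2 * d 0 Z) (a₄ := c ^ 2 * d 2 Z) (a₅ := 0)
    (by simp [c30, c31, c32, hX3, hY3, hZ3, dc])
    (by simp [c30, c31, c32, hX3, hY3, hZ3, dc, dn])
    (by simp [c30, c31, c32, hX3, hY3, hZ3, dc, dn])
    (by simp [c30, c31, c32, hX3, hY3, hZ3, dc, dn])
    (by simp [c30, c31, c32, hX3, hY3, hZ3, dc, dn])
    (by simp) (by
      convert P2 using 1
      simp only [hq₀, horizD, map_sub, Derivation.leibniz, Derivation.leibniz_pow, dc, h.d0_p,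
        h.d1_p, h.d2_p, smul_eq_mul, nsmul_eq_mul]
      ring)
  have T0 := h.coeff_mem_five (m := n - 8) (a₀ := d 0 (d 0 (d 0 Y)))
    (a₁ := 3 * d 0 (d 0 (d 2 Y)) - d 0 (d 0 (d 0 X)))
    (a₂ := 3 * d 0 (d 2 (d 2 Y)) - 3 * d 0 (d 0 (d 2 X)) - c * d 0 (d 0 (d 0 Z)))
    (a₃ := d 2 (d 2 (d 2 Y)) - 3 * d 0 (d 2 (d 2 X)) - 3 * c * d 0 (d 0 (d 2 Z)))
    (a₄ := -d 2 (d 2 (d 2 X)) - 3 * c * d 0 (d 2 (d 2 Z))) (a₅ := -(c * d 2 (d 2 (d 2 Z))))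
    (by simp [c30, c31, c32, hX3, hY3, hZ3, dc, dn])
    (by simp [c30, c31, c32, hX3, hY3, hZ3, dc, dn])
    (by simp [c30, c31, c32, hX3, hY3, hZ3, dc, dn])
    (by simp [c30, c31, c32, hX3, hY3, hZ3, dc, dn])
    (by simp [c30, c31, c32, hX3, hY3, hZ3, dc, dn])
    (by simp [c30, c31, c32, hX3, hY3, hZ3, dc, dn]) (by
      convert P0 using 1
      simp only [hq₀, horizD, map_sub, map_add, Derivation.leibniz, Derivation.leibniz_pow, dc,
        h.d0_p, h.d2_p, smul_eq_mul, nsmul_eq_mul, c20, smul_zero, mul_zero, add_zero,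
        zero_add, map_zero]
      ring)
  have T1 := h.coeff_mem_five (m := n - 7) (a₀ := 3 * (d 0 (d 2 Y) - d 0 (d 0 X)))
    (a₁ := 3 * (d 2 (d 2 Y) - 3 * d 0 (d 2 X) - 2 * c * d 0 (d 0 Z)))
    (a₂ := 3 * (-2 * d 2 (d 2 X) - 5 * c * d 0 (d 2 Z)))
    (a₃ := -9 * c * d 2 (d 2 Z)) (a₄ := 0) (a₅ := 0)
    (by simp [c30, c31, c32, hX3, hY3, hZ3, dc, dn])
    (by simp [c30, c31, c32, hX3, hY3, hZ3, dc, dn])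
    (by simp [c30, c31, c32, hX3, hY3, hZ3, dc, dn])
    (by simp [c30, c31, c32, hX3, hY3, hZ3, dc, dn])
    (by simp) (by simp) (by
      convert P1 using 1
      have dnat : ∀ i (k : ℕ), d i (k : A) = 0 := fun i k => (d i).map_natCast k
      simp only [hq₀, horizD, map_sub, map_add, Derivation.leibniz, Derivation.leibniz_pow, dc,
        h.d0_p, h.d2_p, h.d3_p, smul_eq_mul, nsmul_eq_mul, c20, c30, c32, smul_zero, mul_zero,
        add_zero, zero_add, map_zero, hX3, hY3, hZ3, dnat, Derivation.map_one_eq_zero]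
      push_cast
      ring)
  have smul_c : ∀ (a : ℕ) (g : A), (a : 𝕜) • g = (a : A) * g := fun a g => by
    rw [Algebra.smul_def, map_natCast]
  have smul2 : ∀ g : A, (2 : 𝕜) • g = 2 * g := fun g => by exact_mod_cast smul_c 2 g
  have smul3 : ∀ g : A, (3 : 𝕜) • g = 3 * g := fun g => by exact_mod_cast smul_c 3 g
  -- The factors -2, -4, 8, 16 clear the powers of c = 1/4. From `T1` only the constant coefficient
  -- is needed, from `T0` only the first two.
  refine mem_of_model_equations h.comm hX3 hZ3 hY3 h0 T2.1 ?_ ?_ ?_ ?_ ?_ T0.1 ?_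
  · convert mul_mem_weightGE_right (-2 : A) T2.2.1 using 1
    rw [smul2]; linear_combination -(d 0 Y) * c4
  · convert mul_mem_weightGE_right (-4 : A) T2.2.2.1 using 1
    rw [smul2]; linear_combination -(d 1 Z - 2 * d 0 X + d 2 Y) * c4
  · convert mul_mem_weightGE_right (8 : A) T2.2.2.2.1 using 1
    rw [smul2]; linear_combination (-2 * d 2 X - d 0 Z * (1 + 4 * c)) * c4
  · convert mul_mem_weightGE_right (16 : A) T2.2.2.2.2 using 1
    linear_combination -(d 2 Z * (1 + 4 * c)) * c4
  · refine mem_weightGE_of_natCast_mul (n := 3) (by norm_num) ?_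
    convert Submodule.neg_mem _ T1.1 using 1
    push_cast; ring
  · convert weightGE_anti T0.2.1 (by omega : n - 10 ≤ n - 8 - 2) using 1
    rw [smul3]

/-- A triple with vanishing initial coefficients that satisfies the determining equations of a
normalized system vanishes to infinite order. -/
theorem IsJetAlgebra.mem_weightGE_of_determining [CharZero 𝕜] (h : IsJetAlgebra d e ev p r)
    {F G X Z Y : A}
    (hF : F - algebraMap 𝕜 A (1 / 4) * p ^ 2 ∈ weightGE d ev 6) (heF : e F ∈ weightGE d ev 6)
    (hG : G ∈ weightGE d ev 6)
    (hX3 : d 3 X = 0) (hZ3 : d 3 Z = 0) (hY3 : d 3 Y = 0)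
    (hX4 : e X = 0) (hZ4 : e Z = 0) (hY4 : e Y = 0) (h0 : InitialZero d ev X Z Y)
    (hE : Determining d e p r F G (Y - p * X - F * Z)) (n : ℕ) :
    Y ∈ weightGE d ev n ∧ X ∈ weightGE d ev (n - 2) ∧ Z ∈ weightGE d ev (n - 4) := by
  induction n with
  | zero => exact ⟨mem_weightGE_zero _, mem_weightGE_zero _, mem_weightGE_zero _⟩
  | succ n ih =>
    obtain ⟨hY, hX, hZ⟩ := h.mem_succ hF heF hG hX3 hZ3 hY3 hX4 hZ4 hY4 h0 hE ih.1 ih.2.1 ih.2.2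
    exact ⟨hY, weightGE_anti hX (by omega), weightGE_anti hZ (by omega)⟩

end DeterminingEquations

/-! ### Germs of analytic functions as a differential algebra. -/

section AnalyticGerms

variable {𝕜 : Type*} [RCLike 𝕜]

lemma fderiv_eq_sum_pd {n : ℕ} (f : (Fin n → 𝕜) → 𝕜) (z v : Fin n → 𝕜) :
    fderiv 𝕜 f z v = ∑ i, v i * pd i f z := by
  conv_lhs => rw [pi_eq_sum_univ' v]
  simp only [map_sum, map_smul, smul_eq_mul, pd]

lemma analyticAt_pd {n : ℕ} {f : (Fin n → 𝕜) → 𝕜} {z : Fin n → 𝕜} (hf : AnalyticAt 𝕜 f z)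
    (i : Fin n) : AnalyticAt 𝕜 (pd i f) z :=
  show AnalyticAt 𝕜 (ContinuousLinearMap.apply 𝕜 𝕜 (Pi.single i (1 : 𝕜)) ∘ fderiv 𝕜 f) z from
    (ContinuousLinearMap.apply 𝕜 𝕜 (Pi.single i (1 : 𝕜))).analyticAt _ |>.comp hf.fderiv

lemma pd_congr {n : ℕ} {f g : (Fin n → 𝕜) → 𝕜} {z : Fin n → 𝕜} (h : f =ᶠ[𝓝 z] g) (i : Fin n) :
    pd i f =ᶠ[𝓝 z] pd i g :=
  (h.fderiv (𝕜 := 𝕜)).mono fun y hy => by simp only [pd, hy]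

lemma pd_comm {n : ℕ} {f : (Fin n → 𝕜) → 𝕜} {z : Fin n → 𝕜} (hf : ContDiffAt 𝕜 2 f z)
    (i j : Fin n) : pd i (pd j f) z = pd j (pd i f) z := by
  have hd : DifferentiableAt 𝕜 (fderiv 𝕜 f) z :=
    (hf.fderiv_right (m := 1) (by norm_num)).differentiableAt (by norm_num)
  have key : ∀ i j : Fin n, pd i (pd j f) z
      = fderiv 𝕜 (fderiv 𝕜 f) z (Pi.single i 1) (Pi.single j 1) := fun i j => by
    have : pd j f = fun y => fderiv 𝕜 f y (Pi.single j 1) := rfl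
    rw [this, pd, fderiv_clm_apply hd (differentiableAt_const _)]
    simp
  rw [key, key]
  exact hf.isSymmSndFDerivAt (by simp) _ _

/-- An analytic function vanishes near `0` if it belongs to a class of analytic functions that
vanish at `0` and is stable under directional derivatives. -/
lemma eventuallyEq_zero_of_fderiv_stable {n : ℕ} (P : ((Fin n → 𝕜) → 𝕜) → Prop)
    (han : ∀ f, P f → AnalyticAt 𝕜 f 0) (h0 : ∀ f, P f → f 0 = 0)
    (hpd : ∀ f v, P f → P (fun y => fderiv 𝕜 f y v)) {f : (Fin n → 𝕜) → 𝕜} (hf : P f) :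
    f =ᶠ[𝓝 0] 0 := by
  -- The derivative of order k + 1 is a derivative of order k of a directional derivative, which
  -- lies in the class again; so the whole Taylor series vanishes.
  have key : ∀ (k : ℕ) (f : (Fin n → 𝕜) → 𝕜), P f → iteratedFDeriv 𝕜 k f 0 = 0 := by
    intro k
    induction k with
    | zero =>
      intro f hf
      ext m
      simp [iteratedFDeriv_zero_apply, h0 f hf]
    | succ k ih =>
      intro f hf
      ext m
      rw [iteratedFDeriv_succ_apply_right]
      have hcomp := (ContinuousLinearMap.apply 𝕜 𝕜 (m (Fin.last k))).iteratedFDeriv_comp_left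
        (han f hf).fderiv.contDiffAt (i := k) (n := k) le_rfl
      have := ih _ (hpd f (m (Fin.last k)) hf)
      change iteratedFDeriv 𝕜 k (ContinuousLinearMap.apply 𝕜 𝕜 (m (Fin.last k)) ∘ fderiv 𝕜 f) 0
        = 0 at this
      rw [hcomp] at this
      simpa using congrArg (fun T => T (Fin.init m)) this
  obtain ⟨p, hp⟩ := han f hf
  obtain ⟨r, hr⟩ := hp
  have hball : ∀ y ∈ Metric.eball (0 : Fin n → 𝕜) r, f y = 0 := by
    intro y hy
    have hs := hr.hasSum hy
    have hz : ∀ m, p m (fun _ => y) = 0 := by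
      intro m
      have := hr.factorial_smul y m
      rw [key m f hf] at this
      simpa [Nat.factorial_ne_zero] using this
    simp only [hz, zero_add] at hs
    exact hs.unique hasSum_zero
  exact Filter.mem_of_superset (Metric.eball_mem_nhds _ hr.r_pos) hball

variable (𝕜) in
/-- The algebra of functions of `n` variables that are analytic at `0`. -/
def analyticSubalgebra (n : ℕ) : Subalgebra 𝕜 ((Fin n → 𝕜) → 𝕜) where
  carrier := {f | AnalyticAt 𝕜 f 0}
  mul_mem' hf hg := hf.mul hg
  add_mem' hf hg := hf.add hg
  algebraMap_mem' _ := analyticAt_const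

variable (𝕜) in
/-- The ideal of the analytic functions that vanish near `0`. -/
def nullIdeal (n : ℕ) : Ideal (analyticSubalgebra 𝕜 n) where
  carrier := {f | (f : (Fin n → 𝕜) → 𝕜) =ᶠ[𝓝 0] 0}
  add_mem' {f g} hf hg := by
    have := hf.add hg
    simpa using this
  zero_mem' := EventuallyEq.rfl
  smul_mem' c f hf := by
    have := (EventuallyEq.refl (𝓝 0) (c : (Fin n → 𝕜) → 𝕜)).mul hf
    simpa using this

variable (𝕜) in
/-- The algebra of germs at `0` of analytic functions of `n` variables. -/
def AnalyticGerm (n : ℕ) : Type _ := analyticSubalgebra 𝕜 n ⧸ nullIdeal 𝕜 n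

instance (n : ℕ) : CommRing (AnalyticGerm 𝕜 n) :=
  inferInstanceAs (CommRing (analyticSubalgebra 𝕜 n ⧸ nullIdeal 𝕜 n))

instance (n : ℕ) : Algebra 𝕜 (AnalyticGerm 𝕜 n) :=
  inferInstanceAs (Algebra 𝕜 (analyticSubalgebra 𝕜 n ⧸ nullIdeal 𝕜 n))

/-- The germ of an analytic function. -/
def toGerm {n : ℕ} (f : (Fin n → 𝕜) → 𝕜) (hf : AnalyticAt 𝕜 f 0) : AnalyticGerm 𝕜 n :=
  Ideal.Quotient.mk (nullIdeal 𝕜 n) ⟨f, hf⟩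

lemma toGerm_eq_iff {n : ℕ} {f g : (Fin n → 𝕜) → 𝕜} (hf : AnalyticAt 𝕜 f 0)
    (hg : AnalyticAt 𝕜 g 0) : toGerm f hf = toGerm g hg ↔ f =ᶠ[𝓝 0] g := by
  refine (Ideal.Quotient.eq (I := nullIdeal 𝕜 n) (x := ⟨f, hf⟩) (y := ⟨g, hg⟩)).trans ?_
  exact eventuallyEq_iff_sub.symm

lemma exists_toGerm {n : ℕ} (a : AnalyticGerm 𝕜 n) : ∃ f hf, a = toGerm f hf := by
  obtain ⟨⟨f, hf⟩, rfl⟩ := Ideal.Quotient.mk_surjective a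
  exact ⟨f, hf, rfl⟩

lemma toGerm_add {n : ℕ} {f g : (Fin n → 𝕜) → 𝕜} (hf : AnalyticAt 𝕜 f 0)
    (hg : AnalyticAt 𝕜 g 0) : toGerm f hf + toGerm g hg = toGerm (f + g) (hf.add hg) := rfl

lemma toGerm_sub {n : ℕ} {f g : (Fin n → 𝕜) → 𝕜} (hf : AnalyticAt 𝕜 f 0)
    (hg : AnalyticAt 𝕜 g 0) : toGerm f hf - toGerm g hg = toGerm (f - g) (hf.sub hg) := rfl

lemma toGerm_mul {n : ℕ} {f g : (Fin n → 𝕜) → 𝕜} (hf : AnalyticAt 𝕜 f 0)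
    (hg : AnalyticAt 𝕜 g 0) : toGerm f hf * toGerm g hg = toGerm (f * g) (hf.mul hg) := rfl

lemma toGerm_pow {n : ℕ} {f : (Fin n → 𝕜) → 𝕜} (hf : AnalyticAt 𝕜 f 0) (k : ℕ) :
    toGerm f hf ^ k = toGerm (f ^ k) (hf.pow k) := rfl

lemma algebraMap_eq_toGerm {n : ℕ} (c : 𝕜) :
    algebraMap 𝕜 (AnalyticGerm 𝕜 n) c = toGerm (fun _ => c) analyticAt_const := rfl

/-- The linear map on germs induced by a linear operation on analytic functions. -/
def germLift {n : ℕ} {M : Type*} [AddCommGroup M] [Module 𝕜 M]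
    (T : analyticSubalgebra 𝕜 n →ₗ[𝕜] M)
    (hT : ∀ f : analyticSubalgebra 𝕜 n, (f : (Fin n → 𝕜) → 𝕜) =ᶠ[𝓝 0] 0 → T f = 0) :
    AnalyticGerm 𝕜 n →ₗ[𝕜] M :=
  ((nullIdeal 𝕜 n).restrictScalars 𝕜).liftQ T fun f hf => hT f hf

variable (𝕜) in
/-- The partial derivative in the `i`-th direction of germs of analytic functions. -/
def germPd {n : ℕ} (i : Fin n) : Derivation 𝕜 (AnalyticGerm 𝕜 n) (AnalyticGerm 𝕜 n) :=
  Derivation.mk' (germLift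
    { toFun := fun f => toGerm (pd i f) (analyticAt_pd f.2 i)
      map_add' := fun f g => by
        rw [toGerm_add, toGerm_eq_iff]
        filter_upwards [f.2.eventually_analyticAt, g.2.eventually_analyticAt] with z hf hg
        change fderiv 𝕜 ((f : (Fin n → 𝕜) → 𝕜) + (g : (Fin n → 𝕜) → 𝕜)) z _ = _
        rw [fderiv_add hf.differentiableAt hg.differentiableAt]
        rfl
      map_smul' := fun c f => by
        change _ = toGerm (c • pd i (f : (Fin n → 𝕜) → 𝕜)) (analyticAt_pd f.2 i).const_smul
        rw [toGerm_eq_iff]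
        filter_upwards [f.2.eventually_analyticAt] with z hf
        change fderiv 𝕜 (c • (f : (Fin n → 𝕜) → 𝕜)) z _ = _
        rw [fderiv_const_smul hf.differentiableAt]
        rfl }
    (fun f hf => by
      change toGerm _ _ = toGerm (fun _ => 0) analyticAt_const
      rw [toGerm_eq_iff]
      refine (pd_congr hf i).trans (Eventually.of_forall fun z => ?_)
      change fderiv 𝕜 (fun _ => (0 : 𝕜)) z _ = _
      simp))
    (fun a b => by
      obtain ⟨f, hf, rfl⟩ := exists_toGerm a
      obtain ⟨g, hg, rfl⟩ := exists_toGerm b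
      change toGerm (pd i (f * g)) (analyticAt_pd (hf.mul hg) i)
        = toGerm (f * pd i g + g * pd i f)
          ((hf.mul (analyticAt_pd hg i)).add (hg.mul (analyticAt_pd hf i)))
      · rw [toGerm_eq_iff]
        filter_upwards [hf.eventually_analyticAt, hg.eventually_analyticAt] with z hf hg
        simp only [pd]
        rw [fderiv_mul hf.differentiableAt hg.differentiableAt]
        simp [pd])

lemma germPd_toGerm {n : ℕ} (i : Fin n) {f : (Fin n → 𝕜) → 𝕜} (hf : AnalyticAt 𝕜 f 0) :
    germPd 𝕜 i (toGerm f hf) = toGerm (pd i f) (analyticAt_pd hf i) := rfl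

lemma toGerm_sum {n : ℕ} {ι : Type*} (s : Finset ι) (f : ι → (Fin n → 𝕜) → 𝕜)
    (hf : ∀ i, AnalyticAt 𝕜 (f i) 0) :
    ∑ i ∈ s, toGerm (f i) (hf i)
      = toGerm (fun z => ∑ i ∈ s, f i z) (Finset.analyticAt_fun_sum _ fun i _ => hf i) := by
  classical
  induction s using Finset.induction_on with
  | empty => rfl
  | insert a s ha ih =>
    rw [Finset.sum_insert ha, ih, toGerm_add, toGerm_eq_iff]
    exact Eventually.of_forall fun z => by simp [Finset.sum_insert ha]

lemma toGerm_fderiv_apply {n : ℕ} {f : (Fin n → 𝕜) → 𝕜} (hf : AnalyticAt 𝕜 f 0) (v : Fin n → 𝕜)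
    (hv : AnalyticAt 𝕜 (fun y => fderiv 𝕜 f y v) 0) :
    toGerm _ hv = ∑ i, v i • germPd 𝕜 i (toGerm f hf) := by
  have h : ∀ i, v i • germPd 𝕜 i (toGerm f hf)
      = toGerm (v i • pd i f) (analyticAt_pd hf i).const_smul := fun i => rfl
  simp only [h]
  rw [toGerm_sum, toGerm_eq_iff]
  exact Eventually.of_forall fun z => fderiv_eq_sum_pd f z v

variable (𝕜) in
/-- The value at `0` of germs of analytic functions. -/
def germEv (n : ℕ) : AnalyticGerm 𝕜 n →ₐ[𝕜] 𝕜 :=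
  Ideal.Quotient.liftₐ (nullIdeal 𝕜 n)
    ((Pi.evalAlgHom 𝕜 (fun _ : Fin n → 𝕜 => 𝕜) 0).comp (analyticSubalgebra 𝕜 n).val)
    fun _ hf => hf.self_of_nhds

lemma germPd_comm {n : ℕ} (i j : Fin n) (a : AnalyticGerm 𝕜 n) :
    germPd 𝕜 i (germPd 𝕜 j a) = germPd 𝕜 j (germPd 𝕜 i a) := by
  obtain ⟨f, hf, rfl⟩ := exists_toGerm a
  simp only [germPd_toGerm]
  rw [toGerm_eq_iff]
  filter_upwards [hf.eventually_analyticAt] with z hz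
  exact pd_comm hz.contDiffAt i j

lemma analyticAt_coord {n : ℕ} (i : Fin n) (z : Fin n → 𝕜) :
    AnalyticAt 𝕜 (fun z : Fin n → 𝕜 => z i) z :=
  (ContinuousLinearMap.proj (R := 𝕜) (φ := fun _ : Fin n => 𝕜) i).analyticAt z

lemma pd_coord {n : ℕ} (i j : Fin n) (z : Fin n → 𝕜) :
    pd i (fun z : Fin n → 𝕜 => z j) z = if i = j then 1 else 0 := by
  have : fderiv 𝕜 (fun z : Fin n → 𝕜 => z j) z
      = ContinuousLinearMap.proj (R := 𝕜) (φ := fun _ : Fin n => 𝕜) j :=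
    (ContinuousLinearMap.proj (R := 𝕜) (φ := fun _ : Fin n => 𝕜) j).fderiv
  rw [pd, this]
  simp [Pi.single_apply, eq_comm]

variable (𝕜) in
/-- The germ of the `i`-th coordinate. -/
def germCoord {n : ℕ} (i : Fin n) : AnalyticGerm 𝕜 n := toGerm (fun z => z i) (analyticAt_coord i 0)

lemma germPd_germCoord {n : ℕ} (i j : Fin n) :
    germPd 𝕜 i (germCoord 𝕜 j) = if i = j then 1 else 0 := by
  rw [germCoord, germPd_toGerm]
  have h1 : (1 : AnalyticGerm 𝕜 n) = toGerm (fun _ => 1) analyticAt_const := rfl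
  have h0 : (0 : AnalyticGerm 𝕜 n) = toGerm (fun _ => 0) analyticAt_const := rfl
  split_ifs with h
  · rw [h1, toGerm_eq_iff]
    exact Eventually.of_forall fun z => by simp [pd_coord, h]
  · rw [h0, toGerm_eq_iff]
    exact Eventually.of_forall fun z => by simp [pd_coord, h]

variable (𝕜) in
/-- The partial derivatives in the directions `x¹, x², y, y₁` on the skeleton. -/
def skelPd (i : Fin 4) : Derivation 𝕜 (AnalyticGerm 𝕜 5) (AnalyticGerm 𝕜 5) := germPd 𝕜 i.castSucc

variable (𝕜) in
/-- The partial derivative in the direction `y₁₁` on the skeleton. -/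
def skelPdLast : Derivation 𝕜 (AnalyticGerm 𝕜 5) (AnalyticGerm 𝕜 5) := germPd 𝕜 4

variable (𝕜) in
/-- The value at the origin of the skeleton. -/
def skelEv : AnalyticGerm 𝕜 5 →ₐ[𝕜] 𝕜 := germEv 𝕜 5

variable (𝕜) in
/-- The coordinate `y₁` on the skeleton. -/
def skelP : AnalyticGerm 𝕜 5 := germCoord 𝕜 3

variable (𝕜) in
/-- The coordinate `y₁₁` on the skeleton. -/
def skelR : AnalyticGerm 𝕜 5 := germCoord 𝕜 4

variable (𝕜) in
lemma isJetAlgebra_skeleton :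
    IsJetAlgebra (skelPd 𝕜) (skelPdLast 𝕜) (skelEv 𝕜) (skelP 𝕜) (skelR 𝕜) where
  comm i j f := germPd_comm _ _ _
  comm_e i f := germPd_comm _ _ _
  ev_p := rfl
  d0_p := by rw [skelPd, skelP, germPd_germCoord, if_neg (by decide)]
  d1_p := by rw [skelPd, skelP, germPd_germCoord, if_neg (by decide)]
  d2_p := by rw [skelPd, skelP, germPd_germCoord, if_neg (by decide)]
  d3_p := by rw [skelPd, skelP, germPd_germCoord, if_pos (by decide)]
  e_p := by rw [skelPdLast, skelP, germPd_germCoord, if_neg (by decide)]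
  ev_r := rfl
  d_r i := by rw [skelPd, skelR, germPd_germCoord, if_neg (by revert i; decide)]
  e_r := by rw [skelPdLast, skelR, germPd_germCoord, if_pos rfl]

/-- Infinite weight kills the Taylor coefficients in the first four variables, and independence of
y₁₁ kills the others. Both properties survive differentiation, because the loss of weight does not
matter when every weight is available. -/
lemma toGerm_eq_zero_of_weight {f : (Fin 5 → 𝕜) → 𝕜} (hf : AnalyticAt 𝕜 f 0)
    (he : skelPdLast 𝕜 (toGerm f hf) = 0)
    (hV : ∀ n, toGerm f hf ∈ weightGE (skelPd 𝕜) (skelEv 𝕜) n) : f =ᶠ[𝓝 0] 0 := by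
  refine eventuallyEq_zero_of_fderiv_stable
    (fun f => ∃ hf : AnalyticAt 𝕜 f 0, skelPdLast 𝕜 (toGerm f hf) = 0 ∧
      ∀ n, toGerm f hf ∈ weightGE (skelPd 𝕜) (skelEv 𝕜) n) (fun f h => h.1) ?_ ?_ ⟨hf, he, hV⟩
  · rintro f ⟨hf, -, hV⟩
    exact (mem_weightGE_iff.1 (hV 1)).1 one_pos
  · rintro f v ⟨hf, he, hV⟩
    have hv : AnalyticAt 𝕜 (fun y => fderiv 𝕜 f y v) 0 :=
      (ContinuousLinearMap.apply 𝕜 𝕜 v).analyticAt _ |>.comp hf.fderiv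
    refine ⟨hv, ?_⟩
    have hsum : toGerm _ hv = ∑ i, v i • germPd 𝕜 i (toGerm f hf) := by
      rw [toGerm_fderiv_apply]
    rw [hsum]
    refine ⟨?_, fun n => Submodule.sum_mem _ fun i _ => Submodule.smul_mem _ _ ?_⟩
    · rw [map_sum]
      refine Finset.sum_eq_zero fun i _ => ?_
      rw [Derivation.map_smul, skelPdLast, germPd_comm, ← skelPdLast, he, map_zero, smul_zero]
    · refine Fin.lastCases ?_ (fun j => ?_) i
      · change skelPdLast 𝕜 (toGerm f hf) ∈ _
        rw [he]; exact Submodule.zero_mem _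
      · exact der_mem_weightGE j (hV (n + coordWeight j)) (Or.inl le_rfl)

end AnalyticGerms

/-! ### Weights of the normal form, the linear determining space and the dimension bound. -/

section Skeleton

variable {𝕜 : Type*} [RCLike 𝕜]

variable (𝕜) in
/-- The projection of `𝕜ⁿ` onto its first `m` coordinates. -/
def projInit {m n : ℕ} (h : m ≤ n) : (Fin n → 𝕜) →L[𝕜] (Fin m → 𝕜) :=
  ContinuousLinearMap.pi fun j => ContinuousLinearMap.proj (Fin.castLE h j)

lemma projInit_single {m n : ℕ} (h : m ≤ n) (j : Fin m) :
    projInit 𝕜 h (Pi.single (Fin.castLE h j) 1) = Pi.single j 1 := by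
  ext k
  simp [projInit, Pi.single_apply, Fin.ext_iff]

lemma projInit_single_of_le {m n : ℕ} (h : m ≤ n) (i : Fin n) (hi : m ≤ i) :
    projInit 𝕜 h (Pi.single i 1) = 0 := by
  ext k
  have : (k : ℕ) ≠ i := by omega
  simp [projInit, Fin.ext_iff, this]

lemma analyticAt_comp_projInit {m n : ℕ} (h : m ≤ n) {f : (Fin m → 𝕜) → 𝕜}
    (hf : AnalyticAt 𝕜 f 0) : AnalyticAt 𝕜 (fun z : Fin n → 𝕜 => f (projInit 𝕜 h z)) 0 :=
  AnalyticAt.fun_comp (by rw [map_zero]; exact hf) ((projInit 𝕜 h).analyticAt 0)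

/-- The germ at the origin of the skeleton of an analytic function of the first `m`
coordinates. -/
def pullGerm {m : ℕ} (h : m ≤ 5) (f : (Fin m → 𝕜) → 𝕜) (hf : AnalyticAt 𝕜 f 0) :
    AnalyticGerm 𝕜 5 :=
  toGerm (fun z => f (projInit 𝕜 h z)) (analyticAt_comp_projInit h hf)

lemma eventually_fderiv_comp_projInit {m n : ℕ} (h : m ≤ n) {f : (Fin m → 𝕜) → 𝕜}
    (hf : AnalyticAt 𝕜 f 0) : ∀ᶠ z in 𝓝 (0 : Fin n → 𝕜), ∀ v,
      fderiv 𝕜 (fun z => f (projInit 𝕜 h z)) z v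
        = fderiv 𝕜 f (projInit 𝕜 h z) (projInit 𝕜 h v) := by
  have ht : Tendsto (projInit 𝕜 h) (𝓝 0) (𝓝 0) := by
    simpa using (projInit 𝕜 h).continuous.tendsto 0
  filter_upwards [ht.eventually hf.eventually_analyticAt] with z hz v
  have := (hz.differentiableAt.hasFDerivAt.comp z (projInit 𝕜 h).hasFDerivAt).fderiv
  rw [Function.comp_def] at this
  rw [this]
  rfl

lemma germPd_pullGerm {m : ℕ} (h : m ≤ 5) {f : (Fin m → 𝕜) → 𝕜} (hf : AnalyticAt 𝕜 f 0)
    (j : Fin m) :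
    germPd 𝕜 (Fin.castLE h j) (pullGerm h f hf) = pullGerm h (pd j f) (analyticAt_pd hf j) := by
  rw [pullGerm, germPd_toGerm, pullGerm, toGerm_eq_iff]
  filter_upwards [eventually_fderiv_comp_projInit h hf] with z hz
  rw [pd, hz, projInit_single, pd]

lemma germPd_pullGerm_of_le {m : ℕ} (h : m ≤ 5) {f : (Fin m → 𝕜) → 𝕜} (hf : AnalyticAt 𝕜 f 0)
    (i : Fin 5) (hi : m ≤ i) : germPd 𝕜 i (pullGerm h f hf) = 0 := by
  have h0 : (0 : AnalyticGerm 𝕜 5) = toGerm (fun _ => 0) analyticAt_const := rfl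
  rw [pullGerm, germPd_toGerm, h0, toGerm_eq_iff]
  filter_upwards [eventually_fderiv_comp_projInit h hf] with z hz
  rw [pd, hz, projInit_single_of_le h i hi, map_zero]

lemma skelEv_pullGerm {m : ℕ} (h : m ≤ 5) {f : (Fin m → 𝕜) → 𝕜} (hf : AnalyticAt 𝕜 f 0) :
    skelEv 𝕜 (pullGerm h f hf) = f 0 := by
  change f (projInit 𝕜 h 0) = f 0
  rw [map_zero]

lemma projInit_two (z : Fin 5 → 𝕜) : projInit 𝕜 (by norm_num : 2 ≤ 5) z = ![z 0, z 1] := by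
  ext j; fin_cases j <;> rfl

lemma projInit_three (z : Fin 5 → 𝕜) :
    projInit 𝕜 (by norm_num : 3 ≤ 5) z = ![z 0, z 1, z 2] := by
  ext j; fin_cases j <;> rfl

/-- The only consequences of the normalization that matter: `F - (y₁)² / 4`, `F_{y₁₁}` and `G`
have weight at least `6`. -/
lemma weight_of_isNormalized {F G : (Fin 5 → 𝕜) → 𝕜} (hF : AnalyticAt 𝕜 F 0)
    (hG : AnalyticAt 𝕜 G 0) (hnorm : IsNormalized F G) :
    toGerm F hF - algebraMap 𝕜 _ (1 / 4) * skelP 𝕜 ^ 2 ∈ weightGE (skelPd 𝕜) (skelEv 𝕜) 6 ∧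
      skelPdLast 𝕜 (toGerm F hF) ∈ weightGE (skelPd 𝕜) (skelEv 𝕜) 6 ∧
      toGerm G hG ∈ weightGE (skelPd 𝕜) (skelEv 𝕜) 6 := by
  obtain ⟨a, b, s, c, d, e, R, ha, hb, hs, hc, hd, he, hR, hs0, hs1, hFG⟩ := hnorm
  have h2 : 2 ≤ 5 := by norm_num
  have J := isJetAlgebra_skeleton 𝕜
  set p := skelP 𝕜 with hp
  set r := skelR 𝕜 with hr
  set κ : AnalyticGerm 𝕜 5 := algebraMap 𝕜 _ (1 / 4) with hκ
  let a' : Fin 3 → AnalyticGerm 𝕜 5 := fun i => pullGerm h2 (a i) (ha i)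
  let b' : Fin 3 → AnalyticGerm 𝕜 5 := fun i => pullGerm h2 (b i) (hb i)
  let d' : Fin 4 → AnalyticGerm 𝕜 5 := fun i => pullGerm h2 (d i) (hd i)
  let e' : Fin 4 → AnalyticGerm 𝕜 5 := fun i => pullGerm h2 (e i) (he i)
  let s' : AnalyticGerm 𝕜 5 := pullGerm h2 s hs
  let c' : AnalyticGerm 𝕜 5 := pullGerm h2 c hc
  let R' : Fin 4 → AnalyticGerm 𝕜 5 := fun i => toGerm (R i) (hR i)
  have HF : toGerm F hF = κ * p ^ 2 + p ^ 3 * a' 0 + p ^ 4 * a' 1 + p ^ 5 * a' 2 + p ^ 6 * R' 0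
      + r * (p ^ 2 * s' + p ^ 3 * b' 0 + p ^ 4 * b' 1 + p ^ 5 * b' 2) + r ^ 2 * R' 1 := by
    simp only [hκ, hp, hr, skelP, skelR, germCoord, a', b', s', R', pullGerm, algebraMap_eq_toGerm,
      toGerm_pow, toGerm_mul, toGerm_add]
    rw [toGerm_eq_iff]
    filter_upwards [hFG] with z hz
    rw [hz.1]
    simp only [projInit_two, Pi.add_apply, Pi.mul_apply, Pi.pow_apply]
  have HG : toGerm G hG = p ^ 3 * c' + p ^ 4 * R' 2
      + r * (d' 0 + p * d' 1 + p ^ 2 * d' 2 + p ^ 3 * d' 3)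
      + r ^ 2 * (e' 0 + p * e' 1 + p ^ 2 * e' 2 + p ^ 3 * e' 3) + r ^ 3 * R' 3 := by
    simp only [hp, hr, skelP, skelR, germCoord, c', d', e', R', pullGerm,
      toGerm_pow, toGerm_mul, toGerm_add]
    rw [toGerm_eq_iff]
    filter_upwards [hFG] with z hz
    rw [hz.2]
    simp only [projInit_two, Pi.add_apply, Pi.mul_apply, Pi.pow_apply]
  -- The conditions on `s` at the origin serve here: without them the term y₁² s would give F_{y₁₁}
  -- weight 4 only. No condition on the x¹-derivative is needed, as x¹ has weight 3.
  have hs' : s' ∈ weightGE (skelPd 𝕜) (skelEv 𝕜) 2 := by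
    refine mem_weightGE_mk (fun _ => ?_) (mem_weightGE_zero _) ?_ (mem_weightGE_zero _)
      (mem_weightGE_zero _)
    · rw [skelEv_pullGerm, hs0]
    · refine mem_weightGE_mk (fun _ => ?_) (mem_weightGE_zero _) (mem_weightGE_zero _)
        (mem_weightGE_zero _) (mem_weightGE_zero _)
      have : skelPd 𝕜 1 s' = pullGerm h2 (pd 1 s) (analyticAt_pd hs 1) := germPd_pullGerm h2 hs 1
      rw [this, skelEv_pullGerm, hs1]
  have hpow : ∀ (k : ℕ) (x : AnalyticGerm 𝕜 5), 3 ≤ k →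
      p ^ k * x ∈ weightGE (skelPd 𝕜) (skelEv 𝕜) 6 := fun k x hk =>
    mul_mem_weightGE_left (weightGE_anti (J.p_pow_mem k) (by omega)) x
  have hrm : ∀ (x : AnalyticGerm 𝕜 5), r * x ∈ weightGE (skelPd 𝕜) (skelEv 𝕜) 6 := fun x =>
    mul_mem_weightGE_left (J.r_mem 6) x
  refine ⟨?_, ?_, ?_⟩
  · have : toGerm F hF - κ * p ^ 2 = p ^ 3 * (a' 0 + p * a' 1 + p ^ 2 * a' 2 + p ^ 3 * R' 0)
        + r * (p ^ 2 * s' + p ^ 3 * b' 0 + p ^ 4 * b' 1 + p ^ 5 * b' 2 + r * R' 1) := by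
      rw [HF]; ring
    rw [this]
    exact Submodule.add_mem _ (hpow 3 _ le_rfl) (hrm _)
  · have ek : skelPdLast 𝕜 κ = 0 := Derivation.map_algebraMap _ _
    have ep : skelPdLast 𝕜 p = 0 := J.e_p
    have er : skelPdLast 𝕜 r = 1 := J.e_r
    have ea : ∀ i, skelPdLast 𝕜 (a' i) = 0 := fun i => germPd_pullGerm_of_le h2 (ha i) 4 (by decide)
    have eb : ∀ i, skelPdLast 𝕜 (b' i) = 0 := fun i => germPd_pullGerm_of_le h2 (hb i) 4 (by decide)
    have es : skelPdLast 𝕜 s' = 0 := germPd_pullGerm_of_le h2 hs 4 (by decide)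
    have : skelPdLast 𝕜 (toGerm F hF) = p ^ 2 * s'
        + p ^ 3 * (b' 0 + p * b' 1 + p ^ 2 * b' 2 + p ^ 3 * skelPdLast 𝕜 (R' 0))
        + r * (2 * R' 1 + r * skelPdLast 𝕜 (R' 1)) := by
      rw [HF]
      simp only [map_add, Derivation.leibniz, Derivation.leibniz_pow, ek, ep, er, ea, eb, es,
        smul_eq_mul, nsmul_eq_mul]
      push_cast
      ring
    rw [this]
    exact Submodule.add_mem _ (Submodule.add_mem _
      (mul_mem_weightGE (J.p_pow_mem 2) hs' (by norm_num)) (hpow 3 _ le_rfl)) (hrm _)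
  · have : toGerm G hG = p ^ 3 * (c' + p * R' 2)
        + r * (d' 0 + p * d' 1 + p ^ 2 * d' 2 + p ^ 3 * d' 3
        + r * (e' 0 + p * e' 1 + p ^ 2 * e' 2 + p ^ 3 * e' 3) + r ^ 2 * R' 3) := by
      rw [HG]; ring
    rw [this]
    exact Submodule.add_mem _ (hpow 3 _ le_rfl) (hrm _)

/-- The derivative of `g` along the total derivative `D₁`. -/
def totDer (G g : (Fin 5 → 𝕜) → 𝕜) (z : Fin 5 → 𝕜) : 𝕜 := fderiv 𝕜 g z (D₁ G z)

lemma analyticAt_D₁ {G : (Fin 5 → 𝕜) → 𝕜} {z : Fin 5 → 𝕜} (hG : AnalyticAt 𝕜 G z) :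
    AnalyticAt 𝕜 (D₁ G) z := by
  refine AnalyticAt.pi fun i => ?_
  fin_cases i
  · exact analyticAt_const
  · exact analyticAt_const
  · exact analyticAt_coord 3 z
  · exact analyticAt_coord 4 z
  · exact hG

lemma analyticAt_fderiv_apply {E F : Type*} [NormedAddCommGroup E] [NormedSpace 𝕜 E]
    [NormedAddCommGroup F] [NormedSpace 𝕜 F] [CompleteSpace F] {g : E → F} {w : E → E} {z : E}
    (hg : AnalyticAt 𝕜 g z) (hw : AnalyticAt 𝕜 w z) :
    AnalyticAt 𝕜 (fun x => fderiv 𝕜 g x (w x)) z :=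
  AnalyticAt.comp₂ (h := fun q : (E →L[𝕜] F) × E => q.1 q.2)
    (ContinuousLinearMap.analyticAt_bilinear (ContinuousLinearMap.id 𝕜 (E →L[𝕜] F)) _)
    hg.fderiv hw

lemma analyticAt_totDer {G g : (Fin 5 → 𝕜) → 𝕜} {z : Fin 5 → 𝕜} (hG : AnalyticAt 𝕜 G z)
    (hg : AnalyticAt 𝕜 g z) : AnalyticAt 𝕜 (totDer G g) z :=
  analyticAt_fderiv_apply hg (analyticAt_D₁ hG)

/-- The total derivative on germs at the origin of the skeleton. -/
def germTot (G : AnalyticGerm 𝕜 5) (f : AnalyticGerm 𝕜 5) : AnalyticGerm 𝕜 5 :=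
  totalD (skelPd 𝕜) (skelPdLast 𝕜) (skelP 𝕜) (skelR 𝕜) G f

lemma germTot_toGerm {G f : (Fin 5 → 𝕜) → 𝕜} (hG : AnalyticAt 𝕜 G 0) (hf : AnalyticAt 𝕜 f 0) :
    germTot (toGerm G hG) (toGerm f hf) = toGerm (totDer G f) (analyticAt_totDer hG hf) := by
  simp only [germTot, totalD, horizD, skelPd, skelPdLast, skelP, skelR, germCoord, germPd_toGerm,
    toGerm_mul, toGerm_add]
  rw [toGerm_eq_iff]
  refine Eventually.of_forall fun z => ?_
  rw [totDer, fderiv_eq_sum_pd, Fin.sum_univ_five]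
  simp only [Pi.add_apply, Pi.mul_apply, D₁]
  change pd 0 f z + z 3 * pd 2 f z + z 4 * pd 3 f z + G z * pd 4 f z
    = 1 * pd 0 f z + 0 * pd 1 f z + z 3 * pd 2 f z + z 4 * pd 3 f z + G z * pd 4 f z
  ring

/-- The characteristic `Y - y₁ X¹ - F X²` of a vector field. -/
def charFn (F : (Fin 5 → 𝕜) → 𝕜) (L : (Fin 3 → 𝕜) → (Fin 3 → 𝕜)) (z : Fin 5 → 𝕜) : 𝕜 :=
  L ![z 0, z 1, z 2] 2 - z 3 * L ![z 0, z 1, z 2] 0 - F z * L ![z 0, z 1, z 2] 1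

/-- The determining equations: the characteristic satisfies the linearized system. -/
def SatisfiesDetermining (F G : (Fin 5 → 𝕜) → 𝕜) (L : (Fin 3 → 𝕜) → (Fin 3 → 𝕜)) : Prop :=
  let q := charFn F L
  ∀ᶠ z in 𝓝 (0 : Fin 5 → 𝕜),
    fderiv 𝕜 q z (D₂ F G z) = fderiv 𝕜 F z ![0, 0, q z, totDer G q z, totDer G (totDer G q) z] ∧
    totDer G (totDer G (totDer G q)) z
      = fderiv 𝕜 G z ![0, 0, q z, totDer G q z, totDer G (totDer G q) z]

lemma analyticAt_component {L : (Fin 3 → 𝕜) → (Fin 3 → 𝕜)} (hL : AnalyticAt 𝕜 L 0) (i : Fin 3) :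
    AnalyticAt 𝕜 (fun p => L p i) 0 :=
  (ContinuousLinearMap.proj (R := 𝕜) (φ := fun _ : Fin 3 => 𝕜) i).analyticAt _ |>.comp hL

lemma analyticAt_charFn {F : (Fin 5 → 𝕜) → 𝕜} {L : (Fin 3 → 𝕜) → (Fin 3 → 𝕜)}
    (hF : AnalyticAt 𝕜 F 0) (hL : AnalyticAt 𝕜 L 0) : AnalyticAt 𝕜 (charFn F L) 0 := by
  have h3 : 3 ≤ 5 := by norm_num
  have hπ : ∀ i, AnalyticAt 𝕜 (fun z : Fin 5 → 𝕜 => L (projInit 𝕜 h3 z) i) 0 := fun i =>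
    analyticAt_comp_projInit h3 (analyticAt_component hL i)
  have := ((hπ 2).sub ((analyticAt_coord 3 0).mul (hπ 0))).sub (hF.mul (hπ 1))
  refine this.congr (Eventually.of_forall fun z => ?_)
  simp only [projInit_three, charFn]
  rfl

/-- The germs at the origin of the skeleton of the components of a vector field. -/
def fieldGerm (L : (Fin 3 → 𝕜) → (Fin 3 → 𝕜)) (hL : AnalyticAt 𝕜 L 0) (i : Fin 3) :
    AnalyticGerm 𝕜 5 :=
  pullGerm (by norm_num : 3 ≤ 5) (fun p => L p i) (analyticAt_component hL i)

/-- The triples of germs, independent of `y₁` and `y₁₁`, that satisfy the determining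
equations. -/
def determiningSpace (F G : AnalyticGerm 𝕜 5) : Submodule 𝕜 (Fin 3 → AnalyticGerm 𝕜 5) where
  carrier := {w | (∀ i, skelPd 𝕜 3 (w i) = 0 ∧ skelPdLast 𝕜 (w i) = 0) ∧
    Determining (skelPd 𝕜) (skelPdLast 𝕜) (skelP 𝕜) (skelR 𝕜) F G
      (w 2 - skelP 𝕜 * w 0 - F * w 1)}
  add_mem' {v w} hv hw := by
    refine ⟨fun i => ⟨?_, ?_⟩, ?_⟩
    · rw [Pi.add_apply, map_add, (hv.1 i).1, (hw.1 i).1, add_zero]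
    · rw [Pi.add_apply, map_add, (hv.1 i).2, (hw.1 i).2, add_zero]
    · have : (v + w) 2 - skelP 𝕜 * (v + w) 0 - F * (v + w) 1
          = (v 2 - skelP 𝕜 * v 0 - F * v 1) + (w 2 - skelP 𝕜 * w 0 - F * w 1) := by
        simp only [Pi.add_apply]; ring
      rw [this]
      obtain ⟨v1, v2⟩ := hv.2
      obtain ⟨w1, w2⟩ := hw.2
      constructor
      · simp only [totalD_add, map_add]; linear_combination v1 + w1
      · simp only [totalD_add]; linear_combination v2 + w2
  zero_mem' := by
    refine ⟨fun i => ⟨map_zero _, map_zero _⟩, ?_⟩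
    have h0 : totalD (skelPd 𝕜) (skelPdLast 𝕜) (skelP 𝕜) (skelR 𝕜) G 0 = 0 := by
      simp [totalD, horizD]
    constructor <;> simp [h0]
  smul_mem' c w hw := by
    refine ⟨fun i => ⟨?_, ?_⟩, ?_⟩
    · rw [Pi.smul_apply, Derivation.map_smul, (hw.1 i).1, smul_zero]
    · rw [Pi.smul_apply, Derivation.map_smul, (hw.1 i).2, smul_zero]
    · have : (c • w) 2 - skelP 𝕜 * (c • w) 0 - F * (c • w) 1
          = c • (w 2 - skelP 𝕜 * w 0 - F * w 1) := by
        simp only [Pi.smul_apply, smul_sub, mul_smul_comm]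
      rw [this]
      obtain ⟨w1, w2⟩ := hw.2
      constructor
      · simp only [totalD_smul, Derivation.map_smul, mul_smul_comm, ← smul_add, w1]
      · simp only [totalD_smul, mul_smul_comm, ← smul_add, w2]

variable (𝕜) in
/-- The ten initial coefficients of a triple of germs. -/
def germCoeffs : (Fin 3 → AnalyticGerm 𝕜 5) →ₗ[𝕜] (Fin 10 → 𝕜) :=
  let δ : Fin 4 → AnalyticGerm 𝕜 5 →ₗ[𝕜] AnalyticGerm 𝕜 5 := fun i => (skelPd 𝕜 i).toLinearMap
  let ε : AnalyticGerm 𝕜 5 →ₗ[𝕜] 𝕜 := (skelEv 𝕜).toLinearMap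
  let π : Fin 3 → (Fin 3 → AnalyticGerm 𝕜 5) →ₗ[𝕜] AnalyticGerm 𝕜 5 := fun i => LinearMap.proj i
  LinearMap.pi ![ε ∘ₗ π 0, ε ∘ₗ π 1, ε ∘ₗ π 2, ε ∘ₗ δ 2 ∘ₗ π 0, ε ∘ₗ δ 1 ∘ₗ π 1, ε ∘ₗ δ 0 ∘ₗ π 2,
    ε ∘ₗ δ 2 ∘ₗ π 2, ε ∘ₗ δ 1 ∘ₗ δ 0 ∘ₗ π 1, ε ∘ₗ δ 0 ∘ₗ δ 0 ∘ₗ π 2, ε ∘ₗ δ 2 ∘ₗ δ 2 ∘ₗ π 2]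

lemma germCoeffs_fieldGerm {L : (Fin 3 → 𝕜) → (Fin 3 → 𝕜)} (hL : AnalyticAt 𝕜 L 0) :
    germCoeffs 𝕜 (fieldGerm L hL) = initialCoeffs L := by
  have h3 : 3 ≤ 5 := by norm_num
  have d0 : ∀ {f : (Fin 3 → 𝕜) → 𝕜} (hf : AnalyticAt 𝕜 f 0),
    skelPd 𝕜 0 (pullGerm h3 f hf) = pullGerm h3 (pd 0 f) (analyticAt_pd hf 0) :=
    fun hf => germPd_pullGerm h3 hf 0
  have d1 : ∀ {f : (Fin 3 → 𝕜) → 𝕜} (hf : AnalyticAt 𝕜 f 0),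
    skelPd 𝕜 1 (pullGerm h3 f hf) = pullGerm h3 (pd 1 f) (analyticAt_pd hf 1) :=
    fun hf => germPd_pullGerm h3 hf 1
  have d2 : ∀ {f : (Fin 3 → 𝕜) → 𝕜} (hf : AnalyticAt 𝕜 f 0),
    skelPd 𝕜 2 (pullGerm h3 f hf) = pullGerm h3 (pd 2 f) (analyticAt_pd hf 2) :=
    fun hf => germPd_pullGerm h3 hf 2
  have hc := analyticAt_component hL
  have e1 : ∀ {f : (Fin 3 → 𝕜) → 𝕜} (hf : AnalyticAt 𝕜 f 0), skelEv 𝕜 (pullGerm h3 f hf) = f 0 :=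
    fun hf => skelEv_pullGerm h3 hf
  have hdef : germCoeffs 𝕜 (fieldGerm L hL) = ![skelEv 𝕜 (pullGerm h3 _ (hc 0)),
      skelEv 𝕜 (pullGerm h3 _ (hc 1)), skelEv 𝕜 (pullGerm h3 _ (hc 2)),
      skelEv 𝕜 (skelPd 𝕜 2 (pullGerm h3 _ (hc 0))), skelEv 𝕜 (skelPd 𝕜 1 (pullGerm h3 _ (hc 1))),
      skelEv 𝕜 (skelPd 𝕜 0 (pullGerm h3 _ (hc 2))), skelEv 𝕜 (skelPd 𝕜 2 (pullGerm h3 _ (hc 2))),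
      skelEv 𝕜 (skelPd 𝕜 1 (skelPd 𝕜 0 (pullGerm h3 _ (hc 1)))),
      skelEv 𝕜 (skelPd 𝕜 0 (skelPd 𝕜 0 (pullGerm h3 _ (hc 2)))),
      skelEv 𝕜 (skelPd 𝕜 2 (skelPd 𝕜 2 (pullGerm h3 _ (hc 2))))] := by
    ext k
    fin_cases k <;> rfl
  rw [hdef]
  simp only [d0, d1, d2, e1]
  rfl

/-- An element of the determining space is determined by its ten initial coefficients. -/
lemma eq_zero_of_germCoeffs_eq_zero {F G : (Fin 5 → 𝕜) → 𝕜} (hF : AnalyticAt 𝕜 F 0)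
    (hG : AnalyticAt 𝕜 G 0) (hnorm : IsNormalized F G) {w : Fin 3 → AnalyticGerm 𝕜 5}
    (hw : w ∈ determiningSpace (toGerm F hF) (toGerm G hG)) (h0 : germCoeffs 𝕜 w = 0) : w = 0 := by
  obtain ⟨hF6, heF, hG6⟩ := weight_of_isNormalized hF hG hnorm
  have J := isJetAlgebra_skeleton 𝕜
  have hz : InitialZero (skelPd 𝕜) (skelEv 𝕜) (w 0) (w 1) (w 2) :=
    { ev_X := congrFun h0 0
      ev_Z := congrFun h0 1
      ev_Y := congrFun h0 2
      ev_Xy := congrFun h0 3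
      ev_Z2 := congrFun h0 4
      ev_Y1 := congrFun h0 5
      ev_Yy := congrFun h0 6
      ev_Z12 := by rw [J.comm 0 1]; exact congrFun h0 7
      ev_Y11 := congrFun h0 8
      ev_Yyy := congrFun h0 9 }
  have key := J.mem_weightGE_of_determining hF6 heF hG6 (hw.1 0).1 (hw.1 1).1 (hw.1 2).1
    (hw.1 0).2 (hw.1 1).2 (hw.1 2).2 hz hw.2
  have hall : ∀ i n, w i ∈ weightGE (skelPd 𝕜) (skelEv 𝕜) n := by
    intro i n
    fin_cases i
    -- The shift by 4 makes up for the lag of `X` and `Z` behind `Y`.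
    · exact weightGE_anti (key (n + 4)).2.1 (by omega)
    · exact weightGE_anti (key (n + 4)).2.2 (by omega)
    · exact (key n).1
  ext1 i
  obtain ⟨f, hf, hfw⟩ := exists_toGerm (w i)
  have h1 := (hw.1 i).2
  have h2 := hall i
  rw [hfw] at h1 h2
  rw [hfw]
  exact (toGerm_eq_iff hf analyticAt_const).2 (toGerm_eq_zero_of_weight hf h1 h2)

lemma fieldGerm_mem_determiningSpace {F G : (Fin 5 → 𝕜) → 𝕜} (hF : AnalyticAt 𝕜 F 0)
    (hG : AnalyticAt 𝕜 G 0) {L : (Fin 3 → 𝕜) → (Fin 3 → 𝕜)} (hL : AnalyticAt 𝕜 L 0)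
    (hdet : SatisfiesDetermining F G L) :
    fieldGerm L hL ∈ determiningSpace (toGerm F hF) (toGerm G hG) := by
  have h3 : 3 ≤ 5 := by norm_num
  refine ⟨fun i => ⟨germPd_pullGerm_of_le h3 _ 3 (by decide),
    germPd_pullGerm_of_le h3 _ 4 (by decide)⟩, ?_⟩
  have hq := analyticAt_charFn hF hL
  have hqg : fieldGerm L hL 2 - skelP 𝕜 * fieldGerm L hL 0 - toGerm F hF * fieldGerm L hL 1
      = toGerm (charFn F L) hq := by
    simp only [fieldGerm, pullGerm, skelP, germCoord, toGerm_mul, toGerm_sub]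
    rw [toGerm_eq_iff]
    refine Eventually.of_forall fun z => ?_
    simp only [projInit_three, charFn]
    rfl
  rw [hqg]
  have T : ∀ {f : (Fin 5 → 𝕜) → 𝕜} (hf : AnalyticAt 𝕜 f 0),
      totalD (skelPd 𝕜) (skelPdLast 𝕜) (skelP 𝕜) (skelR 𝕜) (toGerm G hG) (toGerm f hf)
        = toGerm (totDer G f) (analyticAt_totDer hG hf) := fun hf => germTot_toGerm hG hf
  constructor
  · simp only [T]
    simp only [skelPd, skelPdLast, germPd_toGerm, toGerm_mul, toGerm_add]
    rw [toGerm_eq_iff]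
    filter_upwards [hdet] with z hz
    have h1 := hz.1
    rw [fderiv_eq_sum_pd, fderiv_eq_sum_pd, Fin.sum_univ_five, Fin.sum_univ_five] at h1
    have h1' : 0 * pd 0 (charFn F L) z + 1 * pd 1 (charFn F L) z + F z * pd 2 (charFn F L) z
        + H F G z * pd 3 (charFn F L) z + K F G z * pd 4 (charFn F L) z
        = 0 * pd 0 F z + 0 * pd 1 F z + charFn F L z * pd 2 F z
          + totDer G (charFn F L) z * pd 3 F z
          + totDer G (totDer G (charFn F L)) z * pd 4 F z := h1
    change pd 1 (charFn F L) z + F z * pd 2 (charFn F L) z + H F G z * pd 3 (charFn F L) z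
        + K F G z * pd 4 (charFn F L) z
      = pd 2 F z * charFn F L z + pd 3 F z * totDer G (charFn F L) z
        + pd 4 F z * totDer G (totDer G (charFn F L)) z
    linear_combination h1'
  · simp only [T]
    simp only [skelPd, skelPdLast, germPd_toGerm, toGerm_mul, toGerm_add]
    rw [toGerm_eq_iff]
    filter_upwards [hdet] with z hz
    have h1 := hz.2
    rw [fderiv_eq_sum_pd, Fin.sum_univ_five] at h1
    have h1' : totDer G (totDer G (totDer G (charFn F L))) z
        = 0 * pd 0 G z + 0 * pd 1 G z + charFn F L z * pd 2 G z
          + totDer G (charFn F L) z * pd 3 G z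
          + totDer G (totDer G (charFn F L)) z * pd 4 G z := h1
    change totDer G (totDer G (totDer G (charFn F L))) z
      = pd 2 G z * charFn F L z + pd 3 G z * totDer G (charFn F L) z
        + pd 4 G z * totDer G (totDer G (charFn F L)) z
    linear_combination h1'

/-- The inclusion of `(x¹, x², y)`-space in the skeleton. -/
def zeroSection (p : Fin 3 → 𝕜) : Fin 5 → 𝕜 := ![p 0, p 1, p 2, 0, 0]

lemma projInit_zeroSection (p : Fin 3 → 𝕜) :
    projInit 𝕜 (by norm_num : 3 ≤ 5) (zeroSection p) = p := by
  rw [projInit_three]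
  ext i; fin_cases i <;> rfl

lemma tendsto_zeroSection : Tendsto (zeroSection : (Fin 3 → 𝕜) → _) (𝓝 0) (𝓝 0) := by
  have hc : Continuous (zeroSection : (Fin 3 → 𝕜) → _) := by
    refine continuous_pi fun i => ?_
    fin_cases i
    · exact continuous_apply 0
    · exact continuous_apply 1
    · exact continuous_apply 2
    · exact continuous_const
    · exact continuous_const
  have h0 : zeroSection (0 : Fin 3 → 𝕜) = 0 := by
    ext i; fin_cases i <;> rfl
  simpa [h0] using hc.tendsto 0

/-- A field is recovered from its pullback to the skeleton by restriction to y₁ = y₁₁ = 0. -/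
lemma eventuallyEq_of_fieldGerm_eq {L L' : (Fin 3 → 𝕜) → (Fin 3 → 𝕜)} (hL : AnalyticAt 𝕜 L 0)
    (hL' : AnalyticAt 𝕜 L' 0) (h : fieldGerm L hL = fieldGerm L' hL') : L =ᶠ[𝓝 0] L' := by
  have hi : ∀ i, ∀ᶠ p in 𝓝 (0 : Fin 3 → 𝕜), L p i = L' p i := fun i => by
    have := (toGerm_eq_iff _ _).1 (congrFun h i)
    filter_upwards [tendsto_zeroSection.eventually this] with p hp
    simpa only [projInit_zeroSection] using hp
  filter_upwards [eventually_all.2 hi] with p hp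
  exact funext hp

variable (𝕜) in
/-- The vector field germ with given components. -/
def fieldOfGerm :
    (Fin 3 → AnalyticGerm 𝕜 5) →ₗ[𝕜] Germ (𝓝 (0 : Fin 3 → 𝕜)) (Fin 3 → 𝕜) :=
  ∑ i : Fin 3, (germLift (n := 5)
    { toFun := fun f => ((fun p => Pi.single i (f.1 (zeroSection p)) :
        (Fin 3 → 𝕜) → (Fin 3 → 𝕜)) : Germ (𝓝 (0 : Fin 3 → 𝕜)) (Fin 3 → 𝕜))
      map_add' := fun f g => by
        rw [← Germ.coe_add]
        congr 1
        ext1 p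
        exact Pi.single_add i _ _
      map_smul' := fun c f => by
        rw [RingHom.id_apply, ← Germ.coe_smul]
        congr 1
        ext1 p
        exact Pi.single_smul i c _ }
    (fun f hf => by
      refine Germ.coe_eq.2 ?_
      filter_upwards [tendsto_zeroSection.eventually hf] with p hp
      rw [hp]
      simp)) ∘ₗ LinearMap.proj i

lemma fieldOfGerm_fieldGerm {L : (Fin 3 → 𝕜) → (Fin 3 → 𝕜)} (hL : AnalyticAt 𝕜 L 0) :
    fieldOfGerm 𝕜 (fieldGerm L hL) = (L : Germ (𝓝 (0 : Fin 3 → 𝕜)) (Fin 3 → 𝕜)) := by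
  have h3 : 3 ≤ 5 := by norm_num
  have : fieldOfGerm 𝕜 (fieldGerm L hL) = ∑ i : Fin 3,
      ((fun p => Pi.single i (L (projInit 𝕜 h3 (zeroSection p)) i) :
        (Fin 3 → 𝕜) → (Fin 3 → 𝕜)) : Germ (𝓝 (0 : Fin 3 → 𝕜)) (Fin 3 → 𝕜)) := by
    rw [fieldOfGerm, LinearMap.sum_apply]
    rfl
  rw [this, Fin.sum_univ_three, ← Germ.coe_add, ← Germ.coe_add]
  congr 1
  ext p j
  simp only [projInit_zeroSection, Pi.add_apply]
  fin_cases j <;> simp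

/-- If every infinitesimal symmetry satisfies the determining equations, then infinitesimal
symmetries are determined by their ten initial coefficients. -/
theorem uniqueness_and_rank_le {F G : (Fin 5 → 𝕜) → 𝕜} (hF : AnalyticAt 𝕜 F 0)
    (hG : AnalyticAt 𝕜 G 0) (hnorm : IsNormalized F G)
    (hdet : ∀ L, IsInfinitesimalSymmetry F G L → SatisfiesDetermining F G L) :
    (∀ L L' : (Fin 3 → 𝕜) → (Fin 3 → 𝕜),
      IsInfinitesimalSymmetry F G L → IsInfinitesimalSymmetry F G L' →
      initialCoeffs L = initialCoeffs L' → L =ᶠ[𝓝 (0 : Fin 3 → 𝕜)] L') ∧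
    Module.rank 𝕜 (SYM F G) ≤ 10 := by
  set W := determiningSpace (toGerm F hF) (toGerm G hG) with hW
  have hmem : ∀ L (hL : IsInfinitesimalSymmetry F G L), fieldGerm L hL.1 ∈ W := fun L hL =>
    fieldGerm_mem_determiningSpace hF hG hL.1 (hdet L hL)
  refine ⟨fun L L' hL hL' h => eventuallyEq_of_fieldGerm_eq hL.1 hL'.1 ?_, ?_⟩
  · refine sub_eq_zero.1 (eq_zero_of_germCoeffs_eq_zero hF hG hnorm
      (W.sub_mem (hmem L hL) (hmem L' hL')) ?_)
    rw [map_sub, germCoeffs_fieldGerm, germCoeffs_fieldGerm, h, sub_self]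
  -- Sums of symmetries need not be known to be symmetries: `W` is a linear space, so its image
  -- contains the span.
  · have hle : SYM F G ≤ W.map (fieldOfGerm 𝕜) := by
      refine Submodule.span_le.2 ?_
      rintro g ⟨L, hL, rfl⟩
      exact ⟨fieldGerm L hL.1, hmem L hL, fieldOfGerm_fieldGerm hL.1⟩
    have hinj : Function.Injective ((germCoeffs 𝕜).comp W.subtype) := by
      rw [← LinearMap.ker_eq_bot, LinearMap.ker_eq_bot']
      intro w hw
      exact Subtype.ext (eq_zero_of_germCoeffs_eq_zero hF hG hnorm w.2 hw)
    have hWr : Module.rank 𝕜 W ≤ 10 := by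
      have := LinearMap.rank_le_of_injective _ hinj
      simpa using this
    have h1 := Submodule.rank_mono hle
    have h2 := lift_rank_map_le (fieldOfGerm 𝕜) W
    simp only [Cardinal.lift_id] at h2
    exact h1.trans (h2.trans hWr)

end Skeleton

/-! ### The Frobenius theorem for total differential equations. -/

section TotalDifferentialEquation

variable {𝕜 : Type*} [RCLike 𝕜] {E P : Type*} [NormedAddCommGroup E] [NormedSpace 𝕜 E]
  [NormedSpace ℝ E] [IsScalarTower ℝ 𝕜 E] [NormedAddCommGroup P] [NormedSpace 𝕜 P]

omit [IsScalarTower ℝ 𝕜 E] in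
/-- Uniform first and second order bounds near a point for a `C²` map. -/
lemma exists_taylor_bounds {F : Type*} [NormedAddCommGroup F] [NormedSpace 𝕜 F]
    {A : E → F} {z₁ : E} (hA : ContDiffAt 𝕜 2 A z₁) :
    ∃ ρ > (0 : ℝ), ∃ C : NNReal, 0 < C ∧
      (∀ z ∈ Metric.ball z₁ ρ, DifferentiableAt 𝕜 A z) ∧
      (∀ z ∈ Metric.ball z₁ ρ, ‖A z‖ ≤ C) ∧
      (∀ z ∈ Metric.ball z₁ ρ, ‖fderiv 𝕜 A z‖ ≤ C) ∧
      LipschitzOnWith C A (Metric.ball z₁ ρ) ∧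
      ∀ z ∈ Metric.ball z₁ ρ, ∀ w ∈ Metric.ball z₁ ρ,
        ‖A w - A z - fderiv 𝕜 A z (w - z)‖ ≤ C * ‖w - z‖ ^ 2 := by
  have hA1 : ContDiffAt 𝕜 1 A z₁ := hA.of_le (by norm_num)
  have hdA : ContDiffAt 𝕜 1 (fderiv 𝕜 A) z₁ := hA.fderiv_right (by norm_num)
  obtain ⟨K₁, s₁, hs₁, hK₁⟩ := hA1.exists_lipschitzOnWith
  obtain ⟨K₂, s₂, hs₂, hK₂⟩ := hdA.exists_lipschitzOnWith
  have e₁ : ∀ᶠ z in 𝓝 z₁, ‖A z‖ < ‖A z₁‖ + 1 :=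
    hA.continuousAt.norm.eventually_lt_const (lt_add_one _)
  have e₂ : ∀ᶠ z in 𝓝 z₁, ‖fderiv 𝕜 A z‖ < ‖fderiv 𝕜 A z₁‖ + 1 :=
    hdA.continuousAt.norm.eventually_lt_const (lt_add_one _)
  have e₃ : ∀ᶠ z in 𝓝 z₁, DifferentiableAt 𝕜 A z := by
    filter_upwards [hA1.eventually (by simp)] with z hz
    exact hz.differentiableAt (by norm_num)
  obtain ⟨ρ, hρ, hball⟩ := Metric.eventually_nhds_iff_ball.1
    (e₁.and (e₂.and (e₃.and ((eventually_mem_set.2 hs₁).and (eventually_mem_set.2 hs₂)))))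
  refine ⟨ρ, hρ, K₁ + K₂ + ‖A z₁‖₊ + ‖fderiv 𝕜 A z₁‖₊ + 1, by positivity,
    fun z hz => (hball z hz).2.2.1, fun z hz => ?_, fun z hz => ?_, ?_, fun z hz w hw => ?_⟩
  · have := (hball z hz).1
    push_cast
    have h1 := K₁.2; have h2 := K₂.2; have h3 := norm_nonneg (fderiv 𝕜 A z₁)
    simp only [NNReal.val_eq_coe] at h1 h2
    linarith
  · have := (hball z hz).2.1
    push_cast
    have h1 := K₁.2; have h2 := K₂.2; have h3 := norm_nonneg (A z₁)
    simp only [NNReal.val_eq_coe] at h1 h2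
    linarith
  · refine (hK₁.mono fun z hz => (hball z hz).2.2.2.1).weaken ?_
    rw [add_assoc, add_assoc, add_assoc]
    exact le_self_add
  · have hseg : segment ℝ z w ⊆ Metric.ball z₁ ρ := (convex_ball z₁ ρ).segment_subset hz hw
    have key := (convex_segment z w).norm_image_sub_le_of_norm_fderiv_le' (𝕜 := 𝕜) (f := A)
      (φ := fderiv 𝕜 A z) (C := K₂ * ‖w - z‖) (fun x hx => (hball x (hseg hx)).2.2.1)
      (fun x hx => by
        refine (hK₂.norm_sub_le (hball x (hseg hx)).2.2.2.2 (hball z hz).2.2.2.2).trans ?_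
        gcongr
        exact norm_sub_le_of_mem_segment hx)
      (left_mem_segment ℝ z w) (right_mem_segment ℝ z w)
    refine key.trans ?_
    rw [mul_assoc, ← sq]
    gcongr
    have h1 := K₁.2; have h3 := norm_nonneg (fderiv 𝕜 A z₁); have h2 := norm_nonneg (A z₁)
    simp only [NNReal.val_eq_coe] at h1
    linarith

-- Picard–Lindelöf on the unit interval: with speed at most the radius, the curve cannot leave the
-- ball. Working with the fixed point of the Picard operator keeps this confinement to the ball.
omit [NormedSpace 𝕜 E] [IsScalarTower ℝ 𝕜 E] in
lemma exists_integralCurve_mem_closedBall [CompleteSpace E] {v : E → E} {z₀ : E} {ρ K : NNReal}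
    (hb : ∀ z ∈ Metric.closedBall z₀ ρ, ‖v z‖ ≤ ρ)
    (hl : LipschitzOnWith K v (Metric.closedBall z₀ ρ)) :
    ∃ W : ℝ → E, W 0 = z₀ ∧ (∀ t, W t ∈ Metric.closedBall z₀ ρ) ∧
      ∀ t ∈ Set.Icc (0 : ℝ) 1, HasDerivWithinAt W (v (W t)) (Set.Icc 0 1) t := by
  have h01 : (0 : ℝ) ∈ Set.Icc (0 : ℝ) 1 := by simp
  have hf : IsPicardLindelof (fun _ => v) (tmin := 0) (tmax := 1) ⟨0, h01⟩ z₀ ρ 0 ρ K :=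
    IsPicardLindelof.of_time_independent hb hl (by simp)
  obtain ⟨α, hα⟩ := ODE.FunSpace.exists_isFixedPt_next hf (Metric.mem_closedBall_self le_rfl)
  refine ⟨α.compProj, ?_, fun t => α.compProj_mem_closedBall hf.mul_max_le, fun t ht => ?_⟩
  · have := ODE.FunSpace.compProj_val (α := α) (t := ⟨0, h01⟩)
    rw [this, ← hα, ODE.FunSpace.next_apply₀]
  · apply ODE.hasDerivWithinAt_picard_Icc h01 hf.continuousOn_uncurry
      α.continuous_compProj.continuousOn (fun _ ht' ↦ α.compProj_mem_closedBall hf.mul_max_le)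
      z₀ ht |>.congr_of_mem _ ht
    intro t' ht'
    nth_rw 1 [← hα]
    rw [ODE.FunSpace.compProj_of_mem ht', ODE.FunSpace.next_apply]

/-- **Frobenius theorem** for total differential equations `DU = A(U)`: local existence under the
integrability condition. -/
theorem exists_solution_total_differential [CompleteSpace E] {A : E → P →L[𝕜] E} {z₁ : E}
    (hA : ContDiffAt 𝕜 2 A z₁)
    (hsymm : ∀ᶠ z in 𝓝 z₁, ∀ k l, fderiv 𝕜 A z (A z k) l = fderiv 𝕜 A z (A z l) k) :
    ∀ᶠ z₀ in 𝓝 z₁, ∃ U : P → E, U 0 = z₀ ∧ ∀ᶠ h in 𝓝 0, HasFDerivAt U (A (U h)) h := by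
  obtain ⟨ρ', hρ', C, hC, hdiff, hbd, hbd', hlip, htay⟩ := exists_taylor_bounds hA
  obtain ⟨ρ'', hρ'', hsy⟩ := Metric.eventually_nhds_iff_ball.1 hsymm
  set R : ℝ := min ρ' ρ'' with hR
  have hRpos : 0 < R := lt_min hρ' hρ''
  have hR1 : Metric.ball z₁ R ⊆ Metric.ball z₁ ρ' := Metric.ball_subset_ball (min_le_left _ _)
  have hR2 : Metric.ball z₁ R ⊆ Metric.ball z₁ ρ'' := Metric.ball_subset_ball (min_le_right _ _)
  -- `z₀` is within ρ of `z₁`, and all curves below, exact or approximate, stay within 2ρ of `z₀`;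
  -- hence they stay in the ball of radius R = 4ρ.
  set ρ : NNReal := ⟨R / 4, by positivity⟩ with hρ
  have hρR : (ρ : ℝ) = R / 4 := rfl
  have hρpos : (0 : ℝ) < ρ := by rw [hρR]; positivity
  have hCpos : (0 : ℝ) < C := hC
  filter_upwards [Metric.ball_mem_nhds z₁ hρpos] with z₀ hz₀
  have hsub : Metric.closedBall z₀ (2 * ρ) ⊆ Metric.ball z₁ R := by
    intro z hz
    rw [Metric.mem_closedBall] at hz
    rw [Metric.mem_ball] at hz₀ ⊢
    linarith [dist_triangle z z₀ z₁]
  have hsub' : Metric.closedBall z₀ ρ ⊆ Metric.ball z₁ R :=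
    (Metric.closedBall_subset_closedBall (by linarith)).trans hsub
  -- For ‖h‖ ≤ δ the field z ↦ A z h has both speed and Lipschitz constant at most ρ, so its curves
  -- exist up to time 1.
  set δ : ℝ := ρ / C with hδ
  have hδpos : 0 < δ := by positivity
  have hCδ : C * δ = ρ := by rw [hδ]; field_simp
  have hlipv : ∀ (h : P) (K : NNReal), C * ‖h‖ ≤ K →
      LipschitzOnWith K (fun z => A z h) (Metric.ball z₁ R) := fun h K hK => by
    refine LipschitzOnWith.of_dist_le_mul fun x hx y hy => ?_
    have h1 := hlip.dist_le_mul x (hR1 hx) y (hR1 hy)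
    rw [dist_eq_norm] at h1 ⊢
    calc ‖A x h - A y h‖ = ‖(A x - A y) h‖ := by simp
      _ ≤ ‖A x - A y‖ * ‖h‖ := ContinuousLinearMap.le_opNorm _ _
      _ ≤ C * dist x y * ‖h‖ := by gcongr
      _ = C * ‖h‖ * dist x y := by ring
      _ ≤ K * dist x y := by gcongr
  have hex : ∀ h : P, ‖h‖ ≤ δ → ∃ W : ℝ → E, W 0 = z₀ ∧
      (∀ t, W t ∈ Metric.closedBall z₀ ρ) ∧
      ∀ t ∈ Set.Icc (0 : ℝ) 1, HasDerivWithinAt W (A (W t) h) (Set.Icc 0 1) t := fun h hh => by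
    have hm : C * ‖h‖ ≤ ρ := hCδ ▸ mul_le_mul_of_nonneg_left hh hCpos.le
    refine exists_integralCurve_mem_closedBall (v := fun z => A z h) (K := ρ) (fun z hz => ?_)
      ((hlipv h ρ hm).mono hsub')
    exact ((A z).le_opNorm h).trans
      ((mul_le_mul_of_nonneg_right (hbd z (hR1 (hsub' hz))) (norm_nonneg h)).trans hm)
  choose! W hW0 hWm hWd using hex
  -- The solution is built along rays: `W h` integrates the equation in the direction `h`.
  -- Integrability is needed only for the derivative in the other directions.
  refine ⟨fun h => W h 1, ?_, ?_⟩
  · -- the constant curve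
    have h0 : ‖(0 : P)‖ ≤ δ := by rw [norm_zero]; exact hδpos.le
    have hd : ∀ t ∈ Set.Icc (0 : ℝ) 1, HasDerivWithinAt (W 0) 0 (Set.Icc 0 1) t := fun t ht => by
      simpa using hWd 0 h0 t ht
    have := (convex_Icc (0 : ℝ) 1).norm_image_sub_le_of_norm_hasDerivWithin_le (C := 0)
      hd (fun t _ => by simp) (x := 0) (y := 1) (by simp) (by simp)
    rw [zero_mul, norm_le_zero_iff, sub_eq_zero, hW0 0 h0] at this
    exact this
  have hball : ∀ᶠ h in 𝓝 (0 : P), ‖h‖ < δ := by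
    filter_upwards [Metric.ball_mem_nhds (0 : P) hδpos] with h hh
    simpa using hh
  filter_upwards [hball] with h hh
  set c : ℝ := C * C + C * C ^ 2 * δ with hc
  have hcpos : 0 < c := by positivity
  set B : ℝ := c * gronwallBound 0 ρ 1 1 with hB
  have hgron : ∀ ε : ℝ, gronwallBound 0 ρ ε 1 = ε * gronwallBound 0 ρ 1 1 := fun ε => by
    rw [gronwallBound_of_K_ne_0 hρpos.ne', gronwallBound_of_K_ne_0 hρpos.ne']
    ring
  have hest : ∀ᶠ k in 𝓝 (0 : P), ‖W (h + k) 1 - W h 1 - A (W h 1) k‖ ≤ B * ‖k‖ ^ 2 := by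
    have e1 : ∀ᶠ k in 𝓝 (0 : P), ‖h + k‖ < δ := by
      have : ContinuousAt (fun k : P => ‖h + k‖) 0 := by fun_prop
      exact this.eventually_lt_const (by simpa using hh)
    filter_upwards [e1, hball] with k hhk hk
    have hWB : ∀ t, W h t ∈ Metric.ball z₁ R := fun t => hsub' (hWm h hh.le t)
    have hCk : C * ‖k‖ ≤ ρ := hCδ ▸ mul_le_mul_of_nonneg_left hk.le hCpos.le
    have hAk : ∀ t, ‖A (W h t) k‖ ≤ C * ‖k‖ := fun t => ((A _).le_opNorm k).trans
      (mul_le_mul_of_nonneg_right (hbd _ (hR1 (hWB t))) (norm_nonneg k))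
    -- First-order guess for `W (h + k)`. Under the integrability condition t A(W) k solves the
    -- variational equation, so `Z` satisfies the equation for h + k up to O(‖k‖²), and Grönwall's
    -- inequality transfers this error to the solutions.
    let Z : ℝ → E := fun t => W h t + t • A (W h t) k
    have hZm : ∀ t ∈ Set.Icc (0 : ℝ) 1, Z t ∈ Metric.ball z₁ R := fun t ht => by
      apply hsub
      have h1 := hWm h hh.le t
      rw [Metric.mem_closedBall, dist_eq_norm] at h1 ⊢
      have h2 : ‖t • A (W h t) k‖ ≤ ρ := by
        rw [norm_smul, Real.norm_of_nonneg ht.1]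
        calc t * ‖A (W h t) k‖ ≤ 1 * (C * ‖k‖) := by
              gcongr
              · exact ht.2
              · exact hAk t
          _ ≤ ρ := by rw [one_mul]; exact hCk
      calc ‖Z t - z₀‖ = ‖(W h t - z₀) + t • A (W h t) k‖ := by
            congr 1; simp only [Z]; abel
        _ ≤ ‖W h t - z₀‖ + ‖t • A (W h t) k‖ := norm_add_le _ _
        _ ≤ 2 * ρ := by linarith
    let Z' : ℝ → E := fun t =>
      A (W h t) h + (t • fderiv 𝕜 A (W h t) (A (W h t) h) k + (1 : ℝ) • A (W h t) k)
    have hZd : ∀ t ∈ Set.Icc (0 : ℝ) 1, HasDerivWithinAt Z (Z' t) (Set.Icc 0 1) t := fun t ht => by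
      have hd := hWd h hh.le t ht
      have hAd : HasFDerivAt (fun z => A z k)
          (((ContinuousLinearMap.apply 𝕜 E k).comp (fderiv 𝕜 A (W h t))).restrictScalars ℝ)
          (W h t) :=
        HasFDerivAt.restrictScalars ℝ ((ContinuousLinearMap.apply 𝕜 E k).hasFDerivAt.comp (W h t)
          (hdiff _ (hR1 (hWB t))).hasFDerivAt)
      have hd2 := hAd.comp_hasDerivWithinAt t hd
      exact hd.add ((hasDerivWithinAt_id t _).smul hd2)
    have hIci : ∀ {g : ℝ → E} {g' : E} {t : ℝ}, t ∈ Set.Ico (0 : ℝ) 1 →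
        HasDerivWithinAt g g' (Set.Icc 0 1) t → HasDerivWithinAt g g' (Set.Ici t) t :=
      fun {g g' t} ht hg => hg.mono_of_mem_nhdsWithin
        (Filter.mem_of_superset (Icc_mem_nhdsGE ht.2) (Set.Icc_subset_Icc_left ht.1))
    have hIco : Set.Ico (0 : ℝ) 1 ⊆ Set.Icc 0 1 := Set.Ico_subset_Icc_self
    have hCh : C * ‖h + k‖ ≤ ρ := hCδ ▸ mul_le_mul_of_nonneg_left hhk.le hCpos.le
    have key := dist_le_of_approx_trajectories_ODE_of_mem (v := fun _ z => A z (h + k))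
      (s := fun _ => Metric.ball z₁ R) (K := ρ) (f := W (h + k)) (g := Z)
      (f' := fun t => A (W (h + k) t) (h + k)) (g' := Z') (a := 0) (b := 1)
      (εf := 0) (εg := c * ‖k‖ ^ 2) (δ := 0)
      (fun t _ => hlipv (h + k) ρ hCh)
      (fun t ht => (hWd (h + k) hhk.le t ht).continuousWithinAt)
      (fun t ht => hIci ht (hWd (h + k) hhk.le t (hIco ht)))
      (fun t _ => by simp)
      (fun t _ => hsub' (hWm (h + k) hhk.le t))
      (fun t ht => (hZd t ht).continuousWithinAt)
      (fun t ht => hIci ht (hZd t (hIco ht)))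
      (fun t ht => by
        have hw := hWB t
        have hz := hZm t (hIco ht)
        have ht0 : 0 ≤ t := ht.1
        have ht1 : t ≤ 1 := ht.2.le
        set w := W h t with hwdef
        have hsy' := hsy w (hR2 hw) h k
        have hT := htay w (hR1 hw) (Z t) (hR1 hz)
        have hZw : Z t - w = t • A w k := by simp [Z, hwdef]
        rw [hZw] at hT
        have hlin : fderiv 𝕜 A w (t • A w k) = ((t : ℝ) : 𝕜) • fderiv 𝕜 A w (A w k) := by
          rw [RCLike.real_smul_eq_coe_smul (K := 𝕜) t (A w k), map_smul]
        set T := A (Z t) - A w - fderiv 𝕜 A w (t • A w k) with hTdef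
        have hAZ : A (Z t) = T + A w + fderiv 𝕜 A w (t • A w k) := by rw [hTdef]; abel
        -- The terms of first order in `k` cancel by the symmetry `hsy'`; the rest is quadratic in
        -- `k`.
        have e : Z' t - A (Z t) (h + k)
            = -(((t : ℝ) : 𝕜) • fderiv 𝕜 A w (A w k) k) - T (h + k) := by
          rw [hAZ, hlin]
          simp only [Z', ← hwdef, add_apply, smul_apply,
            map_add, one_smul, hsy', RCLike.real_smul_eq_coe_smul (K := 𝕜),
            RCLike.ofReal_one]
          abel
        rw [dist_eq_norm, e]
        have n1 : ‖((t : ℝ) : 𝕜) • fderiv 𝕜 A w (A w k) k‖ ≤ C * C * ‖k‖ ^ 2 := by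
          rw [norm_smul, RCLike.norm_ofReal, abs_of_nonneg ht0]
          calc t * ‖fderiv 𝕜 A w (A w k) k‖ ≤ 1 * (C * (C * ‖k‖) * ‖k‖) := by
                gcongr
                refine (ContinuousLinearMap.le_opNorm _ _).trans ?_
                gcongr
                refine (ContinuousLinearMap.le_opNorm _ _).trans ?_
                gcongr
                · exact hbd' w (hR1 hw)
                · exact hAk t
            _ = C * C * ‖k‖ ^ 2 := by ring
        have n0 : ‖t • A w k‖ ≤ C * ‖k‖ := by
          rw [norm_smul, Real.norm_of_nonneg ht0]
          calc t * ‖A w k‖ ≤ 1 * (C * ‖k‖) := by gcongr; exact hAk t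
            _ = C * ‖k‖ := one_mul _
        have n2 : ‖T (h + k)‖ ≤ C * C ^ 2 * δ * ‖k‖ ^ 2 := by
          calc ‖T (h + k)‖ ≤ ‖T‖ * ‖h + k‖ := T.le_opNorm _
            _ ≤ (C * (C * ‖k‖) ^ 2) * δ := by
                gcongr
                exact hT.trans (by gcongr)
            _ = C * C ^ 2 * δ * ‖k‖ ^ 2 := by ring
        calc ‖-(((t : ℝ) : 𝕜) • fderiv 𝕜 A w (A w k) k) - T (h + k)‖
            ≤ ‖((t : ℝ) : 𝕜) • fderiv 𝕜 A w (A w k) k‖ + ‖T (h + k)‖ := by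
              refine (norm_sub_le _ _).trans ?_
              rw [norm_neg]
          _ ≤ C * C * ‖k‖ ^ 2 + C * C ^ 2 * δ * ‖k‖ ^ 2 := add_le_add n1 n2
          _ = c * ‖k‖ ^ 2 := by rw [hc]; ring)
      (fun t ht => hZm t (hIco ht))
      (by simp [Z, hW0 h hh.le, hW0 (h + k) hhk.le]) 1 (by simp)
    rw [zero_add, sub_zero, hgron, dist_eq_norm] at key
    have e2 : W (h + k) 1 - Z 1 = W (h + k) 1 - W h 1 - A (W h 1) k := by
      simp only [Z, one_smul]; abel
    rw [e2] at key
    calc _ ≤ _ := key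
      _ = B * ‖k‖ ^ 2 := by rw [hB]; ring
  rw [hasFDerivAt_iff_isLittleO_nhds_zero]
  refine (Asymptotics.IsBigO.of_bound B ?_).trans_isLittleO
    (Asymptotics.isLittleO_norm_pow_id one_lt_two)
  filter_upwards [hest] with k hk
  rw [Real.norm_of_nonneg (by positivity)]
  exact hk

omit [NormedSpace ℝ E] [IsScalarTower ℝ 𝕜 E] in
/-- Solutions of `DU = A(U)` are as smooth as `A` allows. -/
lemma contDiffAt_of_total_differential {A : E → P →L[𝕜] E} {U : P → E} {x : P}
    (hA : ∀ᶠ h in 𝓝 x, ContDiffAt 𝕜 (⊤ : ℕ∞) A (U h))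
    (hU : ∀ᶠ h in 𝓝 x, HasFDerivAt U (A (U h)) h) (n : ℕ) : ∀ᶠ h in 𝓝 x, ContDiffAt 𝕜 n U h := by
  induction n with
  | zero =>
    filter_upwards [hU.eventually_nhds] with h hh
    have : ∀ᶠ y in 𝓝 h, ContinuousAt U y := hh.mono fun y hy => hy.continuousAt
    exact contDiffAt_zero.2 ⟨_, this, fun y hy => ContinuousAt.continuousWithinAt hy⟩
  | succ n ih =>
    filter_upwards [ih, hA, hU.eventually_nhds] with h hn hAh hh
    refine contDiffAt_succ_iff_hasFDerivAt.2 ⟨fun y => A (U y), ⟨_, hh, fun y hy => hy⟩, ?_⟩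
    exact (hAh.of_le (by exact_mod_cast le_top)).comp h hn

end TotalDifferentialEquation

/-! ### Solutions with prescribed jets. -/

section Solutions

variable {𝕜 : Type*} [RCLike 𝕜]

lemma analyticAt_D₂ {F G : (Fin 5 → 𝕜) → 𝕜} {z : Fin 5 → 𝕜} (hF : AnalyticAt 𝕜 F z)
    (hG : AnalyticAt 𝕜 G z) : AnalyticAt 𝕜 (D₂ F G) z := by
  refine AnalyticAt.pi fun i => ?_
  fin_cases i
  · exact analyticAt_const
  · exact analyticAt_const
  · exact hF
  · exact analyticAt_totDer hG hF
  · exact analyticAt_totDer hG (analyticAt_totDer hG hF)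

/-- The differential of the jet of a solution, as a function of the jet. -/
def jetForm (F G : (Fin 5 → 𝕜) → 𝕜) (z : Fin 5 → 𝕜) : (Fin 2 → 𝕜) →L[𝕜] (Fin 5 → 𝕜) :=
  (ContinuousLinearMap.proj (R := 𝕜) (φ := fun _ : Fin 2 => 𝕜) 0).smulRight (D₁ G z)
    + (ContinuousLinearMap.proj (R := 𝕜) (φ := fun _ : Fin 2 => 𝕜) 1).smulRight (D₂ F G z)

lemma jetForm_apply (F G : (Fin 5 → 𝕜) → 𝕜) (z : Fin 5 → 𝕜) (h : Fin 2 → 𝕜) :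
    jetForm F G z h = h 0 • D₁ G z + h 1 • D₂ F G z := rfl

lemma jetForm_single_zero (F G : (Fin 5 → 𝕜) → 𝕜) (z : Fin 5 → 𝕜) :
    jetForm F G z (Pi.single 0 1) = D₁ G z := by
  simp [jetForm_apply]

lemma jetForm_single_one (F G : (Fin 5 → 𝕜) → 𝕜) (z : Fin 5 → 𝕜) :
    jetForm F G z (Pi.single 1 1) = D₂ F G z := by
  simp [jetForm_apply]

lemma analyticAt_jetForm {F G : (Fin 5 → 𝕜) → 𝕜} {z : Fin 5 → 𝕜} (hF : AnalyticAt 𝕜 F z)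
    (hG : AnalyticAt 𝕜 G z) : AnalyticAt 𝕜 (jetForm F G) z := by
  have key : ∀ i : Fin 2, AnalyticAt 𝕜 (fun v : Fin 5 → 𝕜 =>
      (ContinuousLinearMap.proj (R := 𝕜) (φ := fun _ : Fin 2 => 𝕜) i).smulRight v) =
      AnalyticAt 𝕜 (ContinuousLinearMap.smulRightL 𝕜 (Fin 2 → 𝕜) (Fin 5 → 𝕜)
        (ContinuousLinearMap.proj (R := 𝕜) (φ := fun _ : Fin 2 => 𝕜) i)) := fun i => rfl
  have key' : ∀ (i : Fin 2) v, AnalyticAt 𝕜 (fun v : Fin 5 → 𝕜 =>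
      (ContinuousLinearMap.proj (R := 𝕜) (φ := fun _ : Fin 2 => 𝕜) i).smulRight v) v :=
    fun i v => by rw [key]; exact ContinuousLinearMap.analyticAt _ _
  exact ((key' 0 _).comp (analyticAt_D₁ hG)).add ((key' 1 _).comp (analyticAt_D₂ hF hG))

lemma fderiv_jetForm_apply {F G : (Fin 5 → 𝕜) → 𝕜} {z : Fin 5 → 𝕜} (hF : AnalyticAt 𝕜 F z)
    (hG : AnalyticAt 𝕜 G z) (v : Fin 5 → 𝕜) (h : Fin 2 → 𝕜) :
    fderiv 𝕜 (jetForm F G) z v h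
      = h 0 • fderiv 𝕜 (D₁ G) z v + h 1 • fderiv 𝕜 (D₂ F G) z v := by
  have h1 := (analyticAt_jetForm hF hG).differentiableAt
  have h2 : fderiv 𝕜 (fun y => jetForm F G y h) z v = fderiv 𝕜 (jetForm F G) z v h := by
    rw [fderiv_clm_apply h1 (differentiableAt_const _)]
    simp
  have h3 : (fun y => jetForm F G y h) = (h 0 • D₁ G + h 1 • D₂ F G) := rfl
  have d1 := (analyticAt_D₁ hG).differentiableAt
  have d2 := (analyticAt_D₂ hF hG).differentiableAt
  rw [← h2, h3, fderiv_add (d1.const_smul _) (d2.const_smul _), fderiv_const_smul d1,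
    fderiv_const_smul d2]
  rfl

lemma fderiv_pi_apply_coord {n m : ℕ} {W : (Fin n → 𝕜) → (Fin m → 𝕜)} {z : Fin n → 𝕜}
    (hW : DifferentiableAt 𝕜 W z) (v : Fin n → 𝕜) (i : Fin m) :
    fderiv 𝕜 W z v i = fderiv 𝕜 (fun y => W y i) z v := by
  rw [fderiv_apply hW i]
  rfl

/-- For a completely integrable system the total derivatives commute. -/
lemma IsCompletelyIntegrable.commute {F G : (Fin 5 → 𝕜) → 𝕜} (hF : AnalyticAt 𝕜 F 0)
    (hG : AnalyticAt 𝕜 G 0) (hint : IsCompletelyIntegrable F G) :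
    ∀ᶠ z in 𝓝 0, fderiv 𝕜 (D₂ F G) z (D₁ G z) = fderiv 𝕜 (D₁ G) z (D₂ F G z) := by
  filter_upwards [hint, hF.eventually_analyticAt, hG.eventually_analyticAt] with z hz hFz hGz
  rw [Submodule.mem_span_pair] at hz
  obtain ⟨a, b, hab⟩ := hz
  have d1 := (analyticAt_D₁ hGz).differentiableAt
  have d2 := (analyticAt_D₂ hFz hGz).differentiableAt
  have hb : VectorField.lieBracket 𝕜 (D₁ G) (D₂ F G) z
      = fderiv 𝕜 (D₂ F G) z (D₁ G z) - fderiv 𝕜 (D₁ G) z (D₂ F G z) := rfl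
  rw [hb] at hab
  -- The x¹- and x²-components of D₁ and D₂ are constant, so those of the bracket vanish; this
  -- forces both coefficients of the linear combination to be 0.
  have c1 : ∀ (i : Fin 5), i = 0 ∨ i = 1 → ∀ v, fderiv 𝕜 (D₁ G) z v i = 0 := by
    rintro i (rfl | rfl) v <;> rw [fderiv_pi_apply_coord d1]
    · simp [D₁]
    · simp [D₁]
  have c2 : ∀ (i : Fin 5), i = 0 ∨ i = 1 → ∀ v, fderiv 𝕜 (D₂ F G) z v i = 0 := by
    rintro i (rfl | rfl) v <;> rw [fderiv_pi_apply_coord d2]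
    · simp [D₂]
    · simp [D₂]
  have h0 := congrFun hab 0
  have h1 := congrFun hab 1
  rw [Pi.sub_apply, c1 0 (.inl rfl), c2 0 (.inl rfl)] at h0
  rw [Pi.sub_apply, c1 1 (.inr rfl), c2 1 (.inr rfl)] at h1
  have ha : a = 0 := by simpa [D₁, D₂] using h0
  have hb' : b = 0 := by simpa [D₁, D₂] using h1
  rw [ha, hb', zero_smul, zero_smul, add_zero] at hab
  exact sub_eq_zero.1 hab.symm

/-- Along a map whose differential is the `jetForm`, the total derivatives become partial
derivatives. -/
lemma pd_comp_of_hasFDerivAt_jetForm {F G : (Fin 5 → 𝕜) → 𝕜} {V : (Fin 2 → 𝕜) → (Fin 5 → 𝕜)}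
    {ξ : Fin 2 → 𝕜} (hV : HasFDerivAt V (jetForm F G (V ξ)) ξ) {g : (Fin 5 → 𝕜) → 𝕜}
    (hg : DifferentiableAt 𝕜 g (V ξ)) :
    pd 0 (fun η => g (V η)) ξ = totDer G g (V ξ) ∧
      pd 1 (fun η => g (V η)) ξ = fderiv 𝕜 g (V ξ) (D₂ F G (V ξ)) := by
  have h := (hg.hasFDerivAt.comp ξ hV).fderiv
  rw [Function.comp_def] at h
  rw [pd, pd, h, ContinuousLinearMap.comp_apply, ContinuousLinearMap.comp_apply,
    jetForm_single_zero, jetForm_single_one]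
  exact ⟨rfl, rfl⟩

/-- A local integral of `jetForm` is the jet of a solution. -/
lemma eventuallyEq_jet_of_hasFDerivAt_jetForm {F G : (Fin 5 → 𝕜) → 𝕜}
    {V : (Fin 2 → 𝕜) → (Fin 5 → 𝕜)} {x : Fin 2 → 𝕜}
    (hV : ∀ᶠ ξ in 𝓝 x, HasFDerivAt V (jetForm F G (V ξ)) ξ) (h0 : V x 0 = x 0)
    (h1 : V x 1 = x 1) : V =ᶠ[𝓝 x] jet (fun ξ => V ξ 2) := by
  have hcoord : ∀ i : Fin 5, ∀ᶠ ξ in 𝓝 x, pd 0 (fun η => V η i) ξ = D₁ G (V ξ) i := fun i =>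
    hV.mono fun ξ hξ => by
      rw [pd, ← fderiv_pi_apply_coord hξ.differentiableAt, hξ.fderiv, jetForm_single_zero]
  have hbase : ∀ (i : Fin 5) (j : Fin 2), (∀ z h, jetForm F G z h i = h j) → V x i = x j →
      ∀ᶠ ξ in 𝓝 x, V ξ i = ξ j := fun i j hij hx => by
    obtain ⟨r, hr, hball⟩ := Metric.eventually_nhds_iff_ball.1 hV
    have hd : ∀ ξ ∈ Metric.ball x r, HasFDerivAt (fun η => V η i)
        (ContinuousLinearMap.proj (R := 𝕜) (φ := fun _ : Fin 2 => 𝕜) j) ξ := fun ξ hξ => by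
      have := (hasFDerivAt_pi'.1 (hball ξ hξ)) i
      exact this.congr_fderiv (ContinuousLinearMap.ext fun h => hij _ h)
    have hd' : ∀ ξ, HasFDerivAt (fun η : Fin 2 → 𝕜 => η j)
        (ContinuousLinearMap.proj (R := 𝕜) (φ := fun _ : Fin 2 => 𝕜) j) ξ := fun ξ =>
      (ContinuousLinearMap.proj (R := 𝕜) (φ := fun _ : Fin 2 => 𝕜) j).hasFDerivAt
    have := Metric.isOpen_ball.eqOn_of_fderiv_eq (𝕜 := 𝕜)
      (convex_ball x r).isPreconnected
      (fun ξ hξ => (hd ξ hξ).differentiableAt.differentiableWithinAt)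
      (fun ξ hξ => (hd' ξ).differentiableAt.differentiableWithinAt)
      (fun ξ hξ => by rw [(hd ξ hξ).fderiv, (hd' ξ).fderiv]) (Metric.mem_ball_self hr) hx
    exact Filter.mem_of_superset (Metric.ball_mem_nhds x hr) this
  have e3 : (fun ξ => V ξ 3) =ᶠ[𝓝 x] pd 0 (fun ξ => V ξ 2) := (hcoord 2).mono fun ξ h => h.symm
  filter_upwards [hbase 0 0 (fun z h => by simp [jetForm_apply, D₁, D₂]) h0,
    hbase 1 1 (fun z h => by simp [jetForm_apply, D₁, D₂]) h1, e3, pd_congr e3 0, hcoord 3]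
    with ξ a0 a1 a3 a4 a4'
  ext i
  fin_cases i
  · exact a0
  · exact a1
  · rfl
  · exact a3
  · exact a4'.symm.trans a4

/-- The y-component of the jet differentiated along x² gives the first equation, its y₁₁-component
along x¹ the second. -/
lemma isSolutionAt_of_hasFDerivAt_jet {F G : (Fin 5 → 𝕜) → 𝕜} {u : (Fin 2 → 𝕜) → 𝕜}
    {x : Fin 2 → 𝕜} (hu : ContDiffAt 𝕜 3 u x)
    (h : ∀ᶠ ξ in 𝓝 x, HasFDerivAt (jet u) (jetForm F G (jet u ξ)) ξ) : IsSolutionAt F G u x := by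
  refine ⟨hu, h.mono fun ξ hξ => ⟨?_, ?_⟩⟩
  · have := congrArg (fun T => T (Pi.single 1 1)) ((hasFDerivAt_pi'.1 hξ) 2).fderiv
    exact this.trans (congrFun (jetForm_single_one F G _) 2)
  · have := congrArg (fun T => T (Pi.single 0 1)) ((hasFDerivAt_pi'.1 hξ) 4).fderiv
    exact this.trans (congrFun (jetForm_single_zero F G _) 4)

/-- A completely integrable system has a smooth solution with any prescribed jet near the
origin. -/
theorem exists_solution_with_jet {F G : (Fin 5 → 𝕜) → 𝕜} (hF : AnalyticAt 𝕜 F 0)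
    (hG : AnalyticAt 𝕜 G 0) (hint : IsCompletelyIntegrable F G) :
    ∀ᶠ z in 𝓝 (0 : Fin 5 → 𝕜), ∃ (u : (Fin 2 → 𝕜) → 𝕜) (x : Fin 2 → 𝕜), jet u x = z ∧
      (∀ n : ℕ, ContDiffAt 𝕜 n u x) ∧
      ∀ᶠ ξ in 𝓝 x, HasFDerivAt (jet u) (jetForm F G (jet u ξ)) ξ := by
  have hsymm : ∀ᶠ z in 𝓝 (0 : Fin 5 → 𝕜), ∀ k l,
      fderiv 𝕜 (jetForm F G) z (jetForm F G z k) l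
        = fderiv 𝕜 (jetForm F G) z (jetForm F G z l) k := by
    filter_upwards [hint.commute hF hG, hF.eventually_analyticAt, hG.eventually_analyticAt]
      with z hz hFz hGz k l
    -- By bilinearity only the mixed terms differ, and these agree because D₁ and D₂ commute.
    rw [fderiv_jetForm_apply hFz hGz, fderiv_jetForm_apply hFz hGz]
    simp only [jetForm_apply, map_add, map_smul, smul_add, hz]
    module
  have hA := analyticAt_jetForm hF hG
  filter_upwards [exists_solution_total_differential hA.contDiffAt hsymm,
    hA.eventually_analyticAt.eventually_nhds] with z hz hAz
  obtain ⟨U, hU0, hU⟩ := hz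
  set x : Fin 2 → 𝕜 := ![z 0, z 1] with hx
  set V : (Fin 2 → 𝕜) → (Fin 5 → 𝕜) := fun ξ => U (ξ - x) with hVdef
  have ht : Tendsto (fun ξ => ξ - x) (𝓝 x) (𝓝 0) := by
    have : Continuous fun ξ => ξ - x := by fun_prop
    simpa using this.tendsto x
  have hV : ∀ᶠ ξ in 𝓝 x, HasFDerivAt V (jetForm F G (V ξ)) ξ :=
    (ht.eventually hU).mono fun ξ hξ => by
      simpa using HasFDerivAt.comp ξ hξ ((hasFDerivAt_id ξ).sub_const x)
  have hVx : V x = z := by simp [hVdef, hU0]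
  have hjet := eventuallyEq_jet_of_hasFDerivAt_jetForm hV (by rw [hVx]; rfl) (by rw [hVx]; rfl)
  refine ⟨fun ξ => V ξ 2, x, hjet.eq_of_nhds.symm.trans hVx, fun n => ?_, ?_⟩
  · have hc : Tendsto V (𝓝 x) (𝓝 z) := by
      have := hV.self_of_nhds.continuousAt.tendsto
      rwa [hVx] at this
    have := (contDiffAt_of_total_differential
      ((hc.eventually hAz).mono fun ξ hξ => hξ.contDiffAt) hV n).self_of_nhds
    exact (contDiffAt_pi.1 this) 2
  · filter_upwards [hV, hjet.eventually_nhds] with ξ h1 h2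
    have := h1.congr_of_eventuallyEq (EventuallyEq.symm h2)
    rwa [h2.self_of_nhds] at this

end Solutions

/-! ### One-parameter families of functions and linearization along them. -/

section Families

variable {𝕜 : Type*} [RCLike 𝕜]

/-- A family of maps depending on a parameter which is the identity at the parameter `0` has an
inverse family. -/
lemma exists_inverse_family {P : Type*} [NormedAddCommGroup P] [NormedSpace 𝕜 P]
    [CompleteSpace P] {a : 𝕜 × P → P} {x : P} {n : WithTop ℕ∞} (hn : n ≠ 0)
    (ha : ContDiffAt 𝕜 n a (0, x)) (h0 : ∀ᶠ ξ in 𝓝 x, a (0, ξ) = ξ) :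
    ∃ b : 𝕜 × P → P, ContDiffAt 𝕜 n b (0, x) ∧
      (∀ᶠ y in 𝓝 ((0, x) : 𝕜 × P), a (y.1, b y) = y.2) ∧
      ∀ᶠ y in 𝓝 ((0, x) : 𝕜 × P), b (y.1, a y) = y.2 := by
  have hx : a (0, x) = x := h0.self_of_nhds
  -- The inverse function theorem is applied with the parameter kept as a coordinate; since `a (0,
  -- ·)` is the identity, the differential at (0, x) is unipotent.
  set f : 𝕜 × P → 𝕜 × P := fun y => (y.1, a y) with hf
  have hfc : ContDiffAt 𝕜 n f (0, x) := contDiffAt_fst.prodMk ha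
  have hfx : f (0, x) = (0, x) := by rw [hf]; simp only [hx]
  set a' := fderiv 𝕜 a (0, x) with ha'
  have had : HasFDerivAt a a' (0, x) := (ha.differentiableAt hn).hasFDerivAt
  have hinr : ∀ h : P, a' (0, h) = h := fun h => by
    have h1 : HasFDerivAt (fun ξ : P => a (0, ξ)) (a'.comp (ContinuousLinearMap.inr 𝕜 𝕜 P)) x :=
      HasFDerivAt.comp x had (hasFDerivAt_prodMk_right (0 : 𝕜) x)
    have h2 : HasFDerivAt (fun ξ : P => a (0, ξ)) (ContinuousLinearMap.id 𝕜 P) x :=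
      (hasFDerivAt_id x).congr_of_eventuallyEq h0
    exact congrArg (fun T => T h) (h1.unique h2)
  have hsplit : ∀ y : 𝕜 × P, a' y = a' (y.1, 0) + y.2 := fun y => by
    conv_rhs => rw [← hinr y.2]
    rw [← map_add]
    simp
  let f' : (𝕜 × P) ≃L[𝕜] (𝕜 × P) := ContinuousLinearEquiv.equivOfInverse
    ((ContinuousLinearMap.fst 𝕜 𝕜 P).prod a')
    ((ContinuousLinearMap.fst 𝕜 𝕜 P).prod (ContinuousLinearMap.snd 𝕜 𝕜 P
      - (a'.comp (ContinuousLinearMap.inl 𝕜 𝕜 P)).comp (ContinuousLinearMap.fst 𝕜 𝕜 P)))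
    (fun y => by
      refine Prod.ext rfl ?_
      change a' y - a' (y.1, 0) = y.2
      rw [hsplit y, add_sub_cancel_left])
    (fun y => by
      refine Prod.ext rfl ?_
      change a' (y.1, y.2 - a' (y.1, 0)) = y.2
      exact (hsplit _).trans (add_sub_cancel _ _))
  have hf' : HasFDerivAt f (f' : (𝕜 × P) →L[𝕜] (𝕜 × P)) (0, x) := hasFDerivAt_fst.prodMk had
  have hg := hfc.to_localInverse hf' hn
  have hst : HasStrictFDerivAt f (f' : (𝕜 × P) →L[𝕜] (𝕜 × P)) (0, x) :=
    hfc.hasStrictFDerivAt' hf' hn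
  have hr := hst.eventually_right_inverse
  have hl := hst.eventually_left_inverse
  rw [hfx] at hg hr
  refine ⟨fun y => (hst.localInverse f f' (0, x) y).2, contDiffAt_snd.comp _ hg, ?_, ?_⟩
  · filter_upwards [hr] with y hy
    have h1 := congrArg Prod.fst hy
    have h2 := congrArg Prod.snd hy
    change (hst.localInverse f f' (0, x) y).1 = y.1 at h1
    rw [← h1]
    exact h2
  · filter_upwards [hl] with y hy
    exact congrArg Prod.snd hy

/-- The partial derivative of a family of functions along the fibres. -/
def sliceD {n : ℕ} (i : Fin n) (f : 𝕜 × (Fin n → 𝕜) → 𝕜) (y : 𝕜 × (Fin n → 𝕜)) : 𝕜 :=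
  pd i (fun η => f (y.1, η)) y.2

/-- The derivative of a family of functions with respect to the parameter. -/
def paramD {n : ℕ} (f : 𝕜 × (Fin n → 𝕜) → 𝕜) (y : 𝕜 × (Fin n → 𝕜)) : 𝕜 :=
  fderiv 𝕜 f y (1, 0)

variable {n : ℕ} {f : 𝕜 × (Fin n → 𝕜) → 𝕜} {y : 𝕜 × (Fin n → 𝕜)}

lemma fderiv_slice_apply (hf : DifferentiableAt 𝕜 f y) (w : Fin n → 𝕜) :
    fderiv 𝕜 (fun η => f (y.1, η)) y.2 w = fderiv 𝕜 f y (0, w) := by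
  have h1 : HasFDerivAt (fun η => f (y.1, η))
      ((fderiv 𝕜 f y).comp (ContinuousLinearMap.inr 𝕜 𝕜 (Fin n → 𝕜))) y.2 :=
    HasFDerivAt.comp y.2 hf.hasFDerivAt (hasFDerivAt_prodMk_right y.1 y.2)
  rw [h1.fderiv]
  rfl

lemma sliceD_eq (hf : DifferentiableAt 𝕜 f y) (i : Fin n) :
    sliceD i f y = fderiv 𝕜 f y (0, Pi.single i 1) := fderiv_slice_apply hf _

lemma eventually_sliceD_eq {m : ℕ} (hf : ContDiffAt 𝕜 (m + 1 : ℕ) f y) (i : Fin n) :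
    sliceD i f =ᶠ[𝓝 y] fun w => fderiv 𝕜 f w (0, Pi.single i 1) := by
  filter_upwards [hf.eventually (by simp)] with w hw
  exact sliceD_eq (hw.differentiableAt (by simp)) i

lemma contDiffAt_fderiv_apply {m : ℕ} (hf : ContDiffAt 𝕜 (m + 1 : ℕ) f y)
    (v : 𝕜 × (Fin n → 𝕜)) : ContDiffAt 𝕜 m (fun w => fderiv 𝕜 f w v) y :=
  (hf.fderiv_right (m := m) (by norm_cast)).clm_apply contDiffAt_const

lemma contDiffAt_sliceD {m : ℕ} (hf : ContDiffAt 𝕜 (m + 1 : ℕ) f y) (i : Fin n) :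
    ContDiffAt 𝕜 m (sliceD i f) y :=
  (contDiffAt_fderiv_apply hf _).congr_of_eventuallyEq (eventually_sliceD_eq hf i)

lemma contDiffAt_paramD {m : ℕ} (hf : ContDiffAt 𝕜 (m + 1 : ℕ) f y) :
    ContDiffAt 𝕜 m (paramD f) y :=
  contDiffAt_fderiv_apply hf _

lemma paramD_sliceD (hf : ContDiffAt 𝕜 (2 : ℕ) f y) (i : Fin n) :
    paramD (sliceD i f) y = sliceD i (paramD f) y := by
  have hd : DifferentiableAt 𝕜 (fderiv 𝕜 f) y :=
    (hf.fderiv_right (m := 1) (by norm_num)).differentiableAt (by norm_num)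
  have hc : ∀ v w : 𝕜 × (Fin n → 𝕜),
      fderiv 𝕜 (fun z => fderiv 𝕜 f z v) y w = fderiv 𝕜 (fderiv 𝕜 f) y w v := fun v w => by
    rw [fderiv_clm_apply hd (differentiableAt_const _)]
    simp
  rw [sliceD_eq ((contDiffAt_paramD (m := 1) hf).differentiableAt (by norm_num)), paramD,
    (eventually_sliceD_eq (m := 1) hf i).fderiv_eq, hc]
  unfold paramD
  rw [hc]
  exact hf.isSymmSndFDerivAt (by simp) _ _

lemma sliceD_congr {g : 𝕜 × (Fin n → 𝕜) → 𝕜} (h : f =ᶠ[𝓝 y] g) (i : Fin n) :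
    sliceD i f =ᶠ[𝓝 y] sliceD i g := by
  filter_upwards [h.eventually_nhds] with w hw
  have ht : Tendsto (fun η => (w.1, η)) (𝓝 w.2) (𝓝 w) :=
    (Continuous.prodMk_right w.1).tendsto w.2
  exact (pd_congr (ht.eventually hw) i).self_of_nhds

/-- The derivative in the direction of the parameter of a function that vanishes at the parameter
`0` and along a curve transversal to the fibres. -/
lemma paramD_eq_zero {x : Fin n → 𝕜} {c : 𝕜 → (Fin n → 𝕜)} (hf : DifferentiableAt 𝕜 f (0, x))
    (hc : DifferentiableAt 𝕜 c 0) (hc0 : c 0 = x) (hf0 : ∀ᶠ η in 𝓝 x, f (0, η) = 0)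
    (hfc : ∀ᶠ t in 𝓝 (0 : 𝕜), f (t, c t) = 0) : paramD f (0, x) = 0 := by
  have h1 : HasFDerivAt (fun t => (t, c t)) ((ContinuousLinearMap.id 𝕜 𝕜).prod (fderiv 𝕜 c 0))
    (0 : 𝕜) := (hasFDerivAt_id 0).prodMk hc.hasFDerivAt
  have hf' : HasFDerivAt f (fderiv 𝕜 f (0, x)) (0, c 0) := by rw [hc0]; exact hf.hasFDerivAt
  have h2 : HasFDerivAt (fun t => f (t, c t)) _ (0 : 𝕜) := HasFDerivAt.comp (0 : 𝕜) hf' h1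
  have h3 : HasFDerivAt (fun t => f (t, c t)) (0 : 𝕜 →L[𝕜] 𝕜) (0 : 𝕜) :=
    (hasFDerivAt_const (0 : 𝕜) 0).congr_of_eventuallyEq hfc
  have h4 : fderiv 𝕜 f (0, x) (1, fderiv 𝕜 c 0 1) = 0 := congrArg (fun T => T 1) (h2.unique h3)
  have h5 : fderiv 𝕜 f (0, x) (0, fderiv 𝕜 c 0 1) = 0 := by
    rw [← fderiv_slice_apply hf]
    have : (fun η => f (((0, x) : 𝕜 × (Fin n → 𝕜)).1, η)) =ᶠ[𝓝 x] fun _ => 0 := hf0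
    rw [this.fderiv_eq]
    simp
  have h6 : ((1, fderiv 𝕜 c 0 1) : 𝕜 × (Fin n → 𝕜)) = (1, 0) + (0, fderiv 𝕜 c 0 1) := by simp
  rw [h6, map_add, h5, add_zero] at h4
  exact h4

/-- Linearization of a differential equation along a family of solutions. -/
lemma paramD_eq_of_family {N : (Fin 5 → 𝕜) → 𝕜} {v e : 𝕜 × (Fin 2 → 𝕜) → 𝕜} {x : Fin 2 → 𝕜}
    {c : 𝕜 → (Fin 2 → 𝕜)} (hv : ContDiffAt 𝕜 (3 : ℕ) v (0, x))
    (he : DifferentiableAt 𝕜 e (0, x))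
    (hN : DifferentiableAt 𝕜 N (jet (fun η => v (0, η)) x))
    (hc : DifferentiableAt 𝕜 c 0) (hc0 : c 0 = x)
    (h0 : ∀ᶠ η in 𝓝 x, e (0, η) = N (jet (fun η => v (0, η)) η))
    (ht : ∀ᶠ t in 𝓝 (0 : 𝕜), e (t, c t) = N (jet (fun η => v (t, η)) (c t))) :
    paramD e (0, x) = fderiv 𝕜 N (jet (fun η => v (0, η)) x)
      ![0, 0, paramD v (0, x), sliceD 0 (paramD v) (0, x),
        sliceD 0 (sliceD 0 (paramD v)) (0, x)] := by
  set J : 𝕜 × (Fin 2 → 𝕜) → (Fin 5 → 𝕜) := fun y => jet (fun η => v (y.1, η)) y.2 with hJ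
  have hs := contDiffAt_sliceD (m := 2) hv 0
  have hss := contDiffAt_sliceD (m := 1) hs 0
  have p1 : paramD (sliceD 0 v) (0, x) = sliceD 0 (paramD v) (0, x) :=
    paramD_sliceD (hv.of_le (by norm_num)) 0
  have p2 : paramD (sliceD 0 (sliceD 0 v)) (0, x) = sliceD 0 (sliceD 0 (paramD v)) (0, x) := by
    rw [paramD_sliceD hs 0]
    refine (sliceD_congr ?_ 0).self_of_nhds
    filter_upwards [hv.eventually (by simp)] with w hw
    exact paramD_sliceD (hw.of_le (by norm_num)) 0
  have hJd : HasFDerivAt J (ContinuousLinearMap.pi ![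
      (ContinuousLinearMap.proj (R := 𝕜) (φ := fun _ : Fin 2 => 𝕜) 0).comp
        (ContinuousLinearMap.snd 𝕜 𝕜 _),
      (ContinuousLinearMap.proj (R := 𝕜) (φ := fun _ : Fin 2 => 𝕜) 1).comp
        (ContinuousLinearMap.snd 𝕜 𝕜 _),
      fderiv 𝕜 v (0, x), fderiv 𝕜 (sliceD 0 v) (0, x),
      fderiv 𝕜 (sliceD 0 (sliceD 0 v)) (0, x)]) (0, x) := by
    rw [hasFDerivAt_pi]
    intro i
    fin_cases i
    · exact ((ContinuousLinearMap.proj (R := 𝕜) (φ := fun _ : Fin 2 => 𝕜) 0).comp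
        (ContinuousLinearMap.snd 𝕜 𝕜 (Fin 2 → 𝕜))).hasFDerivAt
    · exact ((ContinuousLinearMap.proj (R := 𝕜) (φ := fun _ : Fin 2 => 𝕜) 1).comp
        (ContinuousLinearMap.snd 𝕜 𝕜 (Fin 2 → 𝕜))).hasFDerivAt
    · exact (hv.differentiableAt (by norm_num)).hasFDerivAt
    · exact (hs.differentiableAt (by norm_num)).hasFDerivAt
    · exact (hss.differentiableAt (by norm_num)).hasFDerivAt
  have hNJ : HasFDerivAt (fun y => N (J y)) _ (0, x) := HasFDerivAt.comp (0, x) hN.hasFDerivAt hJd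
  -- At time t the equation is assumed only at the point `c t`. Together with its validity on the
  -- fibre t = 0 this determines the time derivative at (0, x).
  have key := paramD_eq_zero (f := fun y => e y - N (J y)) (he.sub hNJ.differentiableAt) hc hc0
    (h0.mono fun η hη => sub_eq_zero.2 hη) (ht.mono fun t h => sub_eq_zero.2 h)
  rw [paramD, (he.hasFDerivAt.fun_sub hNJ).fderiv, sub_apply, sub_eq_zero] at key
  rw [paramD, key, ContinuousLinearMap.comp_apply, ← p1, ← p2]
  congr 1
  ext i
  fin_cases i <;> rfl

end Families

/-! ### Infinitesimal symmetries satisfy the determining equations. -/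

section Linearization

variable {𝕜 : Type*} [RCLike 𝕜]

lemma contDiffAt_graphPt {u : (Fin 2 → 𝕜) → 𝕜} {x : Fin 2 → 𝕜} {n : WithTop ℕ∞}
    (hu : ContDiffAt 𝕜 n u x) : ContDiffAt 𝕜 n (graphPt u) x := by
  refine contDiffAt_pi.2 fun i => ?_
  fin_cases i
  · exact (contDiff_apply 𝕜 𝕜 (0 : Fin 2)).contDiffAt
  · exact (contDiff_apply 𝕜 𝕜 (1 : Fin 2)).contDiffAt
  · exact hu

variable (𝕜) in
/-- `basePt` as a continuous linear map. -/
def basePtL : (Fin 3 → 𝕜) →L[𝕜] (Fin 2 → 𝕜) := projInit 𝕜 (by norm_num)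

lemma basePtL_apply (p : Fin 3 → 𝕜) : basePtL 𝕜 p = basePt p := by
  ext i; fin_cases i <;> rfl

lemma jet_congr {u w : (Fin 2 → 𝕜) → 𝕜} {x : Fin 2 → 𝕜} (h : u =ᶠ[𝓝 x] w) :
    jet u =ᶠ[𝓝 x] jet w := by
  filter_upwards [h, pd_congr h 0, pd_congr (pd_congr h 0) 0] with ξ h0 h1 h2
  simp only [jet, h0, h1, h2]

lemma tendsto_jet {u : (Fin 2 → 𝕜) → 𝕜} {x : Fin 2 → 𝕜} {A : (Fin 2 → 𝕜) →L[𝕜] (Fin 5 → 𝕜)}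
    (h : HasFDerivAt (jet u) A x) : Tendsto (jet u) (𝓝 x) (𝓝 (jet u x)) :=
  h.continuousAt

lemma IsSolutionAt.congr {F G : (Fin 5 → 𝕜) → 𝕜} {u w : (Fin 2 → 𝕜) → 𝕜} {x : Fin 2 → 𝕜}
    (hu : IsSolutionAt F G u x) (h : u =ᶠ[𝓝 x] w) : IsSolutionAt F G w x := by
  refine ⟨hu.1.congr_of_eventuallyEq h.symm, ?_⟩
  filter_upwards [hu.2, jet_congr h, pd_congr h 1, pd_congr (pd_congr (pd_congr h 0) 0) 0]
    with ξ h0 h1 h2 h3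
  rw [← h1, ← h2, ← h3]
  exact h0

/-- The image of the graph of `u` under a flow is, for small times, the graph of a smooth family
of functions, whose derivative with respect to the time is the characteristic of the generating
vector field. -/
lemma exists_family_of_flow {φ : 𝕜 → (Fin 3 → 𝕜) → (Fin 3 → 𝕜)} {L : (Fin 3 → 𝕜) → (Fin 3 → 𝕜)}
    {u : (Fin 2 → 𝕜) → 𝕜} {x : Fin 2 → 𝕜} {n : ℕ} (hu : ContDiffAt 𝕜 (n + 1 : ℕ) u x)
    (hφ : AnalyticAt 𝕜 (fun q : 𝕜 × (Fin 3 → 𝕜) => φ q.1 q.2) (0, graphPt u x))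
    (hφ0 : ∀ᶠ p in 𝓝 (graphPt u x), φ 0 p = p)
    (hφL : ∀ᶠ p in 𝓝 (graphPt u x), HasDerivAt (fun t => φ t p) (L p) 0) :
    ∃ v : 𝕜 × (Fin 2 → 𝕜) → 𝕜, ContDiffAt 𝕜 (n + 1 : ℕ) v (0, x) ∧
      (fun η => v (0, η)) =ᶠ[𝓝 x] u ∧
      (∀ᶠ η in 𝓝 x, paramD v (0, η) = L (graphPt u η) 2 - pd 0 u η * L (graphPt u η) 0
        - pd 1 u η * L (graphPt u η) 1) ∧
      ∀ᶠ t in 𝓝 (0 : 𝕜), ∀ w : (Fin 2 → 𝕜) → 𝕜,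
        (∀ᶠ ξ in 𝓝 x, φ t (graphPt u ξ) = graphPt w (basePt (φ t (graphPt u ξ)))) →
        w =ᶠ[𝓝 (basePt (φ t (graphPt u x)))] fun η => v (t, η) := by
  set ψ : 𝕜 × (Fin 2 → 𝕜) → (Fin 3 → 𝕜) := fun y => φ y.1 (graphPt u y.2) with hψ
  have hgr := contDiffAt_graphPt hu
  have hψc : ContDiffAt 𝕜 (n + 1 : ℕ) ψ (0, x) := by
    have h2 : ContDiffAt 𝕜 (n + 1 : ℕ) (fun y : 𝕜 × (Fin 2 → 𝕜) => (y.1, graphPt u y.2)) (0, x) :=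
      contDiffAt_fst.prodMk (ContDiffAt.comp (0, x) hgr contDiffAt_snd)
    exact ContDiffAt.comp (0, x) (hφ.contDiffAt (n := ((n + 1 : ℕ) : WithTop ℕ∞))) h2
  -- The projection of the moved surface to the base is a family of maps that starts at the
  -- identity. Its inverse family `b` reparametrizes the surface as the graph of `v (t, ·)`.
  set a : 𝕜 × (Fin 2 → 𝕜) → (Fin 2 → 𝕜) := fun y => basePt (ψ y) with ha
  have hac : ContDiffAt 𝕜 (n + 1 : ℕ) a (0, x) := by
    have : a = fun y => basePtL 𝕜 (ψ y) := by funext y; rw [basePtL_apply]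
    rw [this]
    exact (basePtL 𝕜).contDiff.contDiffAt.comp (0, x) hψc
  have hgt : Tendsto (graphPt u) (𝓝 x) (𝓝 (graphPt u x)) := hgr.continuousAt
  have hψ0 : ∀ᶠ ξ in 𝓝 x, ψ (0, ξ) = graphPt u ξ := hgt.eventually hφ0
  have ha0 : ∀ᶠ ξ in 𝓝 x, a (0, ξ) = ξ := hψ0.mono fun ξ hξ => by
    change basePt (ψ (0, ξ)) = ξ
    rw [hξ]
    ext i; fin_cases i <;> rfl
  have hn : ((n + 1 : ℕ) : WithTop ℕ∞) ≠ 0 := by simp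
  obtain ⟨b, hb, hab, hba⟩ := exists_inverse_family hn hac ha0
  have hax : a (0, x) = x := ha0.self_of_nhds
  have hbx : b (0, x) = x := by
    have := hba.self_of_nhds
    rwa [hax] at this
  set v : 𝕜 × (Fin 2 → 𝕜) → 𝕜 := fun y => ψ (y.1, b y) 2 with hv
  have hvc : ContDiffAt 𝕜 (n + 1 : ℕ) v (0, x) := by
    have h1 : ContDiffAt 𝕜 (n + 1 : ℕ) (fun y => ψ (y.1, b y)) (0, x) := by
      refine ContDiffAt.comp (g := ψ) (0, x) ?_ (contDiffAt_fst.prodMk hb)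
      simp only [hbx]
      exact hψc
    exact contDiffAt_pi.1 h1 2
  have hva : ∀ᶠ y in 𝓝 ((0, x) : 𝕜 × (Fin 2 → 𝕜)), v (y.1, a y) = ψ y 2 := hba.mono fun y hy => by
    simp only [hv, hy]
  have h0x : Tendsto (fun η : Fin 2 → 𝕜 => ((0, η) : 𝕜 × (Fin 2 → 𝕜))) (𝓝 x) (𝓝 (0, x)) :=
    (Continuous.prodMk_right (0 : 𝕜)).tendsto x
  have hv0 : (fun η => v (0, η)) =ᶠ[𝓝 x] u := by
    filter_upwards [h0x.eventually hva, ha0, hψ0] with η h1 h2 h3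
    change v (0, a (0, η)) = ψ (0, η) 2 at h1
    rw [h2, h3] at h1
    exact h1
  refine ⟨v, hvc, hv0, ?_, ?_⟩
  -- Differentiating v(t, a(t, η)) = ψ(t, η) 2 at t = 0 gives v_t + u_{x¹} X¹ + u_{x²} X² = Y.
  · filter_upwards [hv0.eventually_nhds, h0x.eventually hva.eventually_nhds, ha0,
      h0x.eventually (hvc.eventually (by simp)), hgt.eventually hφL] with η hη0 hηv hηa hηc hηL
    have hvd := hηc.differentiableAt hn
    have ht0 : Tendsto (fun t : 𝕜 => (t, η)) (𝓝 0) (𝓝 (0, η)) :=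
      (Continuous.prodMk_left η).tendsto 0
    have d1 : HasDerivAt (fun t => a (t, η)) (basePt (L (graphPt u η))) 0 := by
      rw [← basePtL_apply]
      have := (basePtL 𝕜).hasFDerivAt.comp_hasDerivAt (0 : 𝕜) hηL
      refine this.congr_of_eventuallyEq (Eventually.of_forall fun t => ?_)
      exact (basePtL_apply _).symm
    have d2 : HasDerivAt (fun t => v (t, a (t, η)))
        (fderiv 𝕜 v (0, η) (1, basePt (L (graphPt u η)))) 0 := by
      have hvd' : HasFDerivAt v (fderiv 𝕜 v (0, η)) (0, a (0, η)) := by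
        rw [hηa]; exact hvd.hasFDerivAt
      exact HasFDerivAt.comp_hasDerivAt (0 : 𝕜) hvd' ((hasDerivAt_id (0 : 𝕜)).prodMk d1)
    have d3 : HasDerivAt (fun t => v (t, a (t, η))) (L (graphPt u η) 2) 0 :=
      (hasDerivAt_pi.1 hηL 2).congr_of_eventuallyEq (ht0.eventually hηv)
    have e1 := d2.unique d3
    have e2 : ((1, basePt (L (graphPt u η))) : 𝕜 × (Fin 2 → 𝕜))
        = (1, 0) + (0, basePt (L (graphPt u η))) := by simp
    have e3 : fderiv 𝕜 v (0, η) (0, basePt (L (graphPt u η)))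
        = L (graphPt u η) 0 * pd 0 u η + L (graphPt u η) 1 * pd 1 u η := by
      rw [← fderiv_slice_apply hvd]
      have : (fun ξ => v (((0, η) : 𝕜 × (Fin 2 → 𝕜)).1, ξ)) =ᶠ[𝓝 η] u := hη0
      rw [this.fderiv_eq, fderiv_eq_sum_pd, Fin.sum_univ_two]
      rfl
    rw [e2, map_add, e3] at e1
    rw [paramD]
    linear_combination e1
  · have htx : Tendsto (fun t : 𝕜 => (t, a (t, x))) (𝓝 0) (𝓝 (0, x)) := by
      have h1 : ContinuousAt (fun t : 𝕜 => (t, a (t, x))) 0 :=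
        continuousAt_id.prodMk (ContinuousAt.comp (f := fun t : 𝕜 => (t, x)) (x := (0 : 𝕜))
          hac.continuousAt (Continuous.prodMk_left x).continuousAt)
      have h2 := h1.tendsto
      rwa [hax] at h2
    have ht0 : Tendsto (fun t : 𝕜 => (t, x)) (𝓝 0) (𝓝 (0, x)) :=
      (Continuous.prodMk_left x).tendsto 0
    filter_upwards [htx.eventually hab.eventually_nhds, ht0.eventually hba,
      htx.eventually (hb.eventually (by simp))] with t hta htb htc w hw
    have hslice : Tendsto (fun η => (t, η)) (𝓝 (a (t, x))) (𝓝 (t, a (t, x))) :=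
      (Continuous.prodMk_right t).tendsto _
    have hbt : Tendsto (fun η => b (t, η)) (𝓝 (a (t, x))) (𝓝 x) := by
      have h1 : Tendsto b (𝓝 (t, a (t, x))) (𝓝 (b (t, a (t, x)))) := htc.continuousAt
      rw [show b (t, a (t, x)) = x from htb] at h1
      exact h1.comp hslice
    filter_upwards [hbt.eventually hw, hslice.eventually hta] with η h1 h2
    have h3 := congrFun h1 2
    have h4 : basePt (φ t (graphPt u (b (t, η)))) = η := h2
    rw [h4] at h3
    exact h3.symm

/-- Infinitesimal symmetries satisfy the determining equations. -/
theorem IsInfinitesimalSymmetry.satisfiesDetermining {F G : (Fin 5 → 𝕜) → 𝕜}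
    {L : (Fin 3 → 𝕜) → (Fin 3 → 𝕜)} (hF : AnalyticAt 𝕜 F 0) (hG : AnalyticAt 𝕜 G 0)
    (hint : IsCompletelyIntegrable F G) (hL : IsInfinitesimalSymmetry F G L) :
    SatisfiesDetermining F G L := by
  obtain ⟨hLa, φ, ⟨hφ, hφ0, hφL⟩, U, hU, hsym⟩ := hL
  have hπ : Tendsto (fun z : Fin 5 → 𝕜 => (![z 0, z 1, z 2] : Fin 3 → 𝕜)) (𝓝 0) (𝓝 0) := by
    have : Tendsto (projInit 𝕜 (by norm_num : 3 ≤ 5)) (𝓝 0) (𝓝 0) := by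
      simpa using (projInit 𝕜 (by norm_num : 3 ≤ 5)).continuous.tendsto 0
    simpa only [funext projInit_three] using this
  have h0 : Tendsto (fun p : Fin 3 → 𝕜 => ((0, p) : 𝕜 × (Fin 3 → 𝕜))) (𝓝 0) (𝓝 (0, 0)) :=
    (Continuous.prodMk_right (0 : 𝕜)).tendsto 0
  have hφL' : ∀ᶠ p in 𝓝 (0 : Fin 3 → 𝕜), HasDerivAt (fun t => φ t p) (L p) 0 := by
    filter_upwards [h0.eventually hφL, hφ0] with p hp hp0
    have : HasDerivAt (fun t => φ t p) (L (φ 0 p)) 0 := hp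
    rwa [hp0] at this
  filter_upwards [exists_solution_with_jet hF hG hint, hU,
    hπ.eventually (h0.eventually hφ.eventually_analyticAt), hπ.eventually hφ0.eventually_nhds,
    hπ.eventually hφL'.eventually_nhds, hF.eventually_analyticAt.eventually_nhds,
    hG.eventually_analyticAt.eventually_nhds,
    (analyticAt_charFn hF hLa).eventually_analyticAt.eventually_nhds]
    with z hz hzU hzφ hzφ0 hzφL hzF hzG hzq
  -- The point of the skeleton is now the jet of a solution at `x`, so it suffices to prove the
  -- equations along this solution at `x`.
  obtain ⟨u, x, rfl, hu, hjet⟩ := hz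
  have hsol := isSolutionAt_of_hasFDerivAt_jet (hu 3) hjet
  -- Four derivatives are needed: three in x¹ for the second equation, and one in time.
  obtain ⟨v, hv, hv0, hvL, hvt⟩ := exists_family_of_flow (hu 4) hzφ hzφ0 hzφL
  have hJt := tendsto_jet hjet.self_of_nhds
  set q := charFn F L with hq
  have hstep : ∀ {g : (Fin 5 → 𝕜) → 𝕜} {k : (Fin 2 → 𝕜) → 𝕜},
      (∀ᶠ z in 𝓝 (jet u x), AnalyticAt 𝕜 g z) → k =ᶠ[𝓝 x] (fun η => g (jet u η)) →
      pd 0 k =ᶠ[𝓝 x] (fun η => totDer G g (jet u η)) ∧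
      pd 1 k =ᶠ[𝓝 x] fun η => fderiv 𝕜 g (jet u η) (D₂ F G (jet u η)) := by
    intro g k hg hk
    refine ⟨(pd_congr hk 0).trans ?_, (pd_congr hk 1).trans ?_⟩
    · filter_upwards [hjet, hJt.eventually hg] with η h1 h2
      exact (pd_comp_of_hasFDerivAt_jetForm h1 h2.differentiableAt).1
    · filter_upwards [hjet, hJt.eventually hg] with η h1 h2
      exact (pd_comp_of_hasFDerivAt_jetForm h1 h2.differentiableAt).2
  -- As `u` is a solution, u_{x²} can be replaced by `F`, which turns the velocity into the
  -- characteristic.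
  have hq0 : (fun η => paramD v (0, η)) =ᶠ[𝓝 x] fun η => q (jet u η) := by
    filter_upwards [hvL, hsol.2] with η h1 h2
    rw [h1, h2.1]
    rfl
  have hq1 : ∀ᶠ z in 𝓝 (jet u x), AnalyticAt 𝕜 (totDer G q) z := by
    filter_upwards [hzG, hzq] with z h1 h2 using analyticAt_totDer h1 h2
  have hq2 : ∀ᶠ z in 𝓝 (jet u x), AnalyticAt 𝕜 (totDer G (totDer G q)) z := by
    filter_upwards [hzG, hq1] with z h1 h2 using analyticAt_totDer h1 h2
  have s0 := hstep hzq hq0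
  have s1 := hstep hq1 s0.1
  have s2 := hstep hq2 s1.1
  have hjv := jet_congr hv0
  have hzd : HasDerivAt (fun t => φ t (graphPt u x)) (L (graphPt u x)) 0 := hzφL.self_of_nhds
  have hc : DifferentiableAt 𝕜 (fun t => basePt (φ t (graphPt u x))) 0 := by
    have := ((basePtL 𝕜).hasFDerivAt.comp_hasDerivAt (0 : 𝕜) hzd).differentiableAt
    refine this.congr_of_eventuallyEq (Eventually.of_forall fun t => ?_)
    exact (basePtL_apply _).symm
  have hc0 : basePt (φ 0 (graphPt u x)) = x := by
    have : φ 0 (graphPt u x) = graphPt u x := hzφ0.self_of_nhds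
    rw [this]
    ext i; fin_cases i <;> rfl
  -- The neighbourhood on which `v (t, ·)` solves the system may depend on t without any uniformity;
  -- only the moved point itself is used below.
  have himage : ∀ᶠ t in 𝓝 (0 : 𝕜), IsSolutionAt F G (fun η => v (t, η))
      (basePt (φ t (graphPt u x))) := by
    filter_upwards [hsym, hvt] with t h1 h2
    obtain ⟨w, hw, hwg⟩ := h1 u x hsol hzU
    exact hw.congr (h2 w hwg)
  have hsol0 : IsSolutionAt F G (fun η => v (0, η)) x := hsol.congr hv0.symm
  have hd1 := contDiffAt_sliceD (m := 3) hv 1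
  have hd0 := contDiffAt_sliceD (m := 3) hv 0
  have hd00 := contDiffAt_sliceD (m := 2) hd0 0
  have hd000 := contDiffAt_sliceD (m := 1) hd00 0
  have hjx : jet (fun η => v (0, η)) x = jet u x := hjv.self_of_nhds
  have E1 := paramD_eq_of_family (N := F) (hv.of_le (by norm_num))
    (hd1.differentiableAt (by norm_num))
    (by rw [hjx]; exact hzF.self_of_nhds.differentiableAt) hc hc0
    (hsol0.2.mono fun η h => h.1) (himage.mono fun t h => h.2.self_of_nhds.1)
  have E2 := paramD_eq_of_family (N := G) (hv.of_le (by norm_num))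
    (hd000.differentiableAt (by norm_num))
    (by rw [hjx]; exact hzG.self_of_nhds.differentiableAt) hc hc0
    (hsol0.2.mono fun η h => h.2) (himage.mono fun t h => h.2.self_of_nhds.2)
  have hsw : ∀ {f : 𝕜 × (Fin 2 → 𝕜) → 𝕜}, ContDiffAt 𝕜 (2 : ℕ) f (0, x) →
      ∀ i, paramD (sliceD i f) =ᶠ[𝓝 (0, x)] sliceD i (paramD f) := by
    intro f hf i
    filter_upwards [hf.eventually (by simp)] with y hy using paramD_sliceD hy i
  have w1 : paramD (sliceD 1 v) (0, x) = sliceD 1 (paramD v) (0, x) :=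
    (hsw (hv.of_le (by norm_num)) 1).self_of_nhds
  have w3 : paramD (sliceD 0 (sliceD 0 (sliceD 0 v))) (0, x)
      = sliceD 0 (sliceD 0 (sliceD 0 (paramD v))) (0, x) :=
    ((hsw hd00 0).trans (sliceD_congr ((hsw (hd0.of_le (by norm_num)) 0).trans
      (sliceD_congr (hsw (hv.of_le (by norm_num)) 0) 0)) 0)).self_of_nhds
  have p0 : paramD v (0, x) = q (jet u x) := hq0.self_of_nhds
  have p1 : sliceD 0 (paramD v) (0, x) = totDer G q (jet u x) := s0.1.self_of_nhds
  have p2 : sliceD 0 (sliceD 0 (paramD v)) (0, x) = totDer G (totDer G q) (jet u x) :=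
    s1.1.self_of_nhds
  rw [w1, hjx, p0, p1, p2] at E1
  rw [w3, hjx, p0, p1, p2] at E2
  exact ⟨s0.2.self_of_nhds.symm.trans E1, s2.1.self_of_nhds.symm.trans E2⟩

end Linearization

end EFive

end

theorem corollary8p87 {𝕜 : Type*} [RCLike 𝕜] (F G : (Fin 5 → 𝕜) → 𝕜)
    (hF : AnalyticAt 𝕜 F 0) (hG : AnalyticAt 𝕜 G 0)
    (hint : EFive.IsCompletelyIntegrable F G) (hnorm : EFive.IsNormalized F G) :
    (∀ L L' : (Fin 3 → 𝕜) → (Fin 3 → 𝕜),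
      EFive.IsInfinitesimalSymmetry F G L → EFive.IsInfinitesimalSymmetry F G L' →
      EFive.initialCoeffs L = EFive.initialCoeffs L' →
      L =ᶠ[𝓝 (0 : Fin 3 → 𝕜)] L') ∧
    Module.rank 𝕜 (EFive.SYM F G) ≤ 10 :=
  EFive.uniqueness_and_rank_le hF hG hnorm fun _ hL => hL.satisfiesDetermining hF hG hint
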